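/- **Setting.** A client $C$ and a server $S$ run fixed-point model predictive control with state dimension $n_x$, input dimension $m$, horizon $N_h\ge 1$, and $d=N_hm$ optimization variables. A real quantity $a$ is represented with $l_f$ fractional bits by the integer $2^{l_f}a$. The data are $\bar H_f\in\mathbb R^{d\times d}$, $\bar F_f\in\mathbb R^{n_x\times d}$ (already divided by the step-size constant), $\bar\eta$, the state $x$, the box $\bar{\mathcal U}=\{-l_u\preceq U\preceq h_u\}$, a previous solution $U_w$, numbers of iterations $K_c,K_w\ge1$, and a cold-start flag. The functionality gives the server nothing and gives the client the first $m$ components of $U_K$, where $K=K_c$, $U_0=0$ for a cold start, $K=K_w$, $U_0=((U_w)_{m+1:d},0_m)$ for a warm start, $z_0=U_0$, and for $k=0,\dots,K-1$ $$t_k=(I-\bar H_f)z_k-\bar F_f^{\top}x,\quad U_{k+1}=\Pi_{\bar{\mathcal U}}(\lfloor t_k\rfloor_{l_f}),\quad z_{k+1}=(1+\bar\eta)U_{k+1}-\bar\eta U_k ,$$ $\lfloor\cdot\rfloor_{l_f}$ being componentwise truncation (rounding down) to $l_f$ fractional bits. **Encryption.** Paillier keys for security parameter $\sigma$: $N=pq$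 with distinct primes $p,q$ drawn from a given distribution, having exactly $\sigma$ bits for all large $\sigma$, with $\gcd(N,(p-1)(q-1))=1$; a base $g\in\mathbb Z_{N^2}$ of order $N$ chosen from $(1^\sigma,N)$ by a given probabilistic polynomial-time algorithm; $pk=(N,g)$, $sk=(\gamma,\delta)$, $\gamma=\mathrm{lcm}(p-1,q-1)$, $\delta=((g^\gamma\bmod N^2-1)/N)^{-1}\bmod N$. The encryption of $a\in\mathbb Z_N$ is $[[a]]=g^ar^N\bmod N^2$ with a fresh uniform $r\in\mathbb Z_N^*$; $[[a]]\oplus[[b]]$ is the product modulo $N^2$, $b\otimes[[a]]=[[a]]^{b\bmod N}$, and both operations extend to vectors and matrices. **Protocol.** The client holds $x,\bar{\mathcal U},pk,sk$; the server holds $\bar H_f,\bar F_f,\bar\eta,pk,[[U_w]]$; both hold $n_x,m,N_h,K_c,K_w,l_i,l_f$ and the flag ($l_i$ is the number of integer bits). The client sends $[[x]]$. The server forms $[[U_0]]$, encrypting the zeros itself, and $[[z_0]]=[[U_0]]$. For $k=0,\dots,K-1$ the server sends $[[t_k]]=(I-\bar H_f)\otimes[[z_k]]\oplus(-\bar F_f^{\top})\otimes[[x]]$;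 the client decrypts (reading residues as integers of least absolute value), truncates, projects onto $\bar{\mathcal U}$ to get $U_{k+1}$, and sends $[[U_{k+1}]]$; the server forms $[[z_{k+1}]]=(1+\bar\eta)\otimes[[U_{k+1}]]\oplus(-\bar\eta)\otimes[[U_k]]$. The coefficients are scaled by powers of $2^{l_f}$, so that all operations act on integers and the decrypted integer is $2^{3l_f}t_k$. The client outputs the first $m$ components of $U_K$. The server's view consists of its input, the random values it used for its encryptions, and the received messages $[[x]],[[U_1]],\dots,[[U_K]]$. An instance of the data is admissible at $\sigma$ if there is no overflow: $3\cdot 2^{3l_f}|t_k^i|<N$ for all $k<K$, all $i$ and all $N$ that can be generated at $\sigma$. **Theorem.** Assume the decisional composite residuosity (DCR) assumption for the given distribution of $(p,q)$: given $N$, uniformly random $N$-th residues in $\mathbb Z_{N^2}^*$ are computationally indistinguishable from uniformly random elements of $\mathbb Z_{N^2}^*$. Then the protocol privately computes its functionality with respect to a semi-honest server: 1. for every $\sigma$, every instance that is admissible at $\sigma$, and every outcome of all random choices, the client's output is the one prescribed by the functionality; 2. there is a probabilistic polynomial-time simulator that, given only $1^\sigma$, the server's input and the server's (empty) output, produces a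 view that is computationally indistinguishable from the server's real view. That is, for all polynomials $\ell$ and all positive polynomials $P$, every probabilistic polynomial-time distinguisher with polynomial-length advice has advantage less than $1/P(\sigma)$ for all sufficiently large $\sigma$, uniformly over all instances that are admissible at $\sigma$ and have length at most $\ell(\sigma)$ (with $K_c,K_w$, $l_i,l_f$ and the dimensions counted in unary). Here probabilities are over the keys, the encryption of $U_w$, the coins of both parties, of the simulator and of the distinguisher; the DCR assumption, too, refers to probabilistic polynomial-time distinguishers with polynomial-length advice. -/

import Mathlib

open Filter

noncomputable section

/-! ## Data and probabilistic programs with a step count -/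

/-- Data handled by programs: natural numbers (in binary) and pairs. -/
inductive Val : Type
  | num (n : ℕ) : Val
  | pair (a b : Val) : Val
deriving DecidableEq

namespace Val

/-- Length of a datum in bits (up to a constant factor). -/
def size : Val → ℕ
  | num n => n.size + 1
  | pair a b => a.size + b.size + 1

/-- The number stored in a leaf (`0` for a pair). -/
def toNat : Val → ℕ
  | num n => n
  | pair _ _ => 0

def fst : Val → Val
  | num _ => num 0
  | pair a _ => a

def snd : Val → Val
  | num _ => num 0
  | pair _ b => b

def isPair : Val → Val
  | num _ => num 0
  | pair _ _ => num 1

/-- Lists are nested pairs, terminated by `num 0`. -/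
def list : List Val → Val
  | [] => num 0
  | a :: l => pair a (list l)

/-- Unary notation, of length proportional to `n`. -/
def unary (n : ℕ) : Val := list (List.replicate n (num 0))

def ofBool (b : Bool) : Val := num b.toNat

/-- Integers as sign and absolute value. -/
def ofInt (z : ℤ) : Val := pair (ofBool (decide (z < 0))) (num z.natAbs)

def vec {k : ℕ} (f : Fin k → Val) : Val := list (List.ofFn f)

def ofIntVec {k : ℕ} (f : Fin k → ℤ) : Val := vec fun i => ofInt (f i)

def ofIntMatrix {k l : ℕ} (A : Matrix (Fin k) (Fin l) ℤ) : Val := vec fun i => ofIntVec (A i)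

/-- A vector of residues, each given by its representative in `{0, …, n - 1}`. -/
def ofZModVec {k n : ℕ} (f : Fin k → ZMod n) : Val := vec fun i => num (f i).val

end Val

/-- Elementary operations. -/
inductive Op : Type
  | const (v : Val)
  | fst | snd | isPair
  | add | sub | mul | div | mod | le

/-- The arithmetic operations act on the two numbers stored in a pair. -/
def Op.eval : Op → Val → Val
  | .const v, _ => v
  | .fst, v => v.fst
  | .snd, v => v.snd
  | .isPair, v => v.isPair
  | .add, v => .num (v.fst.toNat + v.snd.toNat)
  | .sub, v => .num (v.fst.toNat - v.snd.toNat)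
  | .mul, v => .num (v.fst.toNat * v.snd.toNat)
  | .div, v => .num (v.fst.toNat / v.snd.toNat)
  | .mod, v => .num (v.fst.toNat % v.snd.toNat)
  | .le, v => .ofBool (decide (v.fst.toNat ≤ v.snd.toNat))

/-- Probabilistic while-programs, transforming one datum into another. -/
inductive Prog : Type
  | skip
  | op (o : Op)
  /-- toss a fair coin, discarding the input -/
  | coin
  /-- first `P`, then `Q` -/
  | seq (P Q : Prog)
  /-- run `P` and then `Q` on copies of the input, and pair the results -/
  | fork (P Q : Prog)
  /-- run `C` on a copy of the input; then run `Q` if the result is `0`, and `P` otherwise -/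
  | cond (C P Q : Prog)
  /-- while `C`, run on a copy of the current datum, gives a result other than `0`, run `P` -/
  | loop (C P : Prog)

/-- Distribution of an outcome: `none` if the time allowance for loops is exhausted, otherwise the
resulting datum with the number of steps that were spent. -/
abbrev Outcome : Type := PMF (Option (Val × ℕ))

namespace Outcome

/-- Result `v` after `c` steps. -/
def ret (v : Val) (c : ℕ) : Outcome := PMF.pure (some (v, c))

/-- Continue with `f` on the result, adding up the steps, and `c` further ones. -/
def andThen (μ : Outcome) (c : ℕ) (f : Val → Outcome) : Outcome :=
  μ.bind fun o => match o with
    | none => PMF.pure none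
    | some (v, k) => (f v).map (Option.map fun w => (w.1, c + k + w.2))

/-- At most `T` tests of the loop condition. -/
def whileLoop (C P : Val → Outcome) : ℕ → Val → Outcome
  | 0, _ => PMF.pure none
  | T + 1, v => (C v).andThen (1 + v.size) fun t =>
      if t = .num 0 then ret v 0 else (P v).andThen 0 (whileLoop C P T)

end Outcome

open Outcome in
/-- Execution of a program; every loop may test its condition at most `T` times. The number of
steps of each operation is at least the length of the data that it reads, copies and writes
(logarithmic cost). -/
def Prog.run (T : ℕ) : Prog → Val → Outcome
  | .skip, v => ret v 1
  | .op o, v => ret (o.eval v) (1 + v.size + (o.eval v).size)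
  | .coin, v => (PMF.uniformOfFintype Bool).bind fun b => ret (.ofBool b) (1 + v.size)
  | .seq P Q, v => (P.run T v).andThen 1 (Q.run T)
  | .fork P Q, v => (P.run T v).andThen (1 + v.size) fun a =>
      (Q.run T v).andThen 0 fun b => ret (.pair a b) 0
  | .cond C P Q, v => (C.run T v).andThen (1 + v.size) fun t =>
      if t = .num 0 then Q.run T v else P.run T v
  | .loop C P, v => whileLoop (C.run T) (P.run T) T v

/-- A probabilistic polynomial-time algorithm: on every input and for all outcomes of the coin
tosses, the program halts within a number of steps that is polynomial in the input length. -/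
structure PPT where
  prog : Prog
  time : Polynomial ℕ
  halts : ∀ v : Val, ∀ o ∈ (prog.run (time.eval v.size) v).support,
    ∃ w c, o = some (w, c) ∧ c ≤ time.eval v.size

/-- The distribution of the output of a probabilistic polynomial-time algorithm. -/
def PPT.out (A : PPT) (v : Val) : PMF Val :=
  (A.prog.run (A.time.eval v.size) v).map fun o => (o.map Prod.fst).getD (.num 0)

/-- Probability that `D` outputs `1` on the security parameter in unary, an advice string `a`, and a
sample from `X`. -/
def acceptProb (D : PPT) (n : ℕ) (a : Val) (X : PMF Val) : ℝ :=
  ((X.bind fun v => D.out (.pair (.unary n) (.pair a v))) (.num 1)).toReal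

/-- Computational indistinguishability of two ensembles indexed by the security parameter `n` and by
`i : I n`, with respect to probabilistic polynomial-time algorithms with polynomial advice. The
bound is uniform in `i`. -/
def CompIndist {I : ℕ → Type} (X Y : ∀ n, I n → PMF Val) : Prop :=
  ∀ D : PPT, ∀ advice : ℕ → Val,
    (∃ l : Polynomial ℕ, ∀ n, (advice n).size ≤ l.eval n) →
  ∀ p : Polynomial ℝ, (∀ n : ℕ, 0 < p.eval (n : ℝ)) →
  ∀ᶠ n : ℕ in atTop, ∀ i : I n,
    |acceptProb D n (advice n) (X n i) - acceptProb D n (advice n) (Y n i)| < 1 / p.eval (n : ℝ)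

/-! ## The Paillier cryptosystem -/

structure PublicKey where
  N : ℕ
  pos : 0 < N
  g : ZMod (N ^ 2)

instance (pk : PublicKey) : NeZero pk.N := ⟨pk.pos.ne'⟩

structure SecretKey (pk : PublicKey) where
  γ : ℕ
  δ : ZMod pk.N

namespace PublicKey

variable (pk : PublicKey)

abbrev Plain : Type := ZMod pk.N
abbrev Cipher : Type := ZMod (pk.N ^ 2)
/-- The random values used for encryption. -/
abbrev Nonce : Type := (ZMod pk.N)ˣ

def enc (a : pk.Plain) (r : pk.Nonce) : pk.Cipher :=
  pk.g ^ a.val * ((r : ZMod pk.N).val : pk.Cipher) ^ pk.N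

/-- `u ↦ (u - 1) / N`, for `u` congruent to `1` modulo `N`. -/
def logMap (u : pk.Cipher) : pk.Plain := (((u.val - 1) / pk.N : ℕ) : pk.Plain)

def dec (sk : SecretKey pk) (c : pk.Cipher) : pk.Plain := pk.logMap (c ^ sk.γ) * sk.δ

/-- Addition of encrypted messages. -/
def oplus (c d : pk.Cipher) : pk.Cipher := c * d

/-- Multiplication of an encrypted message by a known integer, taken modulo `N`. -/
def otimes (b : ℤ) (c : pk.Cipher) : pk.Cipher := c ^ (b : pk.Plain).val

/-- Multiplication of a vector of encrypted messages by a known integer matrix. -/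
def matVec {k l : ℕ} (A : Matrix (Fin k) (Fin l) ℤ) (c : Fin l → pk.Cipher) : Fin k → pk.Cipher :=
  fun i => ∏ j, pk.otimes (A i j) (c j)

/-- Encryption of a vector of integers, taken modulo `N`. -/
def encVec {k : ℕ} (v : Fin k → ℤ) (r : Fin k → pk.Nonce) : Fin k → pk.Cipher :=
  fun i => pk.enc (v i : pk.Plain) (r i)

/-- Independent uniform random values for the encryption of `k` messages. -/
def nonces (k : ℕ) : PMF (Fin k → pk.Nonce) := PMF.uniformOfFintype _

end PublicKey

/-- Prime factors of a Paillier modulus. -/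
structure Factors where
  p : ℕ
  q : ℕ
  prime_p : p.Prime
  prime_q : q.Prime
  ne : p ≠ q
  coprime : (p * q).Coprime ((p - 1) * (q - 1))

namespace Factors

variable (M : Factors)

def N : ℕ := M.p * M.q

theorem N_pos : 0 < M.N := Nat.mul_pos M.prime_p.pos M.prime_q.pos

instance : NeZero M.N := ⟨M.N_pos.ne'⟩

/-- The public key with base `g`. -/
def publicKey (g : ℕ) : PublicKey := ⟨M.N, M.N_pos, (g : ZMod (M.N ^ 2))⟩

def secretKey (g : ℕ) : SecretKey (M.publicKey g) where
  γ := Nat.lcm (M.p - 1) (M.q - 1)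
  δ := ((M.publicKey g).logMap ((M.publicKey g).g ^ Nat.lcm (M.p - 1) (M.q - 1)))⁻¹

end Factors

/-- Key generation: a distribution of the prime factors, which eventually have exactly `n` bits, and
an efficient choice of a base `g` of order `N` in `ℤ / N²`, given `n` (in unary) and `N`. -/
structure KeyGen where
  factors : ℕ → PMF Factors
  base : PPT
  factors_size : ∀ᶠ n : ℕ in atTop, ∀ M ∈ (factors n).support, M.p.size = n ∧ M.q.size = n
  base_order : ∀ n, ∀ M ∈ (factors n).support,
    ∀ v ∈ (base.out (.pair (.unary n) (.num M.N))).support,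
      orderOf (v.toNat : ZMod (M.N ^ 2)) = M.N

/-- A modulus `N` together with a uniformly random `N`-th residue modulo `N²`. -/
def residueSample (factors : ℕ → PMF Factors) (n : ℕ) : PMF Val :=
  (factors n).bind fun M =>
    (PMF.uniformOfFintype (ZMod (M.N ^ 2))ˣ).map fun r =>
      .pair (.num M.N) (.num ((r ^ M.N : (ZMod (M.N ^ 2))ˣ) : ZMod (M.N ^ 2)).val)

/-- A modulus `N` together with a uniformly random unit modulo `N²`. -/
def unitSample (factors : ℕ → PMF Factors) (n : ℕ) : PMF Val :=
  (factors n).bind fun M =>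
    (PMF.uniformOfFintype (ZMod (M.N ^ 2))ˣ).map fun r =>
      .pair (.num M.N) (.num (r : ZMod (M.N ^ 2)).val)

/-- The decisional composite residuosity assumption. -/
def DCR (factors : ℕ → PMF Factors) : Prop :=
  CompIndist (I := fun _ => Unit) (fun n _ => residueSample factors n)
    (fun n _ => unitSample factors n)

/-! ## The control problem and its functionality

All real quantities have a fixed-point representation with `lf` fractional bits; a quantity `a` is
given by the integer `2 ^ lf * a`. -/

/-- The parameters known to both parties. -/
structure Params where
  /-- state dimension -/
  n : ℕ
  /-- input dimension -/
  m : ℕ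
  /-- length of the horizon -/
  horizon : ℕ
  horizon_pos : 0 < horizon
  /-- number of iterations for a cold start -/
  Kc : ℕ
  /-- number of iterations for a warm start -/
  Kw : ℕ
  Kc_pos : 0 < Kc
  Kw_pos : 0 < Kw
  /-- number of integer bits -/
  li : ℕ
  /-- number of fractional bits -/
  lf : ℕ
  coldStart : Bool

namespace Params

variable (P : Params)

/-- Number of optimization variables. -/
def dim : ℕ := P.horizon * P.m

theorem m_le_dim : P.m ≤ P.dim := Nat.le_mul_of_pos_left _ P.horizon_pos

/-- Number of iterations. -/
def K : ℕ := if P.coldStart then P.Kc else P.Kw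

/-- The first `m` components. -/
def firstInput {α : Type} (U : Fin P.dim → α) : Fin P.m → α := fun i => U (Fin.castLE P.m_le_dim i)

def encode : Val := .list [.unary P.n, .unary P.m, .unary P.horizon, .unary P.Kc, .unary P.Kw,
  .unary P.li, .unary P.lf, .ofBool P.coldStart]

end Params

/-- The plaintext data of one execution. `H` and `F` stand for the matrices already divided by the
step-size constant, `η` for the momentum parameter. -/
structure Instance extends Params where
  H : Matrix (Fin toParams.dim) (Fin toParams.dim) ℤ
  F : Matrix (Fin n) (Fin toParams.dim) ℤ
  η : ℤ
  /-- current state -/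
  x : Fin n → ℤ
  /-- the feasible set is the hyperbox `-lu ≤ U ≤ hu` -/
  lu : Fin toParams.dim → ℤ
  hu : Fin toParams.dim → ℤ
  /-- previous solution, used for a warm start -/
  Uw : Fin toParams.dim → ℤ

namespace Instance

variable (J : Instance)

def encode : Val := .list [J.toParams.encode, .ofIntMatrix J.H, .ofIntMatrix J.F, .ofInt J.η,
  .ofIntVec J.x, .ofIntVec J.lu, .ofIntVec J.hu, .ofIntVec J.Uw]

/-- Initial iterate: zero, or the previous solution shifted by one time step. -/
def initU : Fin J.dim → ℤ := fun i =>
  if J.coldStart then 0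
  else if h : i + J.m < J.dim then J.Uw ⟨i + J.m, h⟩ else 0

/-- Gradient step; `z` is scaled by `2 ^ (2 * lf)`, the result by `2 ^ (3 * lf)`. -/
def gradStep (z : Fin J.dim → ℤ) : Fin J.dim → ℤ :=
  (((2 : ℤ) ^ J.lf • (1 : Matrix (Fin J.dim) (Fin J.dim) ℤ) - J.H).mulVec z)
    - ((2 : ℤ) ^ J.lf • J.F.transpose).mulVec J.x

/-- Truncation of a quantity scaled by `2 ^ (3 * lf)` to `lf` fractional bits, and projection onto
the feasible set. -/
def truncProject (t : Fin J.dim → ℤ) : Fin J.dim → ℤ := fun i =>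
  max (-J.lu i) (min (J.hu i) (t i / 2 ^ (2 * J.lf)))

/-- The iterates `(U_k, z_k)` of the fixed-point projected fast gradient method, scaled by `2 ^ lf`
and by `2 ^ (2 * lf)`. -/
def iterate : ℕ → (Fin J.dim → ℤ) × (Fin J.dim → ℤ)
  | 0 => (J.initU, fun i => 2 ^ J.lf * J.initU i)
  | k + 1 =>
      let s := iterate k
      let U := J.truncProject (J.gradStep s.2)
      (U, fun i => (2 ^ J.lf + J.η) * U i + -J.η * s.1 i)

/-- The output that the functionality gives to the client: the first `m` components of `U_K`. -/
def clientOutput : Fin J.m → ℤ := J.firstInput (J.iterate J.K).1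

/-- The output that the functionality gives to the server: nothing. -/
def serverOutput : Val := .list []

/-- No overflow modulo `N`: the integers decrypted by the client lie between `-N/3` and `N/3`. -/
def NoOverflow (N : ℕ) : Prop := ∀ k < J.K, ∀ i, 3 * |J.gradStep (J.iterate k).2 i| < (N : ℤ)

end Instance

/-! ## The protocol -/

structure ServerInput (P : Params) (pk : PublicKey) where
  H : Matrix (Fin P.dim) (Fin P.dim) ℤ
  F : Matrix (Fin P.n) (Fin P.dim) ℤ
  η : ℤ
  /-- encrypted previous solution -/
  Uw : Fin P.dim → pk.Cipher

structure ClientInput (P : Params) (pk : PublicKey) where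
  x : Fin P.n → ℤ
  lu : Fin P.dim → ℤ
  hu : Fin P.dim → ℤ
  sk : SecretKey pk

/-- Number of encryptions of zero that the server has to make. -/
def Params.numCoins (P : Params) : ℕ := if P.coldStart then P.dim else P.m

namespace ServerInput

variable {P : Params} {pk : PublicKey} (s : ServerInput P pk)

def encode : Val := .list [P.encode, .ofIntMatrix s.H, .ofIntMatrix s.F, .ofInt s.η,
  .num pk.N, .num pk.g.val, .ofZModVec s.Uw]

/-- Encrypted initial iterate; `ρ` are the random values for the encryptions of zero. -/
def initU (ρ : Fin P.numCoins → pk.Nonce) : Fin P.dim → pk.Cipher := fun i =>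
  if hc : P.coldStart = true then
    pk.enc 0 (ρ ⟨i, by simp [Params.numCoins, hc]⟩)
  else if hi : i + P.m < P.dim then s.Uw ⟨i + P.m, hi⟩
  else pk.enc 0 (ρ ⟨i + P.m - P.dim, by
    have := i.isLt
    simp only [Params.numCoins, hc, Bool.false_eq_true, if_false]
    omega⟩)

/-- Encrypted `z₀ = U₀`, brought to the scale of the later `z_k`. -/
def initZ (U : Fin P.dim → pk.Cipher) : Fin P.dim → pk.Cipher := fun i =>
  pk.otimes (2 ^ P.lf) (U i)

/-- The message `[[t_k]]`. -/
def gradStep (cx : Fin P.n → pk.Cipher) (z : Fin P.dim → pk.Cipher) : Fin P.dim → pk.Cipher :=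
  fun i => pk.oplus
    (pk.matVec ((2 : ℤ) ^ P.lf • (1 : Matrix (Fin P.dim) (Fin P.dim) ℤ) - s.H) z i)
    (pk.matVec (-((2 : ℤ) ^ P.lf • s.F.transpose)) cx i)

def nextZ (U' U : Fin P.dim → pk.Cipher) : Fin P.dim → pk.Cipher := fun i =>
  pk.oplus (pk.otimes (2 ^ P.lf + s.η) (U' i)) (pk.otimes (-s.η) (U i))

end ServerInput

/-- Decryption to an integer of least absolute value, truncation and projection. -/
def ClientInput.step {P : Params} {pk : PublicKey} (c : ClientInput P pk)
    (t : Fin P.dim → pk.Cipher) : Fin P.dim → ℤ := fun i =>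
  max (-c.lu i) (min (c.hu i) ((pk.dec c.sk (t i)).valMinAbs / 2 ^ (2 * P.lf)))

section Protocol

variable {P : Params} {pk : PublicKey} (s : ServerInput P pk) (c : ClientInput P pk)

/-- `k` further iterations, starting with the server's encrypted iterates `U` and `z` and with the
client's current iterate `u`. The result consists of the messages received by the server and of
the client's last iterate. -/
def iterations (cx : Fin P.n → pk.Cipher) : ℕ → (U z : Fin P.dim → pk.Cipher) →
    (u : Fin P.dim → ℤ) → PMF (List (Fin P.dim → pk.Cipher) × (Fin P.dim → ℤ))
  | 0, _, _, u => PMF.pure ([], u)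
  | k + 1, U, z, _ =>
      let t := s.gradStep cx z
      let u' := c.step t
      (pk.nonces P.dim).bind fun r =>
        let U' := pk.encVec u' r
        (iterations cx k U' (s.nextZ U' U) u').map fun o => (U' :: o.1, o.2)

/-- An execution of the protocol: the server's view (its input, its random values, and the messages
that it received) and the client's output. The last argument of `iterations` is not used, because
there is at least one iteration. -/
def execute : PMF (Val × (Fin P.m → ℤ)) :=
  (pk.nonces P.numCoins).bind fun ρ =>
  (pk.nonces P.n).bind fun r =>
    let cx := pk.encVec c.x r
    let U₀ := s.initU ρ
    (iterations s c cx P.K U₀ (ServerInput.initZ U₀) 0).map fun o =>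
      (.pair s.encode (.pair (.ofZModVec fun i => (ρ i : ZMod pk.N))
          (.list (.ofZModVec cx :: o.1.map .ofZModVec))),
        P.firstInput o.2)

end Protocol

/-- The inputs of the two parties. -/
structure Inputs (P : Params) where
  pk : PublicKey
  server : ServerInput P pk
  client : ClientInput P pk

namespace KeyGen

variable (G : KeyGen) (n : ℕ) (J : Instance)

/-- Generate the keys, encrypt the previous solution, and distribute the inputs. -/
def inputs : PMF (Inputs J.toParams) :=
  (G.factors n).bind fun M =>
  (G.base.out (.pair (.unary n) (.num M.N))).bind fun g =>
    let pk := M.publicKey g.toNat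
    (pk.nonces J.dim).map fun r =>
      { pk := pk
        server := { H := J.H, F := J.F, η := J.η, Uw := pk.encVec J.Uw r }
        client := { x := J.x, lu := J.lu, hu := J.hu, sk := M.secretKey g.toNat } }

/-- The server's view and the client's output in the real execution. -/
def real : PMF (Val × (Fin J.m → ℤ)) :=
  (G.inputs n J).bind fun a => execute a.server a.client

/-- The server's view in the real execution. -/
def view : PMF Val := (G.real n J).map Prod.fst

/-- The output of a simulator that is given the security parameter, the server's input and the
server's output. -/
def simulated (S : PPT) : PMF Val :=
  (G.inputs n J).bind fun a =>
    S.out (.pair (.unary n) (.pair a.server.encode Instance.serverOutput))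

/-- Every modulus that may be generated is large enough for the instance. -/
def Admissible : Prop := ∀ M ∈ (G.factors n).support, J.NoOverflow M.N

/-- Whenever there is no overflow, the client obtains its output of the functionality. -/
def Computes : Prop := ∀ n J, G.Admissible n J → ∀ o ∈ (G.real n J).support, o.2 = J.clientOutput

/-- Privacy against a semi-honest server, for instances whose length is polynomial in the security
parameter. -/
def PrivateAgainstServer : Prop :=
  ∃ S : PPT, ∀ l : Polynomial ℕ,
    CompIndist (I := fun n => {J : Instance // G.Admissible n J ∧ J.encode.size ≤ l.eval n})
      (fun n J => G.simulated n J.1 S) (fun n J => G.view n J.1)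

end KeyGen

end

/-! Correctness is the homomorphic property of Paillier encryption. Every ciphertext of the protocol
has the form $g^a y^N$ with $y$ a unit modulo $N^2$ (`Rep`). Since $g^N=1$, products and powers of
such ciphertexts represent sums and multiples modulo $N$. Raising to the power $\gamma$ kills $y^N$
and turns $g^a$ into $(1+tN)^a=1+atN$, where $t$ is invertible modulo $N$ because $g$ has order
exactly $N$ (`Factors.dec_of_rep`). Without overflow the residue of least absolute value is the
intended integer, so the client computes the exact iterates.

Hence, for fixed keys, the messages that reach the server are independent fresh encryptions of
plaintexts that depend on the instance alone (`Instance.execute_spec`, `KeyGen.view_eq`). An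
encryption of $a$ is $g^a$ times a uniform $N$-th residue. With a uniform unit in place of the
residue the product is a uniform unit, whatever $a$ is (`PublicKey.maskDist_unitDist`); so the
simulator just outputs random residues as messages.

The messages are replaced one at a time. Consecutive hybrids differ in the mask of one message, and
there the reduction plants its DCR challenge (`KeyGen.dom_sample`). It receives the plaintexts as
advice. A bound that is uniform over all instances results from choosing, for each security
parameter, advice on which the reduction succeeds whenever such advice exists.

Two technical points shape the proof. Fair coins cannot sample units modulo $N$ exactly; a number of
$5n$ random bits, reduced modulo $N$ or $N^2$, dominates $1-5/2^n$ times the uniform distribution on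
units. The constants of `PMF.Dom` multiply under composition, so polynomially many samples cost a
negligible amount in total. Moreover, simulator and reduction must be programs of the given model:
the class `PT` is closed under composition, branching and randomized passes through a list
(`PT.foldM`), which suffices to write both. -/

open scoped ENNReal

/-! ### Uniform distributions, dominance, and lists of independent samples. -/

namespace PMF

theorem bind_congr_support {α β : Type*} (p : PMF α) {f g : α → PMF β}
    (h : ∀ a ∈ p.support, f a = g a) : p.bind f = p.bind g := by
  ext b
  simp only [bind_apply]
  refine tsum_congr fun a => ?_
  by_cases ha : a ∈ p.support
  · rw [h a ha]
  · rw [(PMF.apply_eq_zero_iff p a).2 ha, zero_mul, zero_mul]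

theorem map_congr_support {α β : Type*} (p : PMF α) {f g : α → β}
    (h : ∀ a ∈ p.support, f a = g a) : p.map f = p.map g :=
  p.bind_congr_support fun a ha => by simp [h a ha]

/-- Pushing a uniform distribution forward along a map with fibres of equal size. -/
theorem map_uniformOfFintype {α β : Type*} [Fintype α] [Nonempty α] [Fintype β] [Nonempty β]
    [DecidableEq β] (f : α → β) (k : ℕ)
    (hf : ∀ b, (Finset.univ.filter fun a => f a = b).card = k) :
    (uniformOfFintype α).map f = uniformOfFintype β := by
  have hcard : Fintype.card α = Fintype.card β * k := by
    rw [← Finset.card_univ, Finset.card_eq_sum_card_fiberwise (f := f) (t := Finset.univ)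
      (fun _ _ => Finset.mem_univ _)]
    simp [hf]
  have hk : (k : ℝ≥0∞) ≠ 0 := by
    have : Fintype.card α ≠ 0 := Fintype.card_ne_zero
    rintro h
    apply this
    rw [hcard, Nat.cast_eq_zero.1 h, mul_zero]
  ext b
  rw [map_apply, uniformOfFintype_apply, tsum_fintype]
  simp only [uniformOfFintype_apply]
  have h1 : ∑ a, (if b = f a then ((Fintype.card α : ℝ≥0∞))⁻¹ else 0)
      = k * ((Fintype.card α : ℝ≥0∞))⁻¹ := by
    rw [← Finset.sum_filter, Finset.sum_const, nsmul_eq_mul, ← hf b]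
    simp only [eq_comm]
  rw [h1, hcard, Nat.cast_mul, ENNReal.mul_inv (Or.inr (ENNReal.natCast_ne_top _)) (Or.inr hk),
    mul_comm, mul_assoc, ENNReal.inv_mul_cancel hk (ENNReal.natCast_ne_top _), mul_one]

theorem map_uniformOfFintype_equiv {α β : Type*} [Fintype α] [Nonempty α] [Fintype β] [Nonempty β]
    (e : α ≃ β) : (uniformOfFintype α).map e = uniformOfFintype β := by
  classical
  refine map_uniformOfFintype e 1 fun b => ?_
  rw [Finset.card_eq_one]
  exact ⟨e.symm b, by ext a; simp [Equiv.eq_symm_apply]⟩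

/-- All fibres are cosets of the kernel and hence equally large. -/
theorem map_uniformOfFintype_monoidHom {G H : Type*} [Group G] [Group H] [Fintype G] [Fintype H]
    (f : G →* H) (hf : Function.Surjective f) :
    (uniformOfFintype G).map f = uniformOfFintype H := by
  classical
  refine map_uniformOfFintype f (Finset.univ.filter fun a => f a = 1).card fun b => ?_
  obtain ⟨c, rfl⟩ := hf b
  refine Finset.card_bij' (fun a _ => c⁻¹ * a) (fun a _ => c * a) ?_ ?_ ?_ ?_ <;> simp
  intro a ha; simp [ha]

theorem uniformOfFintype_prod {α β : Type*} [Fintype α] [Nonempty α] [Fintype β] [Nonempty β] :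
    uniformOfFintype (α × β)
      = (uniformOfFintype α).bind fun a => (uniformOfFintype β).map fun b => (a, b) := by
  classical
  ext ⟨a, b⟩
  simp only [bind_apply, map_apply, uniformOfFintype_apply, tsum_fintype, Prod.mk.injEq,
    Fintype.card_prod, Nat.cast_mul]
  rw [Finset.sum_eq_single a, Finset.sum_eq_single b]
  · simp [ENNReal.mul_inv]
  · intro c _ hc; simp [Ne.symm hc]
  · simp
  · intro c _ hc; simp [Ne.symm hc]
  · simp

/-- The tail is drawn before the head, which is the order used by `seqList`. -/
theorem uniformOfFintype_fin_succ {k : ℕ} {α : Type} [Fintype α] [Nonempty α] :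
    uniformOfFintype (Fin (k + 1) → α) = (uniformOfFintype (Fin k → α)).bind fun s =>
      (uniformOfFintype α).map fun a => Fin.cons a s := by
  rw [← map_uniformOfFintype_equiv (Fin.consEquiv fun _ : Fin (k + 1) => α),
    uniformOfFintype_prod, map_bind]
  simp only [map_comp]
  simp only [← bind_pure_comp]
  rw [PMF.bind_comm]
  rfl

/-- `μ` dominates `κ` times `ν`. -/
def Dom {α : Type*} (κ : ℝ≥0∞) (ν μ : PMF α) : Prop := ∀ a, κ * ν a ≤ μ a

namespace Dom
variable {α β : Type*}

theorem refl (μ : PMF α) : Dom 1 μ μ := fun a => by rw [one_mul]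

theorem mono {κ κ' : ℝ≥0∞} {ν μ : PMF α} (h : Dom κ ν μ) (hκ : κ' ≤ κ) : Dom κ' ν μ :=
  fun a => (mul_le_mul_left hκ _).trans (h a)

/-- This multiplicativity lets the loss of many independent samples be counted by an exponent. -/
theorem bind {κ κ' : ℝ≥0∞} {ν μ : PMF α} {f g : α → PMF β} (h : Dom κ ν μ)
    (h' : ∀ a ∈ ν.support, Dom κ' (f a) (g a)) : Dom (κ * κ') (ν.bind f) (μ.bind g) := fun b => by
  simp only [bind_apply]
  rw [← ENNReal.tsum_mul_left]
  refine ENNReal.tsum_le_tsum fun a => ?_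
  by_cases ha : a ∈ ν.support
  · calc κ * κ' * (ν a * f a b) = (κ * ν a) * (κ' * f a b) := by ring
      _ ≤ _ := mul_le_mul' (h a) (h' a ha b)
  · simp [(PMF.apply_eq_zero_iff ν a).2 ha]

theorem bind_right {κ : ℝ≥0∞} (ν : PMF α) {f g : α → PMF β}
    (h' : ∀ a ∈ ν.support, Dom κ (f a) (g a)) : Dom κ (ν.bind f) (ν.bind g) := by
  simpa using (refl ν).bind h'

theorem bind_left {κ : ℝ≥0∞} {ν μ : PMF α} (h : Dom κ ν μ) (f : α → PMF β) :
    Dom κ (ν.bind f) (μ.bind f) := by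
  simpa using h.bind fun a _ => refl (f a)

theorem map {κ : ℝ≥0∞} {ν μ : PMF α} (h : Dom κ ν μ) (f : α → β) : Dom κ (ν.map f) (μ.map f) :=
  h.bind_left _

/-- Dominance bounds the difference of probabilities. -/
theorem abs_sub_le {κ : ℝ} {ν μ : PMF α} (hκ : 0 ≤ κ) (h : Dom (ENNReal.ofReal κ) ν μ) (a : α) :
    |(ν a).toReal - (μ a).toReal| ≤ 1 - κ := by
  classical
  -- Both the event `x = a` and its complement are used: the lower bound for the complement is the
  -- upper bound for the event.
  have key : ∀ ν μ : PMF Bool, Dom (ENNReal.ofReal κ) ν μ → ∀ b,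
      κ * (ν b).toReal ≤ (μ b).toReal := fun ν μ h b => by
    have := ENNReal.toReal_mono (μ.apply_ne_top b) (h b)
    rwa [ENNReal.toReal_mul, ENNReal.toReal_ofReal hκ] at this
  have hb : ∀ ν : PMF α, ((ν.map fun x => decide (x = a)) true) = ν a := fun ν => by
    rw [map_apply, tsum_eq_single a]
    · simp
    · intro b hb; simp [hb]
  have hs : ∀ ν : PMF Bool, (ν true).toReal + (ν false).toReal = 1 := fun ν => by
    have := ν.tsum_coe
    rw [tsum_fintype] at this
    rw [← ENNReal.toReal_add (ν.apply_ne_top _) (ν.apply_ne_top _)]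
    simp only [Fintype.univ_bool, Finset.mem_singleton, Bool.true_eq_false, not_false_eq_true,
      Finset.sum_insert, Finset.sum_singleton] at this
    rw [this, ENNReal.toReal_one]
  have h1 := key _ _ (h.map fun x => decide (x = a)) true
  have h2 := key _ _ (h.map fun x => decide (x = a)) false
  have e1 := hs (ν.map fun x => decide (x = a))
  have e2 := hs (μ.map fun x => decide (x = a))
  rw [hb] at h1 e1 e2
  rw [hb] at h1
  have p1 : 0 ≤ (ν a).toReal := ENNReal.toReal_nonneg
  have p2 : 0 ≤ (μ a).toReal := ENNReal.toReal_nonneg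
  have p3 : 0 ≤ ((ν.map fun x => decide (x = a)) false).toReal := ENNReal.toReal_nonneg
  have p4 : 0 ≤ ((μ.map fun x => decide (x = a)) false).toReal := ENNReal.toReal_nonneg
  have hκ1 : κ ≤ 1 := by nlinarith
  rw [abs_le]
  constructor <;> nlinarith

end Dom

/-- Independent samples from a list of distributions, collected in a list. -/
noncomputable def seqList : List (PMF Val) → PMF Val
  | [] => PMF.pure (.num 0)
  | p :: l => (seqList l).bind fun s => p.map fun x => .pair x s

/-- Vectors of nonces become lists of independently sampled data, a form in which single entries can
be exchanged. -/
theorem seqList_ofFn {k : ℕ} {α : Type} [Fintype α] [Nonempty α] (φ : Fin k → α → Val) :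
    (uniformOfFintype (Fin k → α)).map (fun r => Val.vec fun i => φ i (r i))
      = seqList (List.ofFn fun i => (uniformOfFintype α).map (φ i)) := by
  induction k with
  | zero =>
    rw [List.ofFn_zero, seqList]
    simp only [Val.vec, List.ofFn_zero, Val.list]
    exact PMF.map_const _ _
  | succ k ih =>
    rw [uniformOfFintype_fin_succ, List.ofFn_succ, seqList, ← ih, map_bind, bind_map]
    simp only [PMF.map_comp]
    congr 1
    funext s
    simp only [Function.comp_def, Val.vec, List.ofFn_succ, Val.list, Fin.cons_zero, Fin.cons_succ]

/-- The distribution of one component may be sampled first. -/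
theorem seqList_append_bind {α : Type} (ν : PMF α) (f : α → PMF Val) (l₁ l₂ : List (PMF Val)) :
    seqList (l₁ ++ ν.bind f :: l₂) = ν.bind fun a => seqList (l₁ ++ f a :: l₂) := by
  induction l₁ with
  | nil =>
    simp only [List.nil_append, seqList, map_bind]
    rw [PMF.bind_comm]
  | cons p l₁ ih => simp only [List.cons_append, seqList, ih, bind_bind]

end PMF

/-! ### Lengths of data, and runs of programs. -/

theorem Polynomial.eval_mono_nat (t : Polynomial ℕ) : Monotone fun n => t.eval n := by
  intro a b h
  simp only [Polynomial.eval_eq_sum, Polynomial.sum]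
  exact Finset.sum_le_sum fun i _ => Nat.mul_le_mul_left _ (Nat.pow_le_pow_left h i)

namespace Val

theorem one_le_size (v : Val) : 1 ≤ v.size := by
  cases v <;> simp [size]

theorem size_fst_le (v : Val) : v.fst.size ≤ v.size := by
  cases v <;> simp [size, fst]; omega

theorem size_snd_le (v : Val) : v.snd.size ≤ v.size := by
  cases v <;> simp [size, snd]; omega

theorem size_toNat_lt (v : Val) : v.toNat.size < v.size := by
  cases v <;> simp [size, toNat]

theorem size_ofBool_le (b : Bool) : (ofBool b).size ≤ 2 := by
  cases b <;> simp [ofBool, size]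

theorem isPair_size_le (v : Val) : v.isPair.size ≤ 2 := by
  cases v <;> simp [isPair, size]

end Val

namespace Outcome

/-- The outcome `o` always has a result, distributed as `μ`, after at most `c` steps. -/
def Is (o : Outcome) (μ : PMF Val) (c : ℕ) : Prop :=
  o.map (Option.map Prod.fst) = μ.map some ∧ ∀ w k, some (w, k) ∈ o.support → k ≤ c

namespace Is

theorem exists_of_mem {o : Outcome} {μ : PMF Val} {c : ℕ} (h : Is o μ c) {x : Option (Val × ℕ)}
    (hx : x ∈ o.support) : ∃ w ∈ μ.support, ∃ k ≤ c, x = some (w, k) := by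
  have h1 : x.map Prod.fst ∈ (μ.map some).support := by
    rw [← h.1, PMF.mem_support_map_iff]
    exact ⟨x, hx, rfl⟩
  rw [PMF.mem_support_map_iff] at h1
  obtain ⟨w, hw, hwx⟩ := h1
  match x, hx, hwx with
  | some (w', k), hx, hwx =>
    simp only [Option.map_some, Option.some.injEq] at hwx
    subst hwx
    exact ⟨w, hw, k, h.2 _ _ hx, rfl⟩

theorem mono {o : Outcome} {μ : PMF Val} {c c' : ℕ} (h : Is o μ c) (hc : c ≤ c') : Is o μ c' :=
  ⟨h.1, fun w k hk => (h.2 w k hk).trans hc⟩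

theorem ret (v : Val) (c : ℕ) : Is (ret v c) (PMF.pure v) c := by
  refine ⟨by simp [Outcome.ret, PMF.pure_map], fun w k hk => ?_⟩
  simp only [Outcome.ret, PMF.mem_support_pure_iff, Option.some.injEq, Prod.mk.injEq] at hk
  exact hk.2.le

theorem andThen {o : Outcome} {μ : PMF Val} {c₁ c₂ c : ℕ} {f : Val → Outcome} {g : Val → PMF Val}
    (ho : Is o μ c₁) (hf : ∀ w ∈ μ.support, Is (f w) (g w) c₂) :
    Is (o.andThen c f) (μ.bind g) (c + c₁ + c₂) := by
  constructor
  · rw [Outcome.andThen, PMF.map_bind, PMF.map_bind]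
    -- The continuation as a function of the result alone, so that the hypothesis on `o`, which
    -- forgets step counts, can be substituted.
    let h : Option Val → PMF (Option Val) := fun x => match x with
      | none => PMF.pure none
      | some w => (g w).map some
    have e : μ.bind (fun a => (g a).map some) = (μ.map some).bind h := by
      rw [PMF.bind_map]; rfl
    rw [e, ← ho.1, PMF.bind_map]
    refine PMF.bind_congr_support _ fun x hx => ?_
    obtain ⟨w, hw, k, -, rfl⟩ := ho.exists_of_mem hx
    simp only [PMF.map_comp, Function.comp_def, Option.map_some, h]
    rw [← (hf w hw).1]
    congr 1
    funext y
    cases y <;> rfl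
  · intro w k hk
    rw [Outcome.andThen, PMF.mem_support_bind_iff] at hk
    obtain ⟨x, hx, hk⟩ := hk
    obtain ⟨w', hw', k', hk', rfl⟩ := ho.exists_of_mem hx
    simp only [PMF.mem_support_map_iff] at hk
    obtain ⟨y, hy, e⟩ := hk
    obtain ⟨w'', _, k'', hk'', rfl⟩ := (hf w' hw').exists_of_mem hy
    simp only [Option.map_some, Option.some.injEq, Prod.mk.injEq] at e
    omega

theorem congr {o : Outcome} {μ μ' : PMF Val} {c : ℕ} (h : Is o μ c) (e : μ = μ') : Is o μ' c :=
  e ▸ h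

end Is

theorem none_notMem_andThen {o : Outcome} {c : ℕ} {f : Val → Outcome}
    (h : none ∉ (o.andThen c f).support) :
    none ∉ o.support ∧ ∀ w k, some (w, k) ∈ o.support → none ∉ (f w).support := by
  simp only [andThen, PMF.mem_support_bind_iff, not_exists, not_and] at h
  refine ⟨fun h0 => h none h0 (by simp), fun w k hw h0 => h _ hw ?_⟩
  simp only [PMF.mem_support_map_iff]
  exact ⟨none, h0, rfl⟩

theorem andThen_congr {o o' : Outcome} {c : ℕ} {f f' : Val → Outcome}
    (ho : none ∉ o.support → o' = o) (hf : ∀ w, none ∉ (f w).support → f' w = f w)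
    (h : none ∉ (o.andThen c f).support) : o'.andThen c f' = o.andThen c f := by
  obtain ⟨h1, h2⟩ := none_notMem_andThen h
  rw [ho h1]
  refine PMF.bind_congr_support _ fun x hx => ?_
  match x, hx with
  | none, hx => exact (h1 hx).elim
  | some (w, k), hx => simp only [hf w (h2 w k hx)]

/-- The primed bodies are the same programs under a larger allowance. If the smaller allowance was
never exhausted, the two runs agree test by test. -/
theorem whileLoop_congr {C P C' P' : Val → Outcome}
    (hC : ∀ v, none ∉ (C v).support → C' v = C v) (hP : ∀ v, none ∉ (P v).support → P' v = P v) :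
    ∀ {T T' : ℕ}, T ≤ T' → ∀ v, none ∉ (whileLoop C P T v).support →
      whileLoop C' P' T' v = whileLoop C P T v
  | 0, _, _, v, h => by simp [whileLoop] at h
  | T + 1, 0, hT, _, _ => by omega
  | T + 1, T' + 1, hT, v, h => by
    rw [whileLoop] at h
    rw [whileLoop, whileLoop]
    refine andThen_congr (hC v) (fun t ht => ?_) h
    split_ifs at ht ⊢ with h0
    · rfl
    · exact andThen_congr (hP v)
        (fun w hw => whileLoop_congr hC hP (Nat.le_of_succ_le_succ hT) w hw) ht

end Outcome

open Outcome

/-- A larger time allowance does not change a run that halts. -/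
theorem Prog.run_congr {T T' : ℕ} (hT : T ≤ T') : ∀ (P : Prog) (v : Val),
    none ∉ (P.run T v).support → P.run T' v = P.run T v
  | .skip, _, _ => rfl
  | .op _, _, _ => rfl
  | .coin, _, _ => rfl
  | .seq P Q, v, h => andThen_congr (run_congr hT P v) (run_congr hT Q) h
  | .fork P Q, v, h => andThen_congr (run_congr hT P v)
      (fun _ => andThen_congr (run_congr hT Q v) fun _ _ => rfl) h
  | .cond C P Q, v, h => andThen_congr (run_congr hT C v) (fun t ht => by
      split_ifs at ht ⊢
      · exact run_congr hT Q v ht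
      · exact run_congr hT P v ht) h
  | .loop C P, v, h => whileLoop_congr (run_congr hT C) (run_congr hT P) hT v h

namespace Outcome

/-- In every outcome that starts with data of length `s`, the growth of the data is bounded by the
number of steps. -/
def Grows (s : ℕ) (o : Outcome) : Prop := ∀ w k, some (w, k) ∈ o.support → w.size ≤ s + k

theorem Grows.andThen {s c : ℕ} {o : Outcome} {f : Val → Outcome}
    (h : ∀ w k, some (w, k) ∈ o.support → Grows (s + c + k) (f w)) :
    Grows s (o.andThen c f) := by
  intro w k hk
  rw [Outcome.andThen, PMF.mem_support_bind_iff] at hk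
  obtain ⟨x, hx, hk⟩ := hk
  match x, hx, hk with
  | none, _, hk => simp at hk
  | some (w', k'), hx, hk =>
    simp only [PMF.mem_support_map_iff] at hk
    obtain ⟨y, hy, e⟩ := hk
    match y, hy, e with
    | some (w'', k''), hy, e =>
      simp only [Option.map_some, Option.some.injEq, Prod.mk.injEq] at e
      have := h _ _ hx _ _ hy
      rw [← e.1, ← e.2]
      omega

theorem Grows.mono {s s' : ℕ} {o : Outcome} (h : Grows s o) (hs : s ≤ s') : Grows s' o :=
  fun w k hk => (h w k hk).trans (by omega)

theorem Grows.ret {v : Val} {c s : ℕ} (h : v.size ≤ s + c) : Grows s (Outcome.ret v c) := by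
  intro w k hk
  simp only [Outcome.ret, PMF.mem_support_pure_iff, Option.some.injEq, Prod.mk.injEq] at hk
  rw [hk.1, hk.2]; exact h

theorem Grows.whileLoop {C P : Val → Outcome} (hP : ∀ v, Grows v.size (P v)) :
    ∀ T v, Grows v.size (whileLoop C P T v)
  | 0, v => fun w k hk => by simp [Outcome.whileLoop] at hk
  | T + 1, v => by
    refine Grows.andThen fun t k _ => ?_
    split_ifs
    · exact Grows.ret (by omega)
    · refine Grows.andThen fun w k' hw => ?_
      exact (Grows.whileLoop hP T w).mono (by have := hP v w k' hw; omega)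

end Outcome

/-- Under logarithmic cost each operation pays for the data that it writes, so a time bound also
bounds the output length. -/
theorem Prog.grows (T : ℕ) : ∀ (P : Prog) (v : Val), Grows v.size (P.run T v)
  | .skip, v => Grows.ret (by omega)
  | .op o, v => Grows.ret (by omega)
  | .coin, v => fun w k hk => by
      simp only [run, PMF.mem_support_bind_iff] at hk
      obtain ⟨b, -, hk⟩ := hk
      exact Grows.ret (by have := Val.size_ofBool_le b; have := v.one_le_size; omega) w k hk
  | .seq P Q, v => Grows.andThen fun w k hw =>
      (Prog.grows T Q w).mono (by have := Prog.grows T P v w k hw; omega)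
  | .fork P Q, v => Grows.andThen fun a k ha => Grows.andThen fun b k' hb => Grows.ret (by
      have := Prog.grows T P v a k ha
      have := Prog.grows T Q v b k' hb
      simp only [Val.size]; omega)
  | .cond C P Q, v => Grows.andThen fun t k _ => by
      split_ifs
      · exact (Prog.grows T Q v).mono (by omega)
      · exact (Prog.grows T P v).mono (by omega)
  | .loop C P, v => Grows.whileLoop (Prog.grows T P) T v

/-! ### Closure properties of polynomial-time computation. -/

/-- `f` is computed by a program in polynomial time. -/
def PT (f : Val → PMF Val) : Prop :=
  ∃ (P : Prog) (t : Polynomial ℕ), ∀ v T, t.eval v.size ≤ T →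
    Is (P.run T v) (f v) (t.eval v.size) ∧ ∀ w ∈ (f v).support, w.size ≤ t.eval v.size

/-- The algorithm is known to halt only under its own loop allowance; `Prog.run_congr` transfers
this to any larger one, and `Prog.grows` bounds the output. Hence given algorithms may serve as
subroutines. -/
theorem PPT.pt_out (A : PPT) : PT A.out := by
  refine ⟨A.prog, Polynomial.X + A.time, fun v T hT => ?_⟩
  simp only [Polynomial.eval_add, Polynomial.eval_X] at hT ⊢
  have hn : none ∉ (A.prog.run (A.time.eval v.size) v).support := fun h => by
    obtain ⟨w, c, h, -⟩ := A.halts v _ h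
    cases h
  have hrun := Prog.run_congr (show A.time.eval v.size ≤ T by omega) A.prog v hn
  have hIs : Is (A.prog.run T v) (A.out v) (A.time.eval v.size) := by
    rw [hrun]
    constructor
    · rw [PPT.out, PMF.map_comp]
      refine PMF.map_congr_support _ fun x hx => ?_
      obtain ⟨w, c, rfl, -⟩ := A.halts v _ hx
      rfl
    · intro w k hk
      obtain ⟨w', c, h, hc⟩ := A.halts v _ hk
      cases h
      exact hc
  refine ⟨hIs.mono (by omega), fun w hw => ?_⟩
  have : some w ∈ ((A.prog.run T v).map (Option.map Prod.fst)).support := by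
    rw [hIs.1, PMF.mem_support_map_iff]
    exact ⟨w, hw, rfl⟩
  rw [PMF.mem_support_map_iff] at this
  obtain ⟨x, hx, e⟩ := this
  obtain ⟨w', _, k, hk, rfl⟩ := hIs.exists_of_mem hx
  cases e
  exact (Prog.grows T A.prog v _ _ hx).trans (by omega)

theorem PT.exists_ppt {f : Val → PMF Val} (h : PT f) : ∃ A : PPT, ∀ v, A.out v = f v := by
  obtain ⟨P, t, h⟩ := h
  refine ⟨⟨P, t, fun v o ho => ?_⟩, fun v => ?_⟩
  · obtain ⟨w, _, k, hk, rfl⟩ := (h v _ le_rfl).1.exists_of_mem ho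
    exact ⟨w, k, rfl, hk⟩
  · have := (h v _ le_rfl).1.1
    simp only [PPT.out]
    rw [show (fun o : Option (Val × ℕ) => (o.map Prod.fst).getD (.num 0))
      = (fun o => o.getD (.num 0)) ∘ Option.map Prod.fst from rfl, ← PMF.map_comp, this,
      PMF.map_comp]
    exact PMF.map_id _

namespace PT

theorem congr {f g : Val → PMF Val} (h : PT f) (e : ∀ v, g v = f v) : PT g := by
  rwa [funext e]

theorem id : PT PMF.pure := by
  refine ⟨.skip, Polynomial.X + 1, fun v T _ => ⟨(Is.ret v 1).mono ?_, fun w hw => ?_⟩⟩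
  · simp
  · rw [PMF.mem_support_pure_iff] at hw
    simp [hw]

theorem op_of_size_le (o : Op) (t : Polynomial ℕ) (ht : ∀ v, (o.eval v).size ≤ t.eval v.size) :
    PT fun v => PMF.pure (o.eval v) := by
  refine ⟨.op o, 1 + Polynomial.X + t, fun v T _ => ⟨(Is.ret _ _).mono ?_, fun w hw => ?_⟩⟩
  · simpa using ht v
  · rw [PMF.mem_support_pure_iff] at hw
    subst hw
    simp only [Polynomial.eval_add, Polynomial.eval_X, Polynomial.eval_one]
    have := ht v
    omega

theorem coin : PT fun _ => (PMF.uniformOfFintype Bool).map Val.ofBool := by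
  refine ⟨.coin, 2 + Polynomial.X, fun v T _ => ⟨⟨?_, fun w k hk => ?_⟩, fun w hw => ?_⟩⟩
  · simp only [Prog.run, PMF.map_bind, ret, PMF.pure_map, PMF.map_comp]
    rfl
  · simp only [Prog.run, PMF.mem_support_bind_iff, ret, PMF.mem_support_pure_iff, Option.some.injEq,
      Prod.mk.injEq] at hk
    obtain ⟨b, -, -, rfl⟩ := hk
    simp
  · rw [PMF.mem_support_map_iff] at hw
    obtain ⟨b, -, rfl⟩ := hw
    have := Val.size_ofBool_le b
    simp; omega

/-- The intermediate result has length at most `s`, so the second program takes at most `t.comp s`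
steps. This is why `PT` records an output bound. -/
theorem comp {f g : Val → PMF Val} (hf : PT f) (hg : PT g) : PT fun v => (f v).bind g := by
  obtain ⟨P, s, hP⟩ := hf
  obtain ⟨Q, t, hQ⟩ := hg
  refine ⟨.seq P Q, 1 + s + t.comp s, fun v T hT => ?_⟩
  simp only [Polynomial.eval_add, Polynomial.eval_one, Polynomial.eval_comp] at hT ⊢
  obtain ⟨h1, h2⟩ := hP v T (by omega)
  have hm : ∀ w ∈ (f v).support, t.eval w.size ≤ t.eval (s.eval v.size) :=
    fun w hw => t.eval_mono_nat (h2 w hw)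
  have h3 := fun w (hw : w ∈ (f v).support) =>
    hQ w T ((hm w hw).trans (by omega))
  refine ⟨h1.andThen fun w hw => (h3 w hw).1.mono (hm w hw), fun x hx => ?_⟩
  rw [PMF.mem_support_bind_iff] at hx
  obtain ⟨w, hw, hx⟩ := hx
  have := (h3 w hw).2 x hx
  have := hm w hw
  omega

theorem fork {f g : Val → PMF Val} (hf : PT f) (hg : PT g) :
    PT fun v => (f v).bind fun a => (g v).map fun b => .pair a b := by
  obtain ⟨P, s, hP⟩ := hf
  obtain ⟨Q, t, hQ⟩ := hg
  refine ⟨.fork P Q, 1 + Polynomial.X + s + t, fun v T hT => ?_⟩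
  simp only [Polynomial.eval_add, Polynomial.eval_one, Polynomial.eval_X] at hT ⊢
  obtain ⟨h1, h2⟩ := hP v T (by omega)
  obtain ⟨h3, h4⟩ := hQ v T (by omega)
  refine ⟨(h1.andThen (c₂ := t.eval v.size) fun w hw =>
    (h3.andThen (c₂ := 0) fun x hx => Is.ret _ _).mono (by omega)), fun x hx => ?_⟩
  simp only [PMF.mem_support_bind_iff, PMF.mem_support_map_iff] at hx
  obtain ⟨a, ha, b, hb, rfl⟩ := hx
  have := h2 a ha
  have := h4 b hb
  have := v.one_le_size
  simp only [Val.size]; omega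

theorem cond {f g : Val → PMF Val} {c : Val → Val} (hc : PT fun v => PMF.pure (c v)) (hf : PT f)
    (hg : PT g) : PT fun v => if c v = .num 0 then g v else f v := by
  obtain ⟨C, r, hC⟩ := hc
  obtain ⟨P, s, hP⟩ := hf
  obtain ⟨Q, t, hQ⟩ := hg
  refine ⟨.cond C P Q, 1 + Polynomial.X + r + (s + t), fun v T hT => ?_⟩
  simp only [Polynomial.eval_add, Polynomial.eval_one, Polynomial.eval_X] at hT ⊢
  obtain ⟨h1, h2⟩ := hC v T (by omega)
  obtain ⟨h3, h4⟩ := hP v T (by omega)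
  obtain ⟨h5, h6⟩ := hQ v T (by omega)
  constructor
  · refine (h1.andThen (c₂ := s.eval v.size + t.eval v.size)
      (g := fun x => if x = .num 0 then g v else f v) fun w hw => ?_).congr (PMF.pure_bind _ _)
    split_ifs
    · exact h5.mono (by omega)
    · exact h3.mono (by omega)
  · intro w hw
    split_ifs at hw
    · have := h6 w hw; omega
    · have := h4 w hw; omega

end PT

/-! ### Lists as data, and deterministic programs. -/

namespace Val

theorem fst_pair (a b : Val) : (pair a b).fst = a := rfl
theorem snd_pair (a b : Val) : (pair a b).snd = b := rfl
theorem toNat_num (n : ℕ) : (num n).toNat = n := rfl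

def toList : Val → List Val
  | num _ => []
  | pair a b => a :: toList b

theorem toList_list (l : List Val) : (list l).toList = l := by
  induction l with
  | nil => rfl
  | cons a l ih => simp [list, toList, ih]

/-- The datum that terminates a list. -/
def terminator : Val → Val
  | num n => num n
  | pair _ b => terminator b

theorem length_toList_lt (v : Val) : v.toList.length < v.size := by
  induction v with
  | num n => simp [toList, size]
  | pair a b _ ih => simp only [toList, size, List.length_cons]; omega

/-- Pass through a list, updating a datum in a randomized way. -/
noncomputable def foldM (h : Val → Val → PMF Val) : List Val → Val → PMF Val
  | [], s => PMF.pure s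
  | a :: l, s => (h a s).bind (foldM h l)

theorem foldM_append (h : Val → Val → PMF Val) (l₁ l₂ : List Val) (s : Val) :
    foldM h (l₁ ++ l₂) s = (foldM h l₁ s).bind (foldM h l₂) := by
  induction l₁ generalizing s with
  | nil => simp [foldM]
  | cons a l ih => simp [foldM, PMF.bind_bind, funext ih]

theorem foldM_pure (f : Val → Val → Val) (l : List Val) (s : Val) :
    foldM (fun a s => PMF.pure (f a s)) l s = PMF.pure (l.foldl (fun s a => f a s) s) := by
  induction l generalizing s with
  | nil => rfl
  | cons a l ih => simp [foldM, ih]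

/-- Each pass prepends its sample, so starting from the last entry restores the original order. -/
theorem foldM_reverse (f : Val → PMF Val) (l : List Val) :
    foldM (fun a s => (f a).map fun x => pair x s) l.reverse (num 0)
      = PMF.seqList (l.map f) := by
  induction l with
  | nil => rfl
  | cons a l ih =>
    rw [List.reverse_cons, foldM_append, ih, List.map_cons, PMF.seqList]
    simp [foldM]

end Val

/-- `f` is computed by a deterministic program in polynomial time. -/
abbrev PTd (f : Val → Val) : Prop := PT fun v => PMF.pure (f v)

namespace PT

theorem comp_det {f : Val → PMF Val} {g : Val → Val} (hf : PT f) (hg : PTd g) :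
    PT fun v => f (g v) :=
  (comp hg hf).congr fun v => by simp

/-- Sample from `f`, and continue with the input and the result. -/
theorem bind {f g : Val → PMF Val} (hf : PT f) (hg : PT g) :
    PT fun v => (f v).bind fun a => g (.pair v a) :=
  (comp (fork id hf) hg).congr fun v => by simp [PMF.bind_map, Function.comp_def]

theorem map {f : Val → PMF Val} {g : Val → Val} (hf : PT f) (hg : PTd g) :
    PT fun v => (f v).map fun a => g (.pair v a) :=
  (bind hf hg).congr fun v => by rfl

end PT

namespace PTd

theorem comp {f g : Val → Val} (hf : PTd f) (hg : PTd g) : PTd fun v => f (g v) := hf.comp_det hg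

theorem const (c : Val) : PTd fun _ => c :=
  PT.op_of_size_le (.const c) (Polynomial.C c.size) fun v => by simp [Op.eval]

theorem pair {f g : Val → Val} (hf : PTd f) (hg : PTd g) : PTd fun v => .pair (f v) (g v) :=
  (PT.fork hf hg).congr fun v => by simp [PMF.pure_map]

theorem fst {f : Val → Val} (hf : PTd f) : PTd fun v => (f v).fst :=
  comp (PT.op_of_size_le .fst .X fun v => by simpa [Op.eval] using v.size_fst_le) hf

theorem snd {f : Val → Val} (hf : PTd f) : PTd fun v => (f v).snd :=
  comp (PT.op_of_size_le .snd .X fun v => by simpa [Op.eval] using v.size_snd_le) hf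

theorem isPair {f : Val → Val} (hf : PTd f) : PTd fun v => (f v).isPair :=
  comp (PT.op_of_size_le .isPair 2 fun v => by simpa [Op.eval] using v.isPair_size_le) hf

theorem size_fst_snd (v : Val) :
    v.fst.toNat.size + 1 ≤ v.size ∧ v.snd.toNat.size + 1 ≤ v.size :=
  ⟨v.fst.size_toNat_lt.trans_le v.size_fst_le, v.snd.size_toNat_lt.trans_le v.size_snd_le⟩

theorem size_add_le (a b : ℕ) : (a + b).size ≤ a.size + b.size + 1 := by
  rw [Nat.size_le]
  have h1 := Nat.lt_size_self a
  have h2 := Nat.lt_size_self b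
  have h3 : 2 ^ a.size ≤ 2 ^ (a.size + b.size) := Nat.pow_le_pow_right (by norm_num) (by omega)
  have h4 : 2 ^ b.size ≤ 2 ^ (a.size + b.size) := Nat.pow_le_pow_right (by norm_num) (by omega)
  rw [pow_succ]
  omega

theorem size_mul_le (a b : ℕ) : (a * b).size ≤ a.size + b.size := by
  rw [Nat.size_le, pow_add]
  exact Nat.mul_lt_mul'' (Nat.lt_size_self a) (Nat.lt_size_self b)

variable {f g : Val → Val}

theorem add (hf : PTd f) (hg : PTd g) : PTd fun v => .num ((f v).toNat + (g v).toNat) :=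
  comp (PT.op_of_size_le .add (.X + .X) fun v => by
    have := size_fst_snd v
    have := size_add_le v.fst.toNat v.snd.toNat
    simp [Op.eval, Val.size]; omega) (pair hf hg)

theorem mul (hf : PTd f) (hg : PTd g) : PTd fun v => .num ((f v).toNat * (g v).toNat) :=
  comp (PT.op_of_size_le .mul (.X + .X) fun v => by
    have := size_fst_snd v
    have := size_mul_le v.fst.toNat v.snd.toNat
    simp [Op.eval, Val.size]; omega) (pair hf hg)

theorem sub (hf : PTd f) (hg : PTd g) : PTd fun v => .num ((f v).toNat - (g v).toNat) :=
  comp (PT.op_of_size_le .sub .X fun v => by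
    have := size_fst_snd v
    have := Nat.size_le_size (Nat.sub_le v.fst.toNat v.snd.toNat)
    simp [Op.eval, Val.size]; omega) (pair hf hg)

theorem div (hf : PTd f) (hg : PTd g) : PTd fun v => .num ((f v).toNat / (g v).toNat) :=
  comp (PT.op_of_size_le .div .X fun v => by
    have := size_fst_snd v
    have := Nat.size_le_size (Nat.div_le_self v.fst.toNat v.snd.toNat)
    simp [Op.eval, Val.size]; omega) (pair hf hg)

theorem mod (hf : PTd f) (hg : PTd g) : PTd fun v => .num ((f v).toNat % (g v).toNat) :=
  comp (PT.op_of_size_le .mod .X fun v => by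
    have := size_fst_snd v
    have := Nat.size_le_size (Nat.mod_le v.fst.toNat v.snd.toNat)
    simp [Op.eval, Val.size]; omega) (pair hf hg)

theorem le (hf : PTd f) (hg : PTd g) :
    PTd fun v => .ofBool (decide ((f v).toNat ≤ (g v).toNat)) :=
  comp (PT.op_of_size_le .le 2 fun v => by simpa [Op.eval] using Val.size_ofBool_le _) (pair hf hg)

end PTd

/-! ### Loops that pass through a list. -/

namespace Outcome

/-- A loop that passes through the list in the second component of `(ctx, (list, s))`. -/
theorem Is.whileLoop_fold {C B : Val → Outcome} {f : Val → PMF Val} {ctx : Val} {L Q S I : ℕ}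
    (hC : ∀ l s, (Val.pair ctx (.pair l s)).size ≤ S →
      Is (C (.pair ctx (.pair l s))) (PMF.pure l.isPair) I)
    (hB : ∀ a l s, (Val.pair ctx (.pair (.pair a l) s)).size ≤ S →
      Is (B (.pair ctx (.pair (.pair a l) s)))
        ((f (.pair ctx (.pair a s))).map fun s' => .pair ctx (.pair l s')) I)
    (hf : ∀ a s, a.size ≤ L → ∀ w ∈ (f (.pair ctx (.pair a s))).support, w.size ≤ s.size + Q)
    (l : Val) : ∀ s N, l.toList.length < N → l.size ≤ L →
      ctx.size + L + s.size + l.toList.length * Q + 2 ≤ S →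
      Is (whileLoop C B N (.pair ctx (.pair l s)))
        ((Val.foldM (fun a s => f (.pair ctx (.pair a s))) l.toList s).map fun s' =>
          .pair ctx (.pair l.terminator s')) ((l.toList.length + 1) * (1 + S + I + I)) ∧
      ∀ w ∈ (Val.foldM (fun a s => f (.pair ctx (.pair a s))) l.toList s).support,
        w.size ≤ s.size + l.toList.length * Q := by
  -- Here `L` bounds the list, `Q` the growth of the state per pass, `S` every datum tested, and `I`
  -- the time of one test or one pass. A pass lengthens `s` by at most `Q` and shortens the list by
  -- one entry, so the inequality with the fixed bound `S` persists. The allowance `N` must exceed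
  -- the number of entries because of the final test.
  induction l with
  | num n =>
    intro s N hN hL hS
    obtain ⟨N, rfl⟩ : ∃ M, N = M + 1 := ⟨N - 1, by omega⟩
    simp only [Val.toList, List.length_nil, zero_mul, add_zero] at hS ⊢
    have hsz : (Val.pair ctx (.pair (.num n) s)).size ≤ S := by
      simp only [Val.size] at hL ⊢; omega
    constructor
    · rw [whileLoop]
      refine Is.congr (((hC (.num n) s hsz).andThen (c₂ := 0) (g := fun t => if t = .num 0 then
        PMF.pure (.pair ctx (.pair (.num n) s)) else PMF.pure t) fun t ht => ?_).mono ?_) ?_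
      · rw [PMF.mem_support_pure_iff] at ht
        simp only [ht, Val.isPair, if_true]
        exact Is.ret _ _
      · omega
      · simp [Val.foldM, PMF.pure_map, Val.isPair, Val.terminator]
    · intro w hw
      simp only [Val.foldM, PMF.mem_support_pure_iff] at hw
      simp [hw]
  | pair a l _ ih =>
    intro s N hN hL hS
    obtain ⟨N, rfl⟩ : ∃ M, N = M + 1 := ⟨N - 1, by omega⟩
    have haL : a.size ≤ L := by simp only [Val.size] at hL; omega
    have hlL : l.size ≤ L := by simp only [Val.size] at hL; omega
    simp only [Val.toList, List.length_cons, add_mul, one_mul] at hS hN ⊢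
    have hsz : (Val.pair ctx (.pair (.pair a l) s)).size ≤ S := by
      simp only [Val.size] at hL ⊢; omega
    have hstep : ∀ w ∈ (f (.pair ctx (.pair a s))).support, w.size ≤ s.size + Q := hf a s haL
    have hih : ∀ w ∈ (f (.pair ctx (.pair a s))).support, _ := fun w hw =>
      ih w N (by omega) hlL (by have := hstep w hw; omega)
    constructor
    · rw [whileLoop]
      refine Is.congr (((hC (.pair a l) s hsz).andThen (c₂ := (l.toList.length + 1) *
        (1 + S + I + I) + I) (g := fun t => if t = .num 0 then PMF.pure t else
          (f (.pair ctx (.pair a s))).bind fun w =>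
            (Val.foldM (fun a s => f (.pair ctx (.pair a s))) l.toList w).map fun s' =>
          .pair ctx (.pair l.terminator s')) fun t ht => ?_).mono ?_) ?_
      · rw [PMF.mem_support_pure_iff] at ht
        have hne : Val.num 1 ≠ Val.num 0 := by simp
        simp only [ht, Val.isPair, if_neg hne]
        refine Is.congr (((hB a l s hsz).andThen (c₂ := (l.toList.length + 1) *
          (1 + S + I + I)) (g := fun v =>
            (Val.foldM (fun a s => f (.pair ctx (.pair a s))) l.toList v.snd.snd).map fun s' =>
            .pair ctx (.pair l.terminator s')) fun w hw => ?_).mono ?_) ?_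
        · rw [PMF.mem_support_map_iff] at hw
          obtain ⟨s', hs', rfl⟩ := hw
          exact (hih s' hs').1
        · omega
        · rw [PMF.bind_map]; rfl
      · simp only [Val.size] at hsz ⊢
        rw [add_mul, one_mul]; omega
      · simp [Val.foldM, PMF.map_bind, Val.isPair, Val.terminator]
    · intro w hw
      simp only [Val.foldM, PMF.mem_support_bind_iff] at hw
      obtain ⟨s', hs', hw⟩ := hw
      have := (hih s' hs').2 w hw
      have := hstep s' hs'
      omega

end Outcome

namespace PT

/-- The growth bound `q` depends on the context and the current entry but not on the state `s`. A
bound polynomial in `s` could lead to exponential growth when iterated. -/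
theorem foldM {f : Val → PMF Val} (hf : PT f) (q : Polynomial ℕ)
    (hq : ∀ ctx a s, ∀ w ∈ (f (.pair ctx (.pair a s))).support,
      w.size ≤ s.size + q.eval (ctx.size + a.size)) {l s : Val → Val} (hl : PTd l) (hs : PTd s) :
    PT fun v => Val.foldM (fun a s => f (.pair v (.pair a s))) (l v).toList (s v) := by
  have hid : PTd fun v => v := PT.id
  obtain ⟨C, r, hC⟩ := hid.snd.fst.isPair
  obtain ⟨B, t, hB⟩ := fork hid.fst (fork hid.snd.fst.snd
    (hf.comp_det (hid.fst.pair (hid.snd.fst.fst.pair hid.snd.snd))))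
  obtain ⟨A, u, hA⟩ := hid.pair (hl.pair hs)
  let X : Polynomial ℕ := .X
  -- Bounds every datum in the loop: context, list and initial state, at most `u` passes of growth
  -- `q`, and two pairing nodes.
  let y : Polynomial ℕ := X + u + u + u * q.comp (X + u) + 2
  refine comp (f := fun v =>
    (Val.foldM (fun a s => f (.pair v (.pair a s))) (l v).toList (s v)).map fun s' =>
      .pair v (.pair (l v).terminator s')) ⟨.seq A (.loop C B),
    1 + u + (u + 1) * (1 + y + (r + t).comp y + (r + t).comp y) + (r + t).comp y + y,
    fun v T hT => ?_⟩ hid.snd.snd |>.congr fun v => ?_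
  · simp only [Polynomial.eval_add, Polynomial.eval_one, Polynomial.eval_mul,
      Polynomial.eval_comp] at hT ⊢
    set Y := y.eval v.size with hY
    set I := r.eval Y + t.eval Y with hI
    have hY' : Y = v.size + u.eval v.size + u.eval v.size
        + u.eval v.size * q.eval (v.size + u.eval v.size) + 2 := by
      simp [hY, y, X]
    -- The allowance `T` is at least the claimed time, which therefore has to cover the at most `u +
    -- 1` tests of the loop.
    have hTu : (u.eval v.size + 1) ≤ (u.eval v.size + 1) * (1 + Y + I + I) :=
      Nat.le_mul_of_pos_right _ (by omega)
    obtain ⟨h1, h2⟩ := hA v T (by omega)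
    have h2 := h2 _ (by rw [PMF.mem_support_pure_iff])
    simp only [Val.size] at h2
    have hlen := (l v).length_toList_lt
    have hmono : (l v).toList.length * q.eval (v.size + u.eval v.size) ≤
        u.eval v.size * q.eval (v.size + u.eval v.size) := Nat.mul_le_mul_right _ (by omega)
    have key := Is.whileLoop_fold (C := C.run T) (B := B.run T) (f := f) (ctx := v)
      (L := u.eval v.size) (Q := q.eval (v.size + u.eval v.size)) (S := Y) (I := I) ?_ ?_ ?_
      (l v) (s v) T (by omega) (by omega) (by omega)
    · constructor
      · refine Is.congr ((h1.andThen (c₂ := (u.eval v.size + 1) * (1 + Y + I + I)) (g := fun _ =>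
          (Val.foldM (fun a s => f (.pair v (.pair a s))) (l v).toList (s v)).map fun s' =>
            .pair v (.pair (l v).terminator s')) fun w hw => ?_).mono ?_) ?_
        · rw [PMF.mem_support_pure_iff] at hw
          subst hw
          exact key.1.mono (Nat.mul_le_mul_right _ (by omega))
        · omega
        · simp
      · intro w hw
        rw [PMF.mem_support_map_iff] at hw
        obtain ⟨s', hs', rfl⟩ := hw
        have := key.2 s' hs'
        have hterm : (l v).terminator.size ≤ (l v).size := by
          generalize l v = z
          induction z with
          | num n => exact le_rfl
          | pair a b _ ih => simp only [Val.terminator, Val.size]; omega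
        simp only [Val.size]
        omega
    · intro l s hsz
      have h3 := r.eval_mono_nat hsz
      exact ((hC _ T (by simp only at h3; omega)).1.congr rfl).mono (by simp only at h3; omega)
    · intro a l s hsz
      have h3 := t.eval_mono_nat hsz
      simp only at h3
      refine ((hB _ T (by omega)).1.congr ?_).mono (by omega)
      simp [PMF.map_comp, Val.fst, Val.snd, Function.comp_def, PMF.pure_bind]
    · intro a s ha w hw
      have h3 := q.eval_mono_nat (show v.size + a.size ≤ v.size + u.eval v.size by omega)
      exact (hq v a s w hw).trans (by simp only at h3; omega)
  · rw [PMF.bind_map]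
    exact (PMF.bind_pure _).symm

/-- A first pass reverses the list and a second one samples, as in `Val.foldM_reverse`. The state
grows by one sample per pass, whose length does not depend on the state. -/
theorem seqList {f : Val → PMF Val} (hf : PT f) {l : Val → Val} (hl : PTd l) :
    PT fun v => PMF.seqList ((l v).toList.map fun a => f (.pair v a)) := by
  have hid : PTd fun v => v := PT.id
  have hrev : PTd fun v => .list (l v).toList.reverse := by
    refine (foldM (f := fun v => PMF.pure (.pair v.snd.fst v.snd.snd))
      (hid.snd.fst.pair hid.snd.snd) (.X + 1) ?_ hl (PTd.const (.num 0))).congr fun v => ?_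
    · intro ctx a s w hw
      rw [PMF.mem_support_pure_iff] at hw
      subst hw
      simp [Val.size, Val.fst, Val.snd]; omega
    · simp only [Val.snd, Val.fst]
      rw [Val.foldM_pure]
      congr 1
      have : ∀ (L : List Val) (s : List Val), L.foldl (fun s a => Val.pair a s) (.list s)
          = .list (L.reverse ++ s) := by
        intro L
        induction L with
        | nil => intro s; rfl
        | cons a L ih => intro s; simpa [Val.list] using ih (a :: s)
      simpa [Val.list] using (this (l v).toList []).symm
  obtain ⟨t, ht⟩ : ∃ t : Polynomial ℕ, ∀ v, ∀ w ∈ (f v).support, w.size ≤ t.eval v.size := by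
    obtain ⟨P, t, h⟩ := hf
    exact ⟨t, fun v => (h v _ le_rfl).2⟩
  refine (foldM (f := fun v => (f (.pair v.fst v.snd.fst)).map fun x => .pair x v.snd.snd)
    ((map (hf.comp_det (hid.fst.pair hid.snd.fst)) (g := fun v => .pair v.snd v.fst.snd.snd)
      (hid.snd.pair hid.fst.snd.snd))) (t.comp (.X + 1) + 1) ?_ hrev (PTd.const (.num 0))).congr
      fun v => ?_
  · intro ctx a s w hw
    rw [PMF.mem_support_map_iff] at hw
    obtain ⟨x, hx, rfl⟩ := hw
    have := ht _ x hx
    simp only [Val.size, Val.fst, Val.snd] at this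
    simp only [Polynomial.eval_add, Polynomial.eval_comp, Polynomial.eval_X, Polynomial.eval_one,
      Val.size, Val.snd]
    omega
  · simp only [Val.snd, Val.fst, Val.toList_list]
    rw [Val.foldM_reverse]

end PT

/-! ### Modular exponentiation, and sampling of residues by coin tosses. -/

namespace Val

/-- Remainder, with the value `0` for a zero modulus. -/
def rmod (x M : ℕ) : ℕ := x % M * (decide (1 ≤ M)).toNat

theorem rmod_eq {x M : ℕ} (hM : M ≠ 0) : rmod x M = x % M := by
  simp [rmod, Nat.one_le_iff_ne_zero, hM]

/-- This holds even for `M = 0`, where `x % M` would be `x`. So repeated squaring stays short on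
malformed inputs too, as the time bound for all inputs requires. -/
theorem rmod_le (x M : ℕ) : rmod x M ≤ M := by
  rcases Nat.eq_zero_or_pos M with rfl | h
  · simp [rmod]
  · rw [rmod_eq h.ne']; exact (Nat.mod_lt _ h).le

/-- One step of binary exponentiation modulo `M`, on (base, exponent, accumulated product). -/
def powStep (M s : Val) : Val :=
  pair (num (rmod (s.fst.toNat * s.fst.toNat) M.toNat)) (pair (num (s.snd.fst.toNat / 2))
    (num (rmod (s.snd.snd.toNat *
      (s.snd.fst.toNat % 2 * s.fst.toNat + (1 - s.snd.fst.toNat % 2))) M.toNat)))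

/-- Binary exponentiation: `b ^ e` modulo `M`, with a number of steps given by the list `w`. -/
def powMod (w M b e : Val) : Val :=
  num (rmod ((w.toList.foldl (fun s _ => powStep M s) (pair b (pair e (num 1)))).snd.snd.toNat)
    M.toNat)

/-- The residue of `r * b ^ e` is invariant under a step, and the exponent reaches `0` after as many
halvings as it has bits. -/
theorem foldl_powStep {M : ℕ} (hM : M ≠ 0) (w : List Val) : ∀ b e r : ℕ, e < 2 ^ w.length →
    (w.foldl (fun s _ => powStep (num M) s) (pair (num b) (pair (num e) (num r)))).snd.snd.toNat
      ≡ r * b ^ e [MOD M] := by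
  induction w with
  | nil =>
    intro b e r he
    obtain rfl : e = 0 := by simpa using he
    simp [snd, toNat, Nat.ModEq]
  | cons a w ih =>
    intro b e r he
    rw [List.length_cons, pow_succ] at he
    rw [List.foldl_cons]
    refine (ih _ _ _ (by simp only [fst, snd, toNat]; omega)).trans ?_
    simp only [fst, snd, toNat, rmod_eq hM]
    -- The factor in parentheses is `b ^ (e % 2)`, written without a case distinction.
    have h : r * (e % 2 * b + (1 - e % 2)) * (b * b) ^ (e / 2) = r * b ^ e := by
      conv_rhs => rw [← Nat.mod_add_div e 2, pow_add, pow_mul]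
      rcases Nat.mod_two_eq_zero_or_one e with h | h <;> simp [h, sq]; ring
    calc r * (e % 2 * b + (1 - e % 2)) % M * (b * b % M) ^ (e / 2)
        ≡ r * (e % 2 * b + (1 - e % 2)) * (b * b) ^ (e / 2) [MOD M] :=
          (Nat.mod_modEq _ _).mul ((Nat.mod_modEq _ _).pow _)
      _ = r * b ^ e := h

theorem powMod_eq {M b e : ℕ} {w : Val} (hM : M ≠ 0) (he : e < 2 ^ w.toList.length) :
    powMod w (num M) (num b) (num e) = num (b ^ e % M) := by
  have := foldl_powStep hM w.toList b e 1 he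
  rw [one_mul] at this
  simp only [powMod, toNat] at this ⊢
  rw [rmod_eq hM, this]

/-- Concatenation of lists. -/
def append : Val → Val → Val
  | num _, v => v
  | pair a u, v => pair a (append u v)

theorem toList_append (u v : Val) : (append u v).toList = u.toList ++ v.toList := by
  induction u with
  | num n => rfl
  | pair a u _ ih => simp [append, toList, ih]

/-- A random number with as many bits as there are entries in a list. -/
noncomputable def randBits (l : List Val) : PMF Val :=
  foldM (fun _ s => (PMF.uniformOfFintype Bool).map fun b => num (2 * s.toNat + b.toNat)) l (num 0)

/-- An almost uniform residue modulo `M`, made of as many bits as there are entries in `w`. -/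
noncomputable def randMod (w M : Val) : PMF Val :=
  (randBits w.toList).map fun r => num (rmod r.toNat M.toNat)

end Val

namespace PTd
variable {f g : Val → Val}

theorem rmod (hf : PTd f) (hg : PTd g) : PTd fun v => .num (Val.rmod (f v).toNat (g v).toNat) :=
  (hf.mod hg).mul ((const (.num 1)).le hg)

theorem powStep (hf : PTd f) (hg : PTd g) : PTd fun v => Val.powStep (f v) (g v) :=
  ((hg.fst.mul hg.fst).rmod hf).pair ((hg.snd.fst.div (const (.num 2))).pair
    ((hg.snd.snd.mul (((hg.snd.fst.mod (const (.num 2))).mul hg.fst).add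
      ((const (.num 1)).sub (hg.snd.fst.mod (const (.num 2)))))).rmod hf))

theorem powMod {w M b e : Val → Val} (hw : PTd w) (hM : PTd M) (hb : PTd b) (he : PTd e) :
    PTd fun v => Val.powMod (w v) (M v) (b v) (e v) := by
  have hid : PTd fun v => v := PT.id
  have h : PTd fun u => (u.fst.toList.foldl (fun s _ => Val.powStep u.snd.fst s) u.snd.snd) := by
    -- Base and accumulated product are at most the modulus, which lies in the context, and the
    -- exponent only shrinks; hence the growth bound.
    refine (PT.foldM (f := fun v => PMF.pure (Val.powStep v.fst.snd.fst v.snd.snd))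
      (hid.fst.snd.fst.powStep hid.snd.snd) (.X + .X + 5) ?_ hid.fst hid.snd.snd).congr fun v => ?_
    · intro ctx a s w hw
      rw [PMF.mem_support_pure_iff] at hw
      subst hw
      have hM : ctx.snd.fst.toNat.size < ctx.size :=
        (Val.size_toNat_lt _).trans_le ((Val.size_fst_le _).trans (Val.size_snd_le _))
      have h1 := fun x => Nat.size_le_size (Val.rmod_le x ctx.snd.fst.toNat)
      have h2 := Nat.size_le_size (Nat.div_le_self s.snd.fst.toNat 2)
      have h3 : s.snd.fst.toNat.size < s.size :=
        (Val.size_toNat_lt _).trans_le ((Val.size_fst_le _).trans (Val.size_snd_le _))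
      have h4 := h1 (s.fst.toNat * s.fst.toNat)
      have h5 := h1 (s.snd.snd.toNat *
        (s.snd.fst.toNat % 2 * s.fst.toNat + (1 - s.snd.fst.toNat % 2)))
      simp only [Val.powStep, Val.size, Val.fst, Val.snd, Polynomial.eval_add, Polynomial.eval_X,
        Polynomial.eval_ofNat] at *
      omega
    · simp only [Val.fst, Val.snd]
      rw [Val.foldM_pure]
  exact ((h.comp (hw.pair (hM.pair (hb.pair (he.pair (const (.num 1))))))).snd.snd).rmod hM

theorem append (hf : PTd f) (hg : PTd g) : PTd fun v => Val.append (f v) (g v) := by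
  have hid : PTd fun v => v := PT.id
  -- Prepending one by one reverses a list, so two such passes append it in its own order.
  have hcons : ∀ {k : Val → Val}, PTd k → ∀ {l : Val → Val}, PTd l → PTd fun v =>
      (l v).toList.foldl (fun s a => Val.pair a s) (k v) := fun {k} hk {l} hl => by
    refine (PT.foldM (f := fun v => PMF.pure (.pair v.snd.fst v.snd.snd))
      (hid.snd.fst.pair hid.snd.snd) (.X + 1) ?_ hl hk).congr fun v => ?_
    · intro ctx a s w hw
      rw [PMF.mem_support_pure_iff] at hw
      subst hw
      simp [Val.size, Val.fst, Val.snd]; omega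
    · simp only [Val.snd, Val.fst]
      rw [Val.foldM_pure]
  refine (hcons hg (hcons (const (.num 0)) hf)).congr fun v => ?_
  have h1 : ∀ (L : List Val) (s : Val), (L.foldl (fun s a => Val.pair a s) s).toList
      = L.reverse ++ s.toList := by
    intro L
    induction L with
    | nil => intro s; rfl
    | cons a L ih => intro s; simp [ih, Val.toList]
  have h2 : ∀ u v : Val, Val.append u v = u.toList.foldr Val.pair v := by
    intro u v
    induction u with
    | num n => rfl
    | pair a u _ ih => simp [Val.append, Val.toList, ih]
  simp only [h1, h2]
  simp only [Val.toList, List.append_nil]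
  rw [List.foldl_reverse]

end PTd

namespace PT
variable {f g : Val → Val}

theorem randMod (hf : PTd f) (hg : PTd g) : PT fun v => Val.randMod (f v) (g v) := by
  have hid : PTd fun v => v := PT.id
  have h : PT fun v => Val.randBits (f v).toList := by
    refine (foldM (f := fun v => (PMF.uniformOfFintype Bool).map fun b =>
      .num (2 * v.snd.snd.toNat + b.toNat)) ?_ 4 ?_ hf (PTd.const (.num 0))).congr fun v => rfl
    · refine (map coin (((PTd.const (.num 2)).mul hid.fst.snd.snd).add hid.snd)).congr fun v => ?_
      simp [PMF.map_comp, Function.comp_def, Val.snd, Val.fst, Val.toNat, Val.ofBool]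
    · intro ctx a s w hw
      rw [PMF.mem_support_map_iff] at hw
      obtain ⟨b, -, rfl⟩ := hw
      have h1 := PTd.size_add_le (2 * s.toNat) b.toNat
      have h2 := s.size_toNat_lt
      have h3 := PTd.size_mul_le 2 s.toNat
      have h4 : b.toNat.size ≤ 1 := by cases b <;> simp
      have h5 : Nat.size 2 = 2 := by decide
      simp only [Val.size, Val.snd, Polynomial.eval_ofNat]
      omega
  exact map h (hid.snd.rmod (hg.comp hid.fst))

end PT

namespace Val
open PMF

/-- Exactly one sequence of coin tosses leads from `s` to `a` if `s` consists of the leading bits of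
`a`, and none otherwise. -/
theorem foldM_bits (l : List Val) : ∀ s a : ℕ,
    (foldM (fun _ s => (PMF.uniformOfFintype Bool).map fun b => num (2 * s.toNat + b.toNat)) l
      (num s)) (num a) = if a / 2 ^ l.length = s then (2 ^ l.length)⁻¹ else 0 := by
  induction l with
  | nil => intro s a; simp [foldM]
  | cons x l ih =>
    intro s a
    rw [foldM, PMF.bind_map, PMF.bind_apply, tsum_fintype]
    rw [Fintype.sum_bool]
    simp only [PMF.uniformOfFintype_apply, Function.comp_apply]
    have e : ∀ b : Bool, foldM (fun _ s => (PMF.uniformOfFintype Bool).map fun b =>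
        num (2 * s.toNat + b.toNat)) l (num (2 * (num s).toNat + b.toNat)) (num a)
        = if a / 2 ^ l.length = 2 * s + b.toNat then (2 ^ l.length : ℝ≥0∞)⁻¹ else 0 :=
      fun b => ih _ a
    rw [e, e]
    have h2 : (2 ^ (x :: l).length : ℝ≥0∞)⁻¹ = 2⁻¹ * (2 ^ l.length)⁻¹ := by
      rw [List.length_cons, pow_succ', ENNReal.mul_inv] <;> simp
    have h3 : a / 2 ^ (x :: l).length = a / 2 ^ l.length / 2 := by
      rw [List.length_cons, pow_succ, Nat.div_div_eq_div_mul]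
    rw [h2, h3]
    simp only [Bool.toNat_true, Bool.toNat_false, Fintype.card_bool, Nat.cast_ofNat]
    generalize a / 2 ^ l.length = y
    by_cases h0 : y = 2 * s + 1
    · rw [if_pos h0, if_neg (by omega), if_pos (by omega)]; simp
    · by_cases h1 : y = 2 * s + 0
      · rw [if_neg h0, if_pos h1, if_pos (by omega)]; simp
      · rw [if_neg h0, if_neg h1, if_neg (by omega)]; simp

theorem randBits_apply {l : List Val} {a : ℕ} (h : a < 2 ^ l.length) :
    randBits l (num a) = (2 ^ l.length)⁻¹ := by
  rw [randBits, foldM_bits, if_pos (Nat.div_eq_of_lt h)]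

/-- The numbers `a + M * i` with `i < 2 ^ L / M`, for `L` bits, are distinct preimages of `a` below
`2 ^ L`. -/
theorem le_randMod_apply {w : Val} {M a : ℕ} (ha : a < M) :
    (2 ^ w.toList.length / M : ℕ) * (2 ^ w.toList.length : ℝ≥0∞)⁻¹ ≤ randMod w (num M) (num a) := by
  have hM : M ≠ 0 := by omega
  set Q := 2 ^ w.toList.length / M
  have hQ : M * Q ≤ 2 ^ w.toList.length := Nat.mul_div_le _ _
  have hlt : ∀ i ∈ Finset.range Q, a + M * i < 2 ^ w.toList.length := by
    intro i hi
    have : M * (i + 1) ≤ M * Q := Nat.mul_le_mul_left _ (Finset.mem_range.1 hi)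
    rw [mul_add] at this
    omega
  have hinj : Function.Injective fun i => num (a + M * i) := fun i j h => by
    simpa [hM] using h
  rw [randMod, PMF.map_apply]
  classical
  refine le_trans ?_ (ENNReal.sum_le_tsum ((Finset.range Q).image fun i => num (a + M * i)))
  rw [Finset.sum_image hinj.injOn]
  calc (Q : ℝ≥0∞) * (2 ^ w.toList.length : ℝ≥0∞)⁻¹
      = ∑ i ∈ Finset.range Q, (2 ^ w.toList.length : ℝ≥0∞)⁻¹ := by simp
    _ ≤ _ := by
      refine Finset.sum_le_sum fun i hi => ?_
      rw [if_pos, randBits_apply (hlt i hi)]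
      simp only [toNat]
      rw [rmod_eq hM, Nat.add_mul_mod_self_left, Nat.mod_eq_of_lt ha]

/-- `randMod` almost dominates the uniform distribution on a large set of residues. -/
theorem dom_randMod {w : Val} {M : ℕ} {α : Type} [Fintype α] [Nonempty α] {f : α → ℕ} {κ : ℝ}
    (hf : Function.Injective f) (hlt : ∀ a, f a < M)
    (hκ : κ * (M * 2 ^ w.toList.length) ≤ (2 ^ w.toList.length - M) * Fintype.card α) :
    Dom (ENNReal.ofReal κ) ((uniformOfFintype α).map fun a => num (f a)) (randMod w (num M)) := by
  intro v
  by_cases hv : ∃ a, num (f a) = v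
  · obtain ⟨a, rfl⟩ := hv
    refine le_trans ?_ (le_randMod_apply (hlt a))
    have hinj : Function.Injective fun a => num (f a) := fun a b h => hf (by simpa using h)
    rw [PMF.map_apply, tsum_eq_single a, if_pos rfl, uniformOfFintype_apply]
    swap
    · intro b hb
      rw [if_neg fun h => hb (hinj h).symm]
    have hM : (0 : ℝ) < M := by exact_mod_cast (Nat.zero_le _).trans_lt (hlt a)
    have hA : (0 : ℝ) < Fintype.card α := by exact_mod_cast Fintype.card_pos
    have hL : (0 : ℝ) < 2 ^ w.toList.length := by positivity
    -- Rounding down loses less than one preimage. With `L` bits, `hκ` is the inequality `κ / card α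
    -- ≤ (2 ^ L / M - 1) / 2 ^ L`, cleared of denominators.
    have hQ : (2 ^ w.toList.length : ℝ) / M - 1 ≤ (2 ^ w.toList.length / M : ℕ) := by
      have := Nat.lt_div_mul_add (a := 2 ^ w.toList.length) (b := M) (by exact_mod_cast hM)
      have h' : (2 ^ w.toList.length : ℝ) < (2 ^ w.toList.length / M : ℕ) * M + M := by
        exact_mod_cast this
      rw [div_sub_one hM.ne', div_le_iff₀ hM]
      linarith
    rw [← ENNReal.ofReal_natCast, ← ENNReal.ofReal_inv_of_pos hA,
      ← ENNReal.ofReal_mul' (inv_nonneg.2 hA.le), ← ENNReal.ofReal_natCast,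
      show (2 ^ w.toList.length : ℝ≥0∞) = ENNReal.ofReal (2 ^ w.toList.length) by
        rw [ENNReal.ofReal_pow zero_le_two]; simp,
      ← ENNReal.ofReal_inv_of_pos hL, ← ENNReal.ofReal_mul (Nat.cast_nonneg _)]
    refine ENNReal.ofReal_le_ofReal (le_trans ?_
      (mul_le_mul_of_nonneg_right hQ (inv_nonneg.2 hL.le)))
    rw [← div_eq_mul_inv, ← div_eq_mul_inv, div_le_div_iff₀ hA hL, div_sub_one hM.ne',
      div_mul_eq_mul_div, le_div_iff₀ hM]
    linarith
  · rw [(PMF.apply_eq_zero_iff _ _).2, mul_zero]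
    · exact zero_le
    · rw [PMF.mem_support_map_iff]
      rintro ⟨a, -, h⟩
      exact hv ⟨a, h⟩

end Val

/-! ### Paillier encryption: homomorphic operations and decryption. -/

instance Factors.neZero_sq (M : Factors) : NeZero (M.N ^ 2) := ⟨pow_ne_zero 2 M.N_pos.ne'⟩

instance PublicKey.neZero_sq (pk : PublicKey) : NeZero (pk.N ^ 2) := ⟨pow_ne_zero 2 pk.pos.ne'⟩

/-- The binomial expansion stops after the linear term, as the square of `N` vanishes. -/
theorem ZMod.one_add_mul_pow (N t a : ℕ) :
    (1 + t * N : ZMod (N ^ 2)) ^ a = 1 + (a * t : ℕ) * N := by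
  have hN : (N : ZMod (N ^ 2)) * N = 0 := by
    rw [← Nat.cast_mul, ← sq, ZMod.natCast_self]
  induction a with
  | zero => simp
  | succ a ih =>
    rw [pow_succ _ a, ih]
    push_cast
    linear_combination (a * t * t : ZMod (N ^ 2)) * hN

theorem ZMod.one_add_mul_eq_one_iff {N t : ℕ} (hN : N ≠ 0) :
    (1 + t * N : ZMod (N ^ 2)) = 1 ↔ N ∣ t := by
  rw [add_eq_left, ← Nat.cast_mul, ZMod.natCast_eq_zero_iff, sq,
    Nat.mul_dvd_mul_iff_right (Nat.pos_of_ne_zero hN)]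

namespace PublicKey

variable {pk : PublicKey}

/-- Only `x` modulo `N` matters, and `1 + (x % N) * N` is below `N ^ 2` once `N ≥ 2`, so that
division on representatives recovers it. -/
theorem logMap_one_add (hN : 2 ≤ pk.N) (x : ℕ) :
    pk.logMap (1 + x * pk.N) = (x : ZMod pk.N) := by
  have h1 : (1 + x * pk.N : pk.Cipher) = ((1 + (x % pk.N) * pk.N : ℕ) : pk.Cipher) := by
    have : x * pk.N = (x % pk.N) * pk.N + pk.N ^ 2 * (x / pk.N) := by
      conv_lhs => rw [← Nat.mod_add_div x pk.N]
      ring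
    rw [← Nat.cast_mul, this]
    push_cast
    rw [← Nat.cast_pow, ZMod.natCast_self]
    simp
  have hlt : 1 + (x % pk.N) * pk.N < pk.N ^ 2 := by
    have : (x % pk.N + 1) * pk.N ≤ pk.N * pk.N :=
      Nat.mul_le_mul_right _ (Nat.mod_lt _ pk.pos)
    rw [add_mul] at this
    rw [sq]; omega
  rw [logMap, h1, ZMod.val_natCast, Nat.mod_eq_of_lt hlt, Nat.add_sub_cancel_left,
    Nat.mul_div_cancel _ pk.pos, ZMod.natCast_mod]

/-- `c` is an encryption of `a`. -/
def Rep (a : pk.Plain) (c : pk.Cipher) : Prop :=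
  ∃ y : (ZMod (pk.N ^ 2))ˣ, c = pk.g ^ a.val * (y : pk.Cipher) ^ pk.N

theorem isUnit_natCast_val (r : pk.Nonce) : IsUnit (((r : ZMod pk.N).val : ℕ) : pk.Cipher) := by
  rw [ZMod.isUnit_iff_coprime]
  exact (ZMod.val_coe_unit_coprime r).pow_right 2

theorem rep_enc (a : pk.Plain) (r : pk.Nonce) : Rep a (pk.enc a r) :=
  ⟨(isUnit_natCast_val r).unit, rfl⟩

section
variable (hg : pk.g ^ pk.N = 1)
include hg

/-- Plaintexts may wrap around modulo `N` without affecting the ciphertext. -/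
theorem g_pow_mod (n : ℕ) : pk.g ^ (n % pk.N) = pk.g ^ n := by
  conv_rhs => rw [← Nat.mod_add_div n pk.N, pow_add, pow_mul, hg, one_pow, mul_one]

theorem Rep.mul {a b : pk.Plain} {c d : pk.Cipher} (hc : Rep a c) (hd : Rep b d) :
    Rep (a + b) (c * d) := by
  obtain ⟨y, rfl⟩ := hc
  obtain ⟨z, rfl⟩ := hd
  refine ⟨y * z, ?_⟩
  rw [ZMod.val_add, g_pow_mod hg, pow_add, Units.val_mul, mul_pow]
  ring

theorem Rep.pow {a : pk.Plain} {c : pk.Cipher} (hc : Rep a c) (n : ℕ) :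
    Rep ((n : pk.Plain) * a) (c ^ n) := by
  induction n with
  | zero => exact ⟨1, by simp⟩
  | succ n ih =>
    have := ih.mul hg hc
    rw [pow_succ c]
    convert this using 1
    push_cast; ring

theorem Rep.otimes {a : pk.Plain} {c : pk.Cipher} (b : ℤ) (hc : Rep a c) :
    Rep ((b : pk.Plain) * a) (pk.otimes b c) := by
  have := hc.pow hg (b : pk.Plain).val
  rwa [ZMod.natCast_zmod_val] at this

theorem Rep.prod {ι : Type} (s : Finset ι) {a : ι → pk.Plain} {c : ι → pk.Cipher}
    (h : ∀ i ∈ s, Rep (a i) (c i)) : Rep (∑ i ∈ s, a i) (∏ i ∈ s, c i) := by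
  classical
  induction s using Finset.induction_on with
  | empty => exact ⟨1, by simp⟩
  | insert i s hi ih =>
    rw [Finset.sum_insert hi, Finset.prod_insert hi]
    exact (h i (Finset.mem_insert_self _ _)).mul hg
      (ih fun j hj => h j (Finset.mem_insert_of_mem hj))

theorem Rep.matVec {k l : ℕ} (A : Matrix (Fin k) (Fin l) ℤ) {v : Fin l → ℤ} {c : Fin l → pk.Cipher}
    (h : ∀ j, Rep (v j : pk.Plain) (c j)) (i : Fin k) :
    Rep ((A.mulVec v i : ℤ) : pk.Plain) (pk.matVec A c i) := by
  rw [Matrix.mulVec, dotProduct, Int.cast_sum]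
  simp only [Int.cast_mul]
  exact Rep.prod hg _ fun j _ => (h j).otimes hg _

end

/-- The distribution of an `N`-th power of a random value does not depend on whether it is chosen
modulo `N` or modulo `N ^ 2`. -/
theorem map_nonce_pow (N : ℕ) [NeZero N] [NeZero (N ^ 2)] {α : Type} (f : ZMod (N ^ 2) → α) :
    (PMF.uniformOfFintype (ZMod N)ˣ).map
        (fun r : (ZMod N)ˣ => f (((r : ZMod N).val : ZMod (N ^ 2)) ^ N))
      = (PMF.uniformOfFintype (ZMod (N ^ 2))ˣ).map
          fun R : (ZMod (N ^ 2))ˣ => f ((R : ZMod (N ^ 2)) ^ N) := by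
  have hd : N ∣ N ^ 2 := dvd_pow_self N two_ne_zero
  rw [← PMF.map_uniformOfFintype_monoidHom (ZMod.unitsMap hd) (ZMod.unitsMap_surjective hd),
    PMF.map_comp]
  congr 1
  funext R
  simp only [Function.comp_apply]
  congr 1
  have h1 : (N : ZMod (N ^ 2)) ∣ (((ZMod.unitsMap hd R : ZMod N).val : ℕ) : ZMod (N ^ 2)) - R := by
    rw [ZMod.unitsMap_val, ZMod.cast_eq_val, ZMod.val_natCast]
    refine ⟨-((R : ZMod (N ^ 2)).val / N : ℕ), ?_⟩
    have h2 := Nat.mod_add_div (R : ZMod (N ^ 2)).val N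
    have h3 : (((R : ZMod (N ^ 2)).val : ℕ) : ZMod (N ^ 2)) = R := ZMod.natCast_zmod_val _
    rw [← h2] at h3
    push_cast at h3 ⊢
    linear_combination h3
  -- Elements congruent modulo `N` have `N`-th powers congruent modulo `N ^ 2`, and `N ^ 2` is zero
  -- here.
  have h4 := dvd_sub_pow_of_dvd_sub h1 1
  rw [pow_one, one_add_one_eq_two, ← Nat.cast_pow, ZMod.natCast_self, zero_dvd_iff,
    sub_eq_zero] at h4
  exact h4

end PublicKey

namespace Factors
variable (M : Factors)

theorem two_le_N : 2 ≤ M.N :=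
  (M.prime_p.two_le).trans (Nat.le_mul_of_pos_right _ M.prime_q.pos)

/-- By Fermat's theorem for both primes and the Chinese remainder theorem, this power is `1` modulo
`N`. -/
theorem exists_pow_lcm (y : (ZMod (M.N ^ 2))ˣ) :
    ∃ t : ℕ, (y : ZMod (M.N ^ 2)) ^ Nat.lcm (M.p - 1) (M.q - 1) = 1 + t * M.N := by
  set γ := Nat.lcm (M.p - 1) (M.q - 1) with hγ
  set v := (y : ZMod (M.N ^ 2)).val with hv
  have hcop : v.Coprime M.N := (Nat.coprime_pow_right_iff (by norm_num) _ _).1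
    (ZMod.val_coe_unit_coprime y)
  have hprime : ∀ r : ℕ, r.Prime → r ∣ M.N → r - 1 ∣ γ → v ^ γ ≡ 1 [MOD r] := by
    rintro r hr hrN ⟨d, hd⟩
    have := Nat.ModEq.pow_totient (hcop.coprime_dvd_right hrN)
    rw [Nat.totient_prime hr] at this
    rw [hd, pow_mul]
    simpa using this.pow d
  have hpq : M.p.Coprime M.q := (Nat.coprime_primes M.prime_p M.prime_q).2 M.ne
  have h1 : v ^ γ ≡ 1 [MOD M.N] := (Nat.modEq_and_modEq_iff_modEq_mul hpq).1
    ⟨hprime _ M.prime_p ⟨_, rfl⟩ (Nat.dvd_lcm_left _ _),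
      hprime _ M.prime_q ⟨M.p, mul_comm _ _⟩ (Nat.dvd_lcm_right _ _)⟩
  have hpos : 1 ≤ v ^ γ := Nat.one_le_iff_ne_zero.2 fun h => by
    rw [h] at h1
    have := h1.symm
    rw [Nat.ModEq, Nat.zero_mod, Nat.mod_eq_of_lt M.two_le_N] at this
    omega
  obtain ⟨t, ht⟩ := (Nat.modEq_iff_dvd' hpos).1 h1.symm
  refine ⟨t, ?_⟩
  rw [← ZMod.natCast_zmod_val (y : ZMod (M.N ^ 2)), ← Nat.cast_pow, ← hv,
    show v ^ γ = 1 + t * M.N by rw [mul_comm, ← ht]; omega]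
  push_cast; rfl

theorem pow_mul_lcm (y : (ZMod (M.N ^ 2))ˣ) :
    ((y : ZMod (M.N ^ 2)) ^ M.N) ^ Nat.lcm (M.p - 1) (M.q - 1) = 1 := by
  obtain ⟨t, ht⟩ := M.exists_pow_lcm y
  rw [pow_right_comm, ht, ZMod.one_add_mul_pow, ZMod.one_add_mul_eq_one_iff M.N_pos.ne']
  exact Dvd.intro _ rfl

variable {M} {g : ℕ} (hg : orderOf (g : ZMod (M.N ^ 2)) = M.N)
include hg

theorem g_pow_N : (M.publicKey g).g ^ (M.publicKey g).N = 1 := by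
  have := pow_orderOf_eq_one (g : ZMod (M.N ^ 2))
  rwa [hg] at this

theorem isUnit_g : IsUnit (g : ZMod (M.N ^ 2)) :=
  (orderOf_pos_iff.1 (hg.symm ▸ M.N_pos : 0 < orderOf (g : ZMod (M.N ^ 2)))).isUnit

/-- The power `γ` of the ciphertext is `1 + a t N`, where `g ^ γ = 1 + t N`. The logarithm reads off
`a t`, and `δ` is the inverse of `t`. -/
theorem dec_of_rep {a : (M.publicKey g).Plain} {c : (M.publicKey g).Cipher}
    (h : PublicKey.Rep a c) : (M.publicKey g).dec (M.secretKey g) c = a := by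
  obtain ⟨y, rfl⟩ := h
  set γ := Nat.lcm (M.p - 1) (M.q - 1) with hγ
  obtain ⟨u, hu⟩ := isUnit_g hg
  obtain ⟨t, ht⟩ := M.exists_pow_lcm u
  rw [hu] at ht
  -- For `d = gcd t N` and `e = N / d` one has `g ^ (γ e) = (1 + t N) ^ e = 1`. So `N` divides `γ
  -- e`, hence `e` as `γ` is prime to `N`, and thus `d = 1`. This uses that the order of `g` is
  -- exactly `N`.
  have hcop : t.Coprime M.N := by
    have hγN : M.N.Coprime γ := M.coprime.coprime_dvd_right
      (Nat.lcm_dvd (Dvd.intro _ rfl) (Dvd.intro_left _ rfl))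
    set d := Nat.gcd t M.N with hd
    obtain ⟨s, hs⟩ : d ∣ t := Nat.gcd_dvd_left _ _
    obtain ⟨e, he⟩ : d ∣ M.N := Nat.gcd_dvd_right _ _
    have h1 : (g : ZMod (M.N ^ 2)) ^ (γ * e) = 1 := by
      rw [pow_mul, ht, ZMod.one_add_mul_pow, ZMod.one_add_mul_eq_one_iff M.N_pos.ne']
      exact ⟨s, by rw [hs, he]; ring⟩
    have h2 : M.N ∣ e := hγN.dvd_of_dvd_mul_left (hg ▸ orderOf_dvd_of_pow_eq_one h1)
    have he0 : 0 < e := Nat.pos_of_ne_zero fun h => M.N_pos.ne' (by rw [he, h, mul_zero])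
    have h3 : M.N ≤ e := Nat.le_of_dvd he0 h2
    have h4 : d * e ≤ 1 * e := by rw [← he, one_mul]; exact h3
    have h5 : d ≤ 1 := Nat.le_of_mul_le_mul_right h4 he0
    have h6 : d ≠ 0 := fun h => M.N_pos.ne' (by rw [he, h, zero_mul])
    exact Nat.coprime_iff_gcd_eq_one.2 (by omega)
  have hN : 2 ≤ (M.publicKey g).N := M.two_le_N
  have h7 : ((M.publicKey g).g ^ a.val * (y : (M.publicKey g).Cipher) ^ (M.publicKey g).N) ^ γ
      = 1 + (a.val * t : ℕ) * (M.publicKey g).N := by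
    rw [mul_pow, show ((y : (M.publicKey g).Cipher) ^ (M.publicKey g).N) ^ γ = 1 from
      M.pow_mul_lcm y, mul_one, pow_right_comm]
    exact (congrArg (· ^ a.val) ht).trans (ZMod.one_add_mul_pow _ _ _)
  have h8 : (M.publicKey g).logMap ((M.publicKey g).g ^ γ) = (t : ZMod M.N) := by
    rw [show (M.publicKey g).g ^ γ = 1 + t * (M.publicKey g).N from ht]
    exact PublicKey.logMap_one_add hN t
  have h9 : (M.secretKey g).δ = (t : ZMod M.N)⁻¹ :=
    congrArg (fun z : ZMod M.N => z⁻¹) h8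
  rw [PublicKey.dec, show (M.secretKey g).γ = γ from rfl, h7, PublicKey.logMap_one_add hN, h9]
  have h10 : ((a.val : ℕ) : ZMod M.N) = a := ZMod.natCast_zmod_val a
  have h11 := ZMod.coe_mul_inv_eq_one t hcop
  have h12 : ∀ z : ZMod M.N, z * t * (t : ZMod M.N)⁻¹ = z := fun z => by
    rw [mul_assoc, h11, mul_one]
  push_cast
  exact (congrArg (fun z : ZMod M.N => z * t * (t : ZMod M.N)⁻¹) h10).trans
    (h12 a)

end Factors

/-! ### Density of the units, and the quality of sampled residues. -/

namespace Factors
variable {M : Factors} {n : ℕ}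

theorem totient_N (M : Factors) : Nat.totient M.N = (M.p - 1) * (M.q - 1) := by
  rw [N, Nat.totient_mul ((Nat.coprime_primes M.prime_p M.prime_q).2 M.ne),
    Nat.totient_prime M.prime_p, Nat.totient_prime M.prime_q]

theorem totient_N_sq (M : Factors) : Nat.totient (M.N ^ 2) = M.N * Nat.totient M.N := by
  have h : (M.p ^ 2).Coprime (M.q ^ 2) :=
    ((Nat.coprime_primes M.prime_p M.prime_q).2 M.ne).pow 2 2
  rw [totient_N, N, mul_pow, Nat.totient_mul h, Nat.totient_prime_pow_succ M.prime_p,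
    Nat.totient_prime_pow_succ M.prime_q]
  ring

theorem N_lt (hp : M.p.size = n) (hq : M.q.size = n) : M.N < 2 ^ (2 * n) := by
  have h1 := Nat.lt_size_self M.p
  have h2 := Nat.lt_size_self M.q
  rw [hp] at h1
  rw [hq] at h2
  rw [two_mul, pow_add]
  exact Nat.mul_lt_mul'' h1 h2

/-- The number of non-units is `p + q - 1`, and each of `p`, `q` is at most `2 N / 2 ^ n` because
the other one is at least `2 ^ (n - 1)`. -/
theorem totient_ge (hp : M.p.size = n) (hq : M.q.size = n) :
    (1 - 4 / 2 ^ n : ℝ) * M.N ≤ Nat.totient M.N := by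
  have h : ∀ r : ℕ, r.Prime → r.size = n → (2 : ℝ) ^ n ≤ 2 * r := fun r hr hn => by
    have h0 : n ≠ 0 := fun h => hr.ne_zero (by rwa [h, Nat.size_eq_zero] at hn)
    have h1 : 2 ^ (n - 1) ≤ r := Nat.lt_size.1 (by omega)
    have h2 : 2 ^ n ≤ 2 * r := by
      calc 2 ^ n = 2 * 2 ^ (n - 1) := by rw [← pow_succ']; congr 1; omega
        _ ≤ _ := by omega
    exact_mod_cast h2
  have h1 := h _ M.prime_p hp
  have h2 := h _ M.prime_q hq
  rw [totient_N, N]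
  push_cast [M.prime_p.one_le, M.prime_q.one_le]
  have h3 : (0 : ℝ) < 2 ^ n := by positivity
  rw [one_sub_div h3.ne', div_mul_eq_mul_div, div_le_iff₀ h3]
  have hp0 : (0 : ℝ) ≤ M.p := Nat.cast_nonneg _
  have hq0 : (0 : ℝ) ≤ M.q := Nat.cast_nonneg _
  nlinarith [mul_le_mul_of_nonneg_left h1 hq0, mul_le_mul_of_nonneg_left h2 hp0]

/-- Residues outside the range of `f` cost at most `4 / 2 ^ n`. Rounding costs another `1 / 2 ^ n`,
because `5 * n` bits exceed the at most `4 * n` bits of the modulus by `n`. -/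
theorem dom_randMod {α : Type} [Fintype α] [Nonempty α] {f : α → ℕ} {m : ℕ}
    (hf : Function.Injective f) (hlt : ∀ a, f a < m) {w : Val} (hw : w.toList.length = 5 * n)
    (hm : m ≤ 2 ^ (4 * n)) (hcard : (1 - 4 / 2 ^ n : ℝ) * m ≤ Fintype.card α) :
    PMF.Dom (ENNReal.ofReal (1 - 5 / 2 ^ n))
      ((PMF.uniformOfFintype α).map fun a => .num (f a)) (Val.randMod w (.num m)) := by
  refine Val.dom_randMod hf hlt ?_
  have hle : (Fintype.card α : ℝ) ≤ m := by
    have := Fintype.card_le_of_injective (fun a => (⟨f a, hlt a⟩ : Fin m))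
      fun a b h => hf (by simpa using h)
    rw [Fintype.card_fin] at this
    exact_mod_cast this
  rw [hw]
  have hn : (0 : ℝ) < 2 ^ n := by positivity
  have hL : (2 : ℝ) ^ n * m ≤ 2 ^ (5 * n) := by
    have h1 : (m : ℝ) ≤ 2 ^ (4 * n) := by exact_mod_cast hm
    calc (2 : ℝ) ^ n * m ≤ 2 ^ n * 2 ^ (4 * n) := mul_le_mul_of_nonneg_left h1 hn.le
      _ = 2 ^ (5 * n) := by rw [← pow_add]; congr 1; omega
  generalize (2 : ℝ) ^ (5 * n) = L at *
  have hA0 : (0 : ℝ) ≤ Fintype.card α := Nat.cast_nonneg _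
  generalize (Fintype.card α : ℝ) = A at *
  have hm0 : (0 : ℝ) ≤ m := Nat.cast_nonneg _
  have hL0 : 0 ≤ L := le_trans (by positivity) hL
  have h1 : (m : ℝ) ≤ L / 2 ^ n := by rw [le_div_iff₀ hn, mul_comm]; exact hL
  calc (1 - 5 / 2 ^ n) * (m * L) = (1 - 4 / 2 ^ n) * m * L - L / 2 ^ n * m := by ring
    _ ≤ A * L - m * A := sub_le_sub (mul_le_mul_of_nonneg_right hcard hL0)
      (mul_le_mul h1 hle hA0 (hm0.trans h1))
    _ = _ := by ring

theorem dom_randMod_units {m : ℕ} [NeZero m] {w : Val} (hw : w.toList.length = 5 * n)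
    (hm : m ≤ 2 ^ (4 * n)) (hcard : (1 - 4 / 2 ^ n : ℝ) * m ≤ Nat.totient m) :
    PMF.Dom (ENNReal.ofReal (1 - 5 / 2 ^ n))
      ((PMF.uniformOfFintype (ZMod m)ˣ).map fun r : (ZMod m)ˣ => .num (r : ZMod m).val)
      (Val.randMod w (.num m)) :=
  dom_randMod (f := fun r : (ZMod m)ˣ => (r : ZMod m).val)
    (fun _ _ h => Units.ext (ZMod.val_injective _ h)) (fun _ => ZMod.val_lt _) hw hm
    (by rwa [ZMod.card_units_eq_totient])

theorem dom_randMod_nonce (hp : M.p.size = n) (hq : M.q.size = n) {w : Val}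
    (hw : w.toList.length = 5 * n) :
    PMF.Dom (ENNReal.ofReal (1 - 5 / 2 ^ n))
      ((PMF.uniformOfFintype (ZMod M.N)ˣ).map fun r : (ZMod M.N)ˣ => .num (r : ZMod M.N).val)
      (Val.randMod w (.num M.N)) :=
  dom_randMod_units hw ((N_lt hp hq).le.trans (Nat.pow_le_pow_right (by norm_num) (by omega)))
    (totient_ge hp hq)

theorem dom_randMod_unit (hp : M.p.size = n) (hq : M.q.size = n) {w : Val}
    (hw : w.toList.length = 5 * n) :
    PMF.Dom (ENNReal.ofReal (1 - 5 / 2 ^ n))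
      ((PMF.uniformOfFintype (ZMod (M.N ^ 2))ˣ).map fun r : (ZMod (M.N ^ 2))ˣ =>
        .num (r : ZMod (M.N ^ 2)).val) (Val.randMod w (.num (M.N ^ 2))) := by
  have h1 : M.N ^ 2 ≤ 2 ^ (4 * n) := by
    calc M.N ^ 2 ≤ (2 ^ (2 * n)) ^ 2 := Nat.pow_le_pow_left (N_lt hp hq).le 2
      _ = 2 ^ (4 * n) := by rw [← pow_mul]; congr 1; omega
  have h2 : (1 - 4 / 2 ^ n : ℝ) * (M.N ^ 2 : ℕ) ≤ Nat.totient (M.N ^ 2) := by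
    have := mul_le_mul_of_nonneg_left (totient_ge hp hq) (Nat.cast_nonneg M.N)
    rw [totient_N_sq]
    push_cast
    linarith
  exact dom_randMod_units hw h1 h2

end Factors

/-! ### The protocol: the client's output and the distribution of the server's view. -/

namespace PublicKey
variable {pk : PublicKey}

/-- Componentwise encryption of a vector of integers. -/
def RepVec {k : ℕ} (v : Fin k → ℤ) (c : Fin k → pk.Cipher) : Prop :=
  ∀ i, Rep (v i : pk.Plain) (c i)

theorem repVec_encVec {k : ℕ} (v : Fin k → ℤ) (r : Fin k → pk.Nonce) :
    RepVec v (pk.encVec v r) := fun i => rep_enc _ (r i)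

/-- The distribution of the random value of one encryption. -/
noncomputable def nonceDist (pk : PublicKey) : PMF Val :=
  (PMF.uniformOfFintype pk.Nonce).map fun r : pk.Nonce => .num (r : ZMod pk.N).val

/-- The distribution of the encryption of an integer. -/
noncomputable def encDist (pk : PublicKey) (a : ℤ) : PMF Val :=
  (PMF.uniformOfFintype pk.Nonce).map fun r : pk.Nonce => .num (pk.enc (a : pk.Plain) r).val

theorem map_ofZModVec_nonces (k : ℕ) :
    (pk.nonces k).map (fun ρ => Val.ofZModVec fun i => (ρ i : ZMod pk.N))
      = PMF.seqList (List.replicate k pk.nonceDist) := by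
  rw [← List.ofFn_const]
  exact PMF.seqList_ofFn (α := pk.Nonce) fun _ r => .num (r : ZMod pk.N).val

theorem map_ofZModVec_encVec {k : ℕ} (v : Fin k → ℤ) :
    (pk.nonces k).map (fun r => Val.ofZModVec (pk.encVec v r))
      = PMF.seqList ((List.ofFn v).map pk.encDist) := by
  rw [List.map_ofFn]
  exact PMF.seqList_ofFn (α := pk.Nonce) fun i r => .num (pk.enc (v i : pk.Plain) r).val

end PublicKey

open PublicKey

namespace Instance

variable (J : Instance)

/-- The server's input in an execution with the data `J`. -/
def server (pk : PublicKey) (r : Fin J.dim → pk.Nonce) : ServerInput J.toParams pk :=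
  { H := J.H, F := J.F, η := J.η, Uw := pk.encVec J.Uw r }

/-- The client's input in an execution with the data `J`. -/
def client {pk : PublicKey} (sk : SecretKey pk) : ClientInput J.toParams pk :=
  { x := J.x, lu := J.lu, hu := J.hu, sk := sk }

/-- The plaintexts of the messages that the server receives. -/
def plaintexts : List (List ℤ) :=
  List.ofFn J.x :: (List.range' 1 J.K).map fun k => List.ofFn (J.iterate k).1

variable {J} {pk : PublicKey} {r : Fin J.dim → pk.Nonce}

theorem repVec_initU (ρ : Fin J.numCoins → pk.Nonce) :
    RepVec J.initU ((J.server pk r).initU ρ) := fun i => by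
  rw [initU, ServerInput.initU]
  split_ifs
  · exact_mod_cast rep_enc (pk := pk) 0 _
  · exact rep_enc _ _
  · exact_mod_cast rep_enc (pk := pk) 0 _

variable (hg : pk.g ^ pk.N = 1)
include hg

theorem repVec_initZ {v : Fin J.dim → ℤ} {c : Fin J.dim → pk.Cipher} (h : RepVec v c) :
    RepVec (fun i => 2 ^ J.lf * v i) (ServerInput.initZ (P := J.toParams) c) := fun i => by
  have := (h i).otimes hg (2 ^ J.lf)
  rwa [← Int.cast_mul] at this

theorem repVec_gradStep {z : Fin J.dim → ℤ} {cz : Fin J.dim → pk.Cipher} {cx : Fin J.n → pk.Cipher}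
    (hz : RepVec z cz) (hx : RepVec J.x cx) :
    RepVec (J.gradStep z) ((J.server pk r).gradStep cx cz) := fun i => by
  have := (Rep.matVec hg
    ((2 : ℤ) ^ J.lf • (1 : Matrix (Fin J.dim) (Fin J.dim) ℤ) - J.H) hz i).mul hg
    (Rep.matVec hg (-((2 : ℤ) ^ J.lf • J.F.transpose)) hx i)
  rwa [← Int.cast_add, Matrix.neg_mulVec, Pi.neg_apply, ← sub_eq_add_neg] at this

theorem repVec_nextZ {v' v : Fin J.dim → ℤ} {c' c : Fin J.dim → pk.Cipher}
    (h' : RepVec v' c') (h : RepVec v c) :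
    RepVec (fun i => (2 ^ J.lf + J.η) * v' i + -J.η * v i) ((J.server pk r).nextZ c' c) :=
  fun i => by
  have := ((h' i).otimes hg (2 ^ J.lf + J.η)).mul hg ((h i).otimes hg (-J.η))
  rwa [← Int.cast_mul, ← Int.cast_mul, ← Int.cast_add] at this

omit hg in
-- The bound `3 |t| < N` puts `t` strictly between `-N / 2` and `N / 2`, so it is the representative
-- of least absolute value.
theorem client_step {sk : SecretKey pk}
    (hdec : ∀ (a : pk.Plain) (c : pk.Cipher), Rep a c → pk.dec sk c = a)
    {t : Fin J.dim → ℤ} {c : Fin J.dim → pk.Cipher} (h : RepVec t c)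
    (ht : ∀ i, 3 * |t i| < (pk.N : ℤ)) : (J.client sk).step c = J.truncProject t := by
  funext i
  have h1 : (pk.dec sk (c i)).valMinAbs = t i := by
    rw [hdec _ _ (h i), ZMod.valMinAbs_spec]
    have h2 := ht i
    have h3 := neg_abs_le (t i)
    have h4 := le_abs_self (t i)
    have h5 := abs_nonneg (t i)
    exact ⟨rfl, by omega, by omega⟩
  change max (-J.lu i) (min (J.hu i) ((pk.dec sk (c i)).valMinAbs / 2 ^ (2 * J.lf))) = _
  rw [h1]
  rfl

/-- The messages that the server receives are encryptions of the iterates, and the client's last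
iterate is the correct one. -/
theorem iterations_spec {sk : SecretKey pk}
    (hdec : ∀ (a : pk.Plain) (c : pk.Cipher), Rep a c → pk.dec sk c = a)
    (hJ : J.NoOverflow pk.N) {cx : Fin J.n → pk.Cipher} (hx : RepVec J.x cx) :
    ∀ (k j : ℕ) (U z : Fin J.dim → pk.Cipher) (u : Fin J.dim → ℤ), j + k = J.K →
      RepVec (J.iterate j).1 U → RepVec (J.iterate j).2 z →
      (iterations (J.server pk r) (J.client sk) cx k U z u).map
          (fun o => Val.list (o.1.map .ofZModVec))
        = PMF.seqList ((List.range' (j + 1) k).map fun i =>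
            PMF.seqList ((List.ofFn (J.iterate i).1).map pk.encDist)) ∧
      ∀ o ∈ (iterations (J.server pk r) (J.client sk) cx k U z u).support,
        0 < k → o.2 = (J.iterate J.K).1
  | 0, j, U, z, u, _, _, _ => by
    refine ⟨?_, fun o _ h => absurd h (lt_irrefl 0)⟩
    simp [iterations, PMF.pure_map, PMF.seqList, Val.list]
  | k + 1, j, U, z, u, hjk, hU, hz => by
    have ht := repVec_gradStep (r := r) hg hz hx
    have hstep : (J.client sk).step ((J.server pk r).gradStep cx z) = (J.iterate (j + 1)).1 :=
      client_step hdec ht (hJ j (by omega))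
    have ih := fun ρ : Fin J.dim → pk.Nonce =>
      iterations_spec hdec hJ hx k (j + 1) (pk.encVec (J.iterate (j + 1)).1 ρ)
        ((J.server pk r).nextZ (pk.encVec (J.iterate (j + 1)).1 ρ) U) (J.iterate (j + 1)).1
        (by omega) (repVec_encVec _ _) (repVec_nextZ hg (repVec_encVec _ _) hU)
    constructor
    · simp only [iterations, hstep]
      rw [PMF.map_bind, List.range'_succ, List.map_cons, PMF.seqList, ← map_ofZModVec_encVec]
      simp only [PMF.map_comp]
      simp only [← PMF.bind_pure_comp]
      -- The distribution of the later messages does not depend on the nonces of the current one, so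
      -- they may be drawn first, as in `seqList`.
      rw [PMF.bind_comm]
      congr 1
      funext ρ
      rw [← (ih ρ).1]
      simp only [PMF.bind_map, Function.comp_def, List.map_cons, Val.list]
    · intro o ho _
      simp only [iterations, hstep, PMF.mem_support_bind_iff, PMF.mem_support_map_iff] at ho
      obtain ⟨ρ, -, o', ho', rfl⟩ := ho
      -- The induction hypothesis says nothing about the client's iterate when no rounds remain;
      -- then it is the iterate just computed.
      rcases Nat.eq_zero_or_pos k with rfl | hk
      · simp only [iterations, PMF.mem_support_pure_iff] at ho'
        rw [ho', ← hjk]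
      · exact (ih ρ).2 o' ho' hk

/-- Each message is freshly encrypted by the client, and its plaintext is determined by the
instance. So the messages are independent of the server's own randomness. -/
theorem execute_spec {sk : SecretKey pk}
    (hdec : ∀ (a : pk.Plain) (c : pk.Cipher), Rep a c → pk.dec sk c = a)
    (hJ : J.NoOverflow pk.N) :
    ((execute (J.server pk r) (J.client sk)).map Prod.fst
        = (PMF.seqList (List.replicate J.numCoins pk.nonceDist)).bind fun ρ =>
          (PMF.seqList (J.plaintexts.map fun l => PMF.seqList (l.map pk.encDist))).map fun m =>
            .pair (J.server pk r).encode (.pair ρ m)) ∧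
      ∀ o ∈ (execute (J.server pk r) (J.client sk)).support, o.2 = J.clientOutput := by
  have key := fun (ρ : Fin J.numCoins → pk.Nonce) (r' : Fin J.n → pk.Nonce) =>
    iterations_spec (r := r) hg hdec hJ (repVec_encVec J.x r') J.K 0
      ((J.server pk r).initU ρ) (ServerInput.initZ ((J.server pk r).initU ρ)) 0
      (by omega) (repVec_initU ρ) (repVec_initZ hg (repVec_initU ρ))
  constructor
  · rw [execute, ← map_ofZModVec_nonces, PMF.map_bind, PMF.bind_map]
    congr 1
    funext ρ
    rw [PMF.map_bind, Function.comp_apply, plaintexts, List.map_cons, PMF.seqList, List.map_map,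
      ← map_ofZModVec_encVec]
    simp only [PMF.map_comp, PMF.map_bind]
    simp only [← PMF.bind_pure_comp]
    rw [PMF.bind_comm]
    congr 1
    funext r'
    have := (key ρ r').1
    rw [zero_add] at this
    simp only [Function.comp_def]
    rw [← this]
    simp only [Function.comp_def, Val.list, PMF.bind_map]
    rfl
  · intro o ho
    simp only [execute, PMF.mem_support_bind_iff, PMF.mem_support_map_iff] at ho
    obtain ⟨ρ, -, r', -, o', ho', rfl⟩ := ho
    have hK : 0 < J.K := by
      rw [Params.K]; split_ifs
      · exact J.Kc_pos
      · exact J.Kw_pos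
    simp only [(key ρ r').2 o' ho' hK]
    rfl

end Instance

namespace KeyGen
variable (G : KeyGen) (n : ℕ) (J : Instance)

theorem inputs_eq : G.inputs n J = (G.factors n).bind fun M =>
    (G.base.out (.pair (.unary n) (.num M.N))).bind fun g =>
      ((M.publicKey g.toNat).nonces J.dim).map fun r =>
        ⟨M.publicKey g.toNat, J.server _ r, J.client (M.secretKey g.toNat)⟩ := rfl

theorem computes : G.Computes := by
  intro n J hJ o ho
  rw [real, PMF.mem_support_bind_iff] at ho
  obtain ⟨a, ha, ho⟩ := ho
  simp only [inputs_eq, PMF.mem_support_bind_iff, PMF.mem_support_map_iff] at ha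
  obtain ⟨M, hM, g, hg, r, -, rfl⟩ := ha
  have hord := G.base_order n M hM g hg
  exact (Instance.execute_spec (Factors.g_pow_N hord) (fun _ _ => Factors.dec_of_rep hord)
    (hJ M hM)).2 o ho

end KeyGen

/-! ### The simulator and the reduction as programs. -/

namespace PT

theorem randList {l w M : Val → Val} (hl : PTd l) (hw : PTd w) (hM : PTd M) :
    PT fun v => PMF.seqList ((l v).toList.map fun _ => Val.randMod (w v) (M v)) := by
  have hid : PTd fun v => v := PT.id
  exact (seqList (f := fun v => Val.randMod (w v.fst) (M v.fst))
    (randMod (hw.comp hid.fst) (hM.comp hid.fst)) hl).congr fun v => rfl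

theorem fork_map {f g : Val → PMF Val} (hf : PT f) (hg : PT g) {k : Val → Val} (hk : PTd k) :
    PT fun v => (f v).bind fun a => (g v).map fun b => k (.pair v (.pair a b)) :=
  (map (fork hf hg) hk).congr fun v => by simp [PMF.map_bind, PMF.map_comp, Function.comp_def]

end PT

namespace Val

/-- A list five times as long. -/
def fiveTimes (u : Val) : Val := append u (append u (append u (append u u)))

theorem length_fiveTimes (u : Val) : (fiveTimes u).toList.length = 5 * u.toList.length := by
  simp only [fiveTimes, toList_append, List.length_append]
  omega

theorem toList_unary (n : ℕ) : (unary n).toList = List.replicate n (num 0) := toList_list _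

theorem length_fiveTimes_unary (n : ℕ) : (fiveTimes (unary n)).toList.length = 5 * n := by
  rw [length_fiveTimes, toList_unary, List.length_replicate]

/-- The entry of a list at a given position. -/
def nth : ℕ → Val → Val
  | 0, v => v.fst
  | k + 1, v => nth k v.snd

end Val

theorem PTd.fiveTimes {f : Val → Val} (hf : PTd f) : PTd fun v => Val.fiveTimes (f v) :=
  hf.append (hf.append (hf.append (hf.append hf)))

theorem PTd.nth {f : Val → Val} (hf : PTd f) : ∀ k : ℕ, PTd fun v => Val.nth k (f v)
  | 0 => hf.fst
  | k + 1 => PTd.nth hf.snd k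

theorem PTd.ite {c f g : Val → Val} (hc : PTd c) (hf : PTd f) (hg : PTd g) :
    PTd fun v => if c v = .num 0 then g v else f v :=
  (PT.cond hc hf hg).congr fun v => by dsimp only; split_ifs <;> rfl

namespace Simulator
open Val

/-- The server's input. -/
def input (v : Val) : Val := v.snd.fst
-- Only the length `5 n` of this list is used.
def numBits (v : Val) : Val := fiveTimes v.fst
def modulus (v : Val) : Val := nth 4 (input v)
def modulusSq (v : Val) : Val := num ((modulus v).toNat * (modulus v).toNat)
def prevSolution (v : Val) : Val := nth 6 (input v)
def param (k : ℕ) (v : Val) : Val := nth k (nth 0 (input v))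
-- Only the length matters. Parameter `7` is the cold-start flag, parameter `1` is `m` in unary, and
-- the previous solution has one entry per optimization variable. In `rounds`, parameters `3` and
-- `4` are `Kc` and `Kw`.
def coins (v : Val) : Val := if param 7 v = num 0 then param 1 v else prevSolution v
def rounds (v : Val) : Val := if param 7 v = num 0 then param 4 v else param 3 v

/-- Random residues take the place of the server's random values and of the messages. -/
noncomputable def sim (v : Val) : PMF Val :=
  (PMF.seqList ((coins v).toList.map fun _ => randMod (numBits v) (modulus v))).bind fun ρ =>
    ((PMF.seqList ((rounds v).toList.map fun _ =>
        PMF.seqList ((prevSolution v).toList.map fun _ => randMod (numBits v) (modulusSq v)))).bind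
      fun s => (PMF.seqList ((param 0 v).toList.map fun _ =>
        randMod (numBits v) (modulusSq v))).map fun c => pair c s).map fun m =>
      pair (input v) (pair ρ m)

theorem ptd_input : PTd input := PTd.fst (PTd.snd PT.id)
theorem ptd_numBits : PTd numBits := (PTd.fst PT.id).fiveTimes
theorem ptd_modulus : PTd modulus := ptd_input.nth 4
theorem ptd_modulusSq : PTd modulusSq := ptd_modulus.mul ptd_modulus
theorem ptd_prevSolution : PTd prevSolution := ptd_input.nth 6
theorem ptd_param (k : ℕ) : PTd (param k) := (ptd_input.nth 0).nth k
theorem ptd_coins : PTd coins := (ptd_param 7).ite ptd_prevSolution (ptd_param 1)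
theorem ptd_rounds : PTd rounds := (ptd_param 7).ite (ptd_param 3) (ptd_param 4)

theorem pt_rows : PT fun v => PMF.seqList ((rounds v).toList.map fun _ =>
    PMF.seqList ((prevSolution v).toList.map fun _ => randMod (numBits v) (modulusSq v))) := by
  have hrow := PT.randList ptd_prevSolution ptd_numBits ptd_modulusSq
  exact PT.seqList (f := fun v => PMF.seqList ((prevSolution v.fst).toList.map fun _ =>
    randMod (numBits v.fst) (modulusSq v.fst))) (hrow.comp_det (PTd.fst PT.id)) ptd_rounds

theorem pt_sim : PT sim := by
  have hid : PTd fun v => v := PT.id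
  have h := PT.fork_map pt_rows (PT.randList (ptd_param 0) ptd_numBits ptd_modulusSq)
      (k := fun v => pair v.snd.snd v.snd.fst) (hid.snd.snd.pair hid.snd.fst)
  have h' := PT.fork_map (PT.randList ptd_coins ptd_numBits ptd_modulus) h
    (k := fun v => pair (input v.fst) v.snd) ((ptd_input.comp hid.fst).pair hid.snd)
  exact h'

end Simulator

namespace Reduction
open Val

/-! The input of the reduction has the form `((1ⁿ, (a, info), (N, c)), g)`. -/

def numBits (v : Val) : Val := fiveTimes v.fst.fst
-- Entries `0` to `3` are the server's plaintext data, `4` the tasks for the previous solution, `5`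
-- the number of coins in unary, and `6` the tasks for the messages.
def info (k : ℕ) (v : Val) : Val := nth k v.fst.snd.fst.snd
def modulus (v : Val) : Val := v.fst.snd.snd.fst
def challenge (v : Val) : Val := v.fst.snd.snd.snd
def modulusSq (v : Val) : Val := num ((modulus v).toNat * (modulus v).toNat)
-- The reduction makes the base agree with the canonical representative in the server's input.
def base (v : Val) : Val := num (rmod v.snd.toNat (modulusSq v).toNat)

/-- The random part of a ciphertext: a random residue, the challenge, or a random power. -/
noncomputable def mask (v t : Val) : PMF Val :=
  if t.fst = num 0 then randMod (numBits v) (modulusSq v)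
  else if num (t.fst.toNat - (num 1).toNat) = num 0 then PMF.pure (challenge v)
  else (randMod (numBits v) (modulus v)).map fun r =>
    powMod (numBits v) (modulusSq v) r (modulus v)

/-- The integer `p - q` modulo `N`, for a pair `(p, q)`. -/
def exponent (v t : Val) : Val :=
  -- Adding `q (N - 1)` stands for subtracting `q`, since subtraction of natural numbers truncates.
  num (rmod (t.snd.fst.toNat + t.snd.snd.toNat * ((modulus v).toNat - (num 1).toNat))
    (modulus v).toNat)

noncomputable def cipher (v t : Val) : PMF Val :=
  (mask v t).map fun y =>
    num (rmod ((powMod (numBits v) (modulusSq v) (base v) (exponent v t)).toNat * y.toNat)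
      (modulusSq v).toNat)

def serverInput (v U : Val) : Val :=
  pair (info 0 v) (pair (info 1 v) (pair (info 2 v) (pair (info 3 v) (pair (modulus v)
    (pair (base v) (pair U (num 0)))))))

noncomputable def viewOfBase (v : Val) : PMF Val :=
  (PMF.seqList ((info 4 v).toList.map (cipher v))).bind fun U =>
    ((PMF.seqList ((info 5 v).toList.map fun _ => randMod (numBits v) (modulus v))).bind fun ρ =>
      (PMF.seqList ((info 6 v).toList.map fun l => PMF.seqList (l.toList.map (cipher v)))).map
        fun m => pair ρ m).map fun x => pair (serverInput v U) x

noncomputable def view (A : PPT) (v : Val) : PMF Val :=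
  (A.out (pair v.fst v.snd.snd.fst)).bind fun g => viewOfBase (pair v g)

/-- Run a distinguisher `D` of views. -/
noncomputable def run (A D : PPT) (v : Val) : PMF Val :=
  (view A v).bind fun x => D.out (pair v.fst (pair v.snd.fst.fst x))

theorem ptd_numBits : PTd numBits := (PTd.fst (PTd.fst PT.id)).fiveTimes
theorem ptd_info (k : ℕ) : PTd (info k) := (PTd.snd (PTd.fst (PTd.snd (PTd.fst PT.id)))).nth k
theorem ptd_modulus : PTd modulus := PTd.fst (PTd.snd (PTd.snd (PTd.fst PT.id)))
theorem ptd_challenge : PTd challenge := PTd.snd (PTd.snd (PTd.snd (PTd.fst PT.id)))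
theorem ptd_modulusSq : PTd modulusSq := ptd_modulus.mul ptd_modulus
theorem ptd_base : PTd base := (PTd.snd PT.id).rmod ptd_modulusSq

theorem pt_mask : PT fun v => mask v.fst v.snd := by
  have hid : PTd fun v => v := PT.id
  have hpow : PT fun v => (randMod (numBits v) (modulus v)).map fun r =>
      powMod (numBits v) (modulusSq v) r (modulus v) :=
    PT.map (PT.randMod ptd_numBits ptd_modulus)
      (g := fun v => powMod (numBits v.fst) (modulusSq v.fst) v.snd (modulus v.fst))
      ((ptd_numBits.comp hid.fst).powMod (ptd_modulusSq.comp hid.fst) hid.snd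
        (ptd_modulus.comp hid.fst))
  have h1 : PT fun v => PMF.pure (challenge v.fst) := ptd_challenge.comp hid.fst
  have h2 := (PT.randMod ptd_numBits ptd_modulusSq).comp_det hid.fst
  have h3 := PT.cond (hid.snd.fst.sub (PTd.const (num 1))) (hpow.comp_det hid.fst) h1
  exact PT.cond hid.snd.fst h3 h2

theorem ptd_exponent : PTd fun v => exponent v.fst v.snd := by
  have hid : PTd fun v => v := PT.id
  have h1 := (ptd_modulus.comp hid.fst).sub (PTd.const (num 1))
  exact (hid.snd.snd.fst.add (hid.snd.snd.snd.mul h1)).rmod (ptd_modulus.comp hid.fst)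

theorem pt_cipher : PT fun v => cipher v.fst v.snd := by
  have hid : PTd fun v => v := PT.id
  have h1 := (ptd_numBits.comp hid.fst.fst).powMod (ptd_modulusSq.comp hid.fst.fst)
    (ptd_base.comp hid.fst.fst) (ptd_exponent.comp hid.fst)
  have h2 := (h1.mul hid.snd).rmod (ptd_modulusSq.comp hid.fst.fst)
  refine (PT.map pt_mask h2).congr fun v => ?_
  simp only [cipher, fst_pair, snd_pair, toNat_num]

theorem pt_row : PT fun v => PMF.seqList (v.snd.toList.map (cipher v.fst)) := by
  have hid : PTd fun v => v := PT.id
  refine (PT.seqList (f := fun v => cipher v.fst.fst v.snd) ?_ hid.snd).congr fun v => ?_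
  · refine (pt_cipher.comp_det (hid.fst.fst.pair hid.snd)).congr fun v => ?_
    simp only [fst_pair, snd_pair]
  · simp only [fst_pair, snd_pair]

theorem ptd_serverInput : PTd fun v => serverInput v.fst v.snd := by
  have hid : PTd fun v => v := PT.id
  have hi := fun k => (ptd_info k).comp hid.fst
  exact (hi 0).pair ((hi 1).pair ((hi 2).pair ((hi 3).pair ((ptd_modulus.comp hid.fst).pair
      ((ptd_base.comp hid.fst).pair (hid.snd.pair (PTd.const (num 0))))))))

theorem pt_viewOfBase : PT viewOfBase := by
  have hid : PTd fun v => v := PT.id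
  have hU := PT.seqList pt_cipher (ptd_info 4)
  have hm := PT.seqList pt_row (ptd_info 6)
  have h := PT.fork_map (PT.randList (ptd_info 5) ptd_numBits ptd_modulus) hm hid.snd
  have h' := PT.fork_map hU h (k := fun v => pair (serverInput v.fst v.snd.fst) v.snd.snd)
    ((ptd_serverInput.comp (hid.fst.pair hid.snd.fst)).pair hid.snd.snd)
  exact h'

theorem pt_run (A D : PPT) : PT (run A D) := by
  have hid : PTd fun v => v := PT.id
  have hview : PT (view A) :=
    PT.bind (A.pt_out.comp_det (hid.fst.pair hid.snd.snd.fst)) pt_viewOfBase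
  exact PT.bind hview (g := fun u => D.out (pair u.fst.fst (pair u.fst.snd.fst.fst u.snd)))
    (D.pt_out.comp_det (hid.fst.fst.pair (hid.fst.snd.fst.fst.pair hid.snd)))

end Reduction

/-! ### Hybrid views. -/

namespace PMF

theorem Dom.seqList_map {α : Type} {κ : ℝ≥0∞} (l : List α) {f g : α → PMF Val} (e : α → ℕ)
    (h : ∀ a ∈ l, Dom (κ ^ e a) (f a) (g a)) :
    Dom (κ ^ (l.map e).sum) (PMF.seqList (l.map f)) (PMF.seqList (l.map g)) := by
  induction l with
  | nil => simpa using Dom.refl _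
  | cons a l ih =>
    rw [List.map_cons, List.sum_cons, add_comm, pow_add]
    exact (ih fun b hb => h b (List.mem_cons_of_mem _ hb)).bind fun s _ =>
      (h a List.mem_cons_self).map _

theorem Dom.seqList_map_one {α : Type} {κ : ℝ≥0∞} (l : List α) {f g : α → PMF Val}
    (h : ∀ a ∈ l, Dom κ (f a) (g a)) :
    Dom (κ ^ l.length) (PMF.seqList (l.map f)) (PMF.seqList (l.map g)) := by
  have := Dom.seqList_map l (κ := κ) (f := f) (g := g) (fun _ => 1) (by simpa using h)
  simpa using this

end PMF

open PMF

namespace PublicKey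
variable (pk : PublicKey)

/-- A uniformly random unit modulo `N ^ 2`. -/
noncomputable def unitDist : PMF pk.Cipher :=
  (uniformOfFintype (ZMod (pk.N ^ 2))ˣ).map fun r : (ZMod (pk.N ^ 2))ˣ => (r : pk.Cipher)

/-- A uniformly random `N`-th residue modulo `N ^ 2`. -/
noncomputable def residueDist : PMF pk.Cipher :=
  (uniformOfFintype (ZMod (pk.N ^ 2))ˣ).map fun r : (ZMod (pk.N ^ 2))ˣ => (r : pk.Cipher) ^ pk.N

/-- Encryption of `a` with a mask distributed as `Y`. -/
noncomputable def maskDist (Y : PMF pk.Cipher) (a : ℤ) : PMF Val :=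
  Y.map fun y => .num (pk.g ^ (a : pk.Plain).val * y).val

/-- By `map_nonce_pow` the nonce modulo `N` may be exchanged for a unit modulo `N ^ 2`, which brings
encryption into the form of the DCR problem. -/
theorem encDist_eq (a : ℤ) : pk.encDist a = pk.maskDist pk.residueDist a := by
  rw [encDist, maskDist, residueDist, PMF.map_comp]
  exact map_nonce_pow pk.N fun z => Val.num (pk.g ^ (a : pk.Plain).val * z).val

theorem maskDist_bind {α : Type} (C : PMF α) (Y : α → PMF pk.Cipher) (a : ℤ) :
    pk.maskDist (C.bind Y) a = C.bind fun c => pk.maskDist (Y c) a := by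
  rw [maskDist, PMF.map_bind]; rfl

/-- Multiplication by the unit `g ^ a` permutes the units, so a uniform mask hides `a` completely.
-/
theorem maskDist_unitDist (hg : IsUnit pk.g) (a : ℤ) :
    pk.maskDist pk.unitDist a
      = (uniformOfFintype (ZMod (pk.N ^ 2))ˣ).map fun r : (ZMod (pk.N ^ 2))ˣ =>
        .num (r : pk.Cipher).val := by
  obtain ⟨u, hu⟩ := hg
  rw [maskDist, unitDist, PMF.map_comp]
  conv_rhs => rw [← map_uniformOfFintype_equiv (Equiv.mulLeft (u ^ (a : pk.Plain).val)),
    PMF.map_comp]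
  congr 1
  funext r
  simp [← hu]

/-- Real or random encryptions, as told by a flag. -/
noncomputable def flagDist (t : Bool × ℤ) : PMF Val :=
  pk.maskDist (if t.1 then pk.residueDist else pk.unitDist) t.2

noncomputable def rowDist (l : List (Bool × ℤ)) : PMF Val := seqList (l.map pk.flagDist)

/-- Real and random encryptions, arranged in a list of lists. -/
noncomputable def hybridDist (T : List (List (Bool × ℤ))) : PMF Val := seqList (T.map pk.rowDist)

/-- Like `hybridDist`, with one distinguished entry that is masked by `Y`. -/
noncomputable def holeDist (L₁ : List (List (Bool × ℤ))) (l₁ : List (Bool × ℤ)) (a : ℤ)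
    (l₂ : List (Bool × ℤ)) (L₂ : List (List (Bool × ℤ))) (Y : PMF pk.Cipher) : PMF Val :=
  seqList (L₁.map pk.rowDist ++
    seqList (l₁.map pk.flagDist ++ pk.maskDist Y a :: l₂.map pk.flagDist) :: L₂.map pk.rowDist)

variable {pk} {L₁ L₂ : List (List (Bool × ℤ))} {l₁ l₂ : List (Bool × ℤ)} {a : ℤ}

/-- The challenge may be drawn before everything else, as it is when handed to the reduction. -/
theorem holeDist_bind {α : Type} (C : PMF α) (Y : α → PMF pk.Cipher) :
    pk.holeDist L₁ l₁ a l₂ L₂ (C.bind Y) = C.bind fun c => pk.holeDist L₁ l₁ a l₂ L₂ (Y c) := by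
  simp only [holeDist, maskDist_bind, seqList_append_bind]

theorem holeDist_flag (b : Bool) :
    pk.holeDist L₁ l₁ a l₂ L₂ (if b then pk.residueDist else pk.unitDist)
      = pk.hybridDist (L₁ ++ (l₁ ++ (b, a) :: l₂) :: L₂) := by
  simp [holeDist, hybridDist, rowDist, flagDist]

end PublicKey

/-- The server's input as a datum. -/
def Instance.serverVal (J : Instance) (pk : PublicKey) (U : Val) : Val :=
  .list [J.toParams.encode, .ofIntMatrix J.H, .ofIntMatrix J.F, .ofInt J.η,
    .num pk.N, .num pk.g.val, U]

/-- The server's view for the modulus of `M`, with messages chosen from `msg`. -/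
noncomputable def KeyGen.game (G : KeyGen) (n : ℕ) (J : Instance) (M : Factors)
    (msg : PublicKey → PMF Val) : PMF Val :=
  (G.base.out (.pair (.unary n) (.num M.N))).bind fun g =>
    let pk := M.publicKey g.toNat
    (seqList ((List.ofFn J.Uw).map pk.encDist)).bind fun U =>
      ((seqList (List.replicate J.numCoins pk.nonceDist)).bind fun ρ =>
        (msg pk).map fun m => .pair ρ m).map fun x => .pair (J.serverVal pk U) x

namespace KeyGen
variable (G : KeyGen) (n : ℕ) (J : Instance)

/-- The real view is the hybrid in which all messages are genuine encryptions. Admissibility is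
needed because overflow could change the plaintexts. -/
theorem view_eq (hJ : G.Admissible n J) :
    G.view n J = (G.factors n).bind fun M => G.game n J M fun pk =>
      pk.hybridDist (J.plaintexts.map fun l => l.map fun a => (true, a)) := by
  rw [view, real, inputs_eq, PMF.map_bind, PMF.bind_bind]
  refine PMF.bind_congr_support _ fun M hM => ?_
  rw [PMF.bind_bind, game]
  refine PMF.bind_congr_support _ fun g hg => ?_
  have hord := G.base_order n M hM g hg
  simp only
  rw [← PublicKey.map_ofZModVec_encVec, PMF.bind_map, PMF.bind_map]
  congr 1
  funext r
  have := (Instance.execute_spec (r := r) (Factors.g_pow_N hord)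
    (fun _ _ => Factors.dec_of_rep hord) (hJ M hM)).1
  simp only [Function.comp_apply]
  rw [this, PMF.map_bind]
  simp only [PMF.map_comp]
  congr 1
  funext ρ
  have h : (M.publicKey g.toNat).hybridDist (J.plaintexts.map fun l => l.map fun a => (true, a))
      = seqList (J.plaintexts.map fun l => seqList (l.map (M.publicKey g.toNat).encDist)) := by
    simp only [PublicKey.hybridDist, PublicKey.rowDist, List.map_map, Function.comp_def,
      PublicKey.flagDist, if_true, funext (PublicKey.encDist_eq _)]
  rw [h]
  rfl

theorem game_bind {M : Factors} {α : Type} (C : PMF α) (msg : α → PublicKey → PMF Val) :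
    (G.game n J M fun pk => C.bind fun c => msg c pk) = C.bind fun c => G.game n J M (msg c) := by
  simp only [game]
  rw [PMF.bind_comm]
  congr 1; funext g
  rw [PMF.bind_comm]
  congr 1; funext U
  rw [← PMF.map_bind, PMF.bind_comm]
  simp only [PMF.map_bind]

end KeyGen

/-! ### The simulator against the hybrid with random messages. -/

namespace Simulator
open Val

theorem sim_eq {n : ℕ} {J : Instance} {pk : PublicKey} {r : Fin J.dim → pk.Nonce} {x : Val} :
    sim (pair (unary n) (pair (J.server pk r).encode x))
      = (seqList (List.replicate J.numCoins (randMod (fiveTimes (unary n)) (num pk.N)))).bind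
        fun ρ => (seqList (J.plaintexts.map fun l => seqList (l.map fun _ =>
          randMod (fiveTimes (unary n)) (num (pk.N ^ 2))))).map fun m =>
            pair (J.server pk r).encode (pair ρ m) := by
  have hin : input (pair (unary n) (pair (J.server pk r).encode x)) = (J.server pk r).encode := rfl
  have hmod : modulus (pair (unary n) (pair (J.server pk r).encode x)) = num pk.N := rfl
  have hsq : modulusSq (pair (unary n) (pair (J.server pk r).encode x)) = num (pk.N ^ 2) := by
    rw [modulusSq, hmod, sq]; rfl
  have hbits : numBits (pair (unary n) (pair (J.server pk r).encode x)) = fiveTimes (unary n) := rfl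
  have hprev : (prevSolution (pair (unary n) (pair (J.server pk r).encode x))).toList.length
      = J.dim := by
    rw [show prevSolution (pair (unary n) (pair (J.server pk r).encode x))
      = Val.list (List.ofFn fun i => num (pk.encVec J.Uw r i).val) from rfl, toList_list,
      List.length_ofFn]
  have hcold : param 7 (pair (unary n) (pair (J.server pk r).encode x)) = ofBool J.coldStart := rfl
  have hcoins : (coins (pair (unary n) (pair (J.server pk r).encode x))).toList.length
      = J.numCoins := by
    rw [coins, hcold, Params.numCoins]
    cases J.coldStart
    · rw [if_pos (show ofBool false = num 0 from rfl), if_neg (by simp),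
        show param 1 (pair (unary n) (pair (J.server pk r).encode x))
        = unary J.m from rfl, toList_unary, List.length_replicate]
    · rw [if_neg (by simp [ofBool]), if_pos rfl, hprev]
  have hrounds : (rounds (pair (unary n) (pair (J.server pk r).encode x))).toList.length
      = J.K := by
    rw [rounds, hcold, Params.K]
    cases J.coldStart
    · rw [if_pos (show ofBool false = num 0 from rfl), if_neg (by simp),
        show param 4 (pair (unary n) (pair (J.server pk r).encode x))
        = unary J.Kw from rfl, toList_unary, List.length_replicate]
    · rw [if_neg (by simp [ofBool]), if_pos rfl,
        show param 3 (pair (unary n) (pair (J.server pk r).encode x))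
        = unary J.Kc from rfl, toList_unary, List.length_replicate]
  have hn : (param 0 (pair (unary n) (pair (J.server pk r).encode x))).toList.length
      = J.n := by
    rw [show param 0 (pair (unary n) (pair (J.server pk r).encode x))
        = unary J.n from rfl, toList_unary, List.length_replicate]
  rw [sim, hin, hmod, hsq, hbits]
  simp only [List.map_const', hcoins, hrounds, hn, hprev, Instance.plaintexts, List.map_cons,
    List.map_map, Function.comp_def, List.length_ofFn, List.length_range', seqList]

end Simulator

namespace KeyGen
variable (G : KeyGen) {n : ℕ} {J : Instance}

/-- Number of messages of the server's view. -/
def _root_.Instance.numMessages (J : Instance) : ℕ := (J.plaintexts.map List.length).sum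

/-- Masking with uniform units makes all plaintexts disappear. What remains is one factor for each
sampled nonce and each sampled message. -/
theorem dom_simulated {S : PPT} (hS : ∀ v, S.out v = Simulator.sim v)
    (hsize : ∀ M ∈ (G.factors n).support, M.p.size = n ∧ M.q.size = n) :
    Dom (ENNReal.ofReal (1 - 5 / 2 ^ n) ^ (J.numCoins + J.numMessages))
      ((G.factors n).bind fun M => G.game n J M fun pk =>
        pk.hybridDist (J.plaintexts.map fun l => l.map fun a => (false, a)))
      (G.simulated n J S) := by
  rw [simulated, inputs_eq, PMF.bind_bind]
  refine Dom.bind_right _ fun M hM => ?_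
  obtain ⟨hp, hq⟩ := hsize M hM
  rw [game, PMF.bind_bind]
  refine Dom.bind_right _ fun g hg => ?_
  have hord := G.base_order n M hM g hg
  simp only [← PublicKey.map_ofZModVec_encVec, PMF.bind_map]
  refine Dom.bind_right _ fun r _ => ?_
  simp only [Function.comp_apply, hS, Simulator.sim_eq, PMF.map_bind, PMF.map_comp]
  have hw := Val.length_fiveTimes_unary n
  rw [pow_add]
  refine Dom.bind ?_ fun ρ _ => Dom.map ?_ _
  · have := Dom.seqList_map_one (List.replicate J.numCoins ()) fun _ _ =>
      Factors.dom_randMod_nonce hp hq hw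
    simp only [List.length_replicate, List.map_replicate] at this
    exact this
  · rw [PublicKey.hybridDist, List.map_map]
    refine Dom.seqList_map _ _ fun l _ => ?_
    simp only [Function.comp_apply, PublicKey.rowDist, List.map_map]
    refine Dom.seqList_map_one _ fun a _ => ?_
    simp only [Function.comp_apply, PublicKey.flagDist, Bool.false_eq_true, if_false]
    rw [PublicKey.maskDist_unitDist _ (Factors.isUnit_g hord)]
    exact Factors.dom_randMod_unit hp hq hw

end KeyGen

/-! ### The reduction against hybrids with one challenge. -/

namespace Reduction
open Val

/-- How the reduction is told to encrypt `a`. -/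
def task (mode : ℕ) (a : ℤ) : Val := pair (num mode) (pair (num a.toNat) (num (-a).toNat))

def flagTask (t : Bool × ℤ) : Val := task (if t.1 then 2 else 0) t.2

def rowTask (l : List (Bool × ℤ)) : Val := .list (l.map flagTask)

/-- The advice of the reduction. -/
def advice (J : Instance) (L₁ : List (List (Bool × ℤ))) (l₁ : List (Bool × ℤ)) (a : ℤ)
    (l₂ : List (Bool × ℤ)) (L₂ : List (List (Bool × ℤ))) : Val :=
  .list [J.toParams.encode, .ofIntMatrix J.H, .ofIntMatrix J.F, .ofInt J.η,
    .list ((List.ofFn J.Uw).map (task 2)), .unary J.numCoins,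
    .list (L₁.map rowTask ++
      .list (l₁.map flagTask ++ task 1 a :: l₂.map flagTask) :: L₂.map rowTask)]

/-- The input of the reduction, with a base. -/
def inputVal (n : ℕ) (A I : Val) (N c : ℕ) (g : Val) : Val :=
  pair (pair (unary n) (pair (pair A I) (pair (num N) (num c)))) g

variable {n : ℕ} {A I : Val} {pk : PublicKey} {c : ℕ} {g : Val}

theorem modulusSq_inputVal {N : ℕ} : modulusSq (inputVal n A I N c g) = num (N ^ 2) := by
  rw [sq]; rfl

theorem mask_zero {N : ℕ} {a : ℤ} : mask (inputVal n A I N c g) (task 0 a)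
    = randMod (fiveTimes (unary n)) (num (N ^ 2)) := by
  simp only [mask, task, fst_pair, modulusSq_inputVal, if_true]
  rfl

theorem mask_two {N : ℕ} {a : ℤ} : mask (inputVal n A I N c g) (task 2 a)
    = (randMod (fiveTimes (unary n)) (num N)).map fun r =>
      powMod (fiveTimes (unary n)) (num (N ^ 2)) r (num N) := by
  simp only [mask, task, fst_pair, modulusSq_inputVal]
  rw [if_neg (by simp), if_neg (by simp [toNat_num])]
  rfl

theorem base_inputVal (hg : pk.g = (g.toNat : pk.Cipher)) :
    base (inputVal n A I pk.N c g) = num pk.g.val := by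
  rw [base, modulusSq_inputVal, toNat_num, rmod_eq (pow_ne_zero 2 pk.pos.ne'), hg,
    ZMod.val_natCast]
  rfl

theorem exponent_inputVal (m : ℕ) (a : ℤ) :
    exponent (inputVal n A I pk.N c g) (task m a) = num (a : pk.Plain).val := by
  change num (rmod (a.toNat + (-a).toNat * (pk.N - 1)) pk.N) = _
  rw [rmod_eq pk.pos.ne', ← ZMod.val_natCast]
  congr 2
  have h : ((a.toNat : ℤ) : ZMod pk.N) - (((-a).toNat : ℤ) : ZMod pk.N) = a := by
    rw [← Int.cast_sub, Int.toNat_sub_toNat_neg]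
  have hN : 1 ≤ pk.N := pk.pos
  push_cast [hN]
  rw [← h]
  simp only [Int.cast_natCast, ZMod.natCast_self]
  ring

section
variable (hlt : pk.N < 2 ^ (fiveTimes (unary n)).toList.length)
  (hg : pk.g = (g.toNat : pk.Cipher))
include hlt hg

/-- Exponents are below `N`, hence have at most `5 n` bits, and the binary exponentiation is exact.
-/
theorem cipher_eq (m : ℕ) (a : ℤ) (y : ℕ) :
    num (rmod ((powMod (numBits (inputVal n A I pk.N c g))
      (modulusSq (inputVal n A I pk.N c g)) (base (inputVal n A I pk.N c g))
      (exponent (inputVal n A I pk.N c g) (task m a))).toNat * (num y).toNat)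
      (modulusSq (inputVal n A I pk.N c g)).toNat)
    = num (pk.g ^ (a : pk.Plain).val * (y : pk.Cipher)).val := by
  have hN2 : pk.N ^ 2 ≠ 0 := pow_ne_zero 2 pk.pos.ne'
  have hw : numBits (inputVal n A I pk.N c g) = fiveTimes (unary n) := rfl
  rw [modulusSq_inputVal, base_inputVal hg, exponent_inputVal, hw, powMod_eq hN2
    ((ZMod.val_lt _).trans hlt), toNat_num, toNat_num, toNat_num,
    rmod_eq hN2, ← ZMod.val_natCast]
  congr 2
  rw [Nat.cast_mul, ZMod.natCast_mod, Nat.cast_pow, ZMod.natCast_zmod_val]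

/-- A mask that is close to `Y` gives a ciphertext that is close to the one masked by `Y`. -/
theorem dom_cipher {κ : ℝ≥0∞} {m : ℕ} {a : ℤ} {Y : PMF pk.Cipher}
    (h : Dom κ (Y.map fun y => num y.val) (mask (inputVal n A I pk.N c g) (task m a))) :
    Dom κ (pk.maskDist Y a) (cipher (inputVal n A I pk.N c g) (task m a)) := by
  have := h.map fun y => num (rmod ((powMod (numBits (inputVal n A I pk.N c g))
      (modulusSq (inputVal n A I pk.N c g)) (base (inputVal n A I pk.N c g))
      (exponent (inputVal n A I pk.N c g) (task m a))).toNat * y.toNat)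
      (modulusSq (inputVal n A I pk.N c g)).toNat)
  rw [PMF.map_comp] at this
  simp only [Function.comp_def, cipher_eq hlt hg, ZMod.natCast_zmod_val] at this
  exact this

theorem dom_cipher_challenge (a : ℤ) :
    Dom 1 (pk.maskDist (PMF.pure (c : pk.Cipher)) a)
      (cipher (inputVal n A I pk.N (c : pk.Cipher).val g) (task 1 a)) := by
  refine dom_cipher hlt hg ?_
  rw [PMF.pure_map]
  exact Dom.refl _

variable {κ : ℝ≥0∞} (hnonce : Dom κ pk.nonceDist (randMod (fiveTimes (unary n)) (num pk.N)))
  (hunit : Dom κ (pk.unitDist.map fun y => num y.val)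
    (randMod (fiveTimes (unary n)) (num (pk.N ^ 2))))
include hnonce hunit

/-- A random mask is a sampled residue modulo `N ^ 2`. A real one is the `N`-th power of a sampled
residue modulo `N`, which `map_nonce_pow` compares with a uniform `N`-th residue. -/
theorem dom_cipher_flag (t : Bool × ℤ) :
    Dom κ (pk.flagDist t) (cipher (inputVal n A I pk.N c g) (flagTask t)) := by
  obtain ⟨b, a⟩ := t
  refine dom_cipher hlt hg ?_
  cases b
  · change Dom κ (pk.unitDist.map fun y => num y.val) (mask _ (task 0 a))
    rw [mask_zero]
    exact hunit
  · change Dom κ (pk.residueDist.map fun y => num y.val) (mask _ (task 2 a))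
    rw [mask_two]
    have h := hnonce.map fun r => powMod (fiveTimes (unary n)) (num (pk.N ^ 2)) r (num pk.N)
    rw [PublicKey.nonceDist, PMF.map_comp] at h
    simp only [Function.comp_def, powMod_eq (pow_ne_zero 2 pk.pos.ne') hlt, ← ZMod.val_natCast,
      Nat.cast_pow] at h
    have h1 := PublicKey.map_nonce_pow pk.N fun z => num z.val
    rw [PublicKey.residueDist, PMF.map_comp]
    exact h1 ▸ h

variable {J : Instance} {L₁ L₂ : List (List (Bool × ℤ))} {l₁ l₂ : List (Bool × ℤ)} {a : ℤ}

theorem dom_row (l : List (Bool × ℤ)) : Dom (κ ^ l.length) (pk.rowDist l)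
    (seqList ((rowTask l).toList.map (cipher (inputVal n A I pk.N c g)))) := by
  rw [rowTask, toList_list, List.map_map]
  exact Dom.seqList_map_one l fun t _ => dom_cipher_flag hlt hg hnonce hunit t

theorem dom_hole (hκ : κ ≤ 1) :
    Dom (κ ^ ((L₁ ++ (l₁ ++ (true, a) :: l₂) :: L₂).map List.length).sum)
      (pk.holeDist L₁ l₁ a l₂ L₂ (PMF.pure (c : pk.Cipher)))
      (seqList ((L₁.map rowTask ++
        .list (l₁.map flagTask ++ task 1 a :: l₂.map flagTask) :: L₂.map rowTask).map fun l =>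
          seqList (l.toList.map (cipher (inputVal n A I pk.N (c : pk.Cipher).val g))))) := by
  -- Each row is stored with its number of entries and its target distribution, so that
  -- `Dom.seqList_map` applies although the row with the hole has another shape.
  let T : List (Val × ℕ × PMF Val) := L₁.map (fun l => (rowTask l, l.length, pk.rowDist l)) ++
    (.list (l₁.map flagTask ++ task 1 a :: l₂.map flagTask), l₁.length + (l₂.length + 1),
      seqList (l₁.map pk.flagDist ++ pk.maskDist (PMF.pure (c : pk.Cipher)) a ::
        l₂.map pk.flagDist)) :: L₂.map (fun l => (rowTask l, l.length, pk.rowDist l))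
  have key := Dom.seqList_map (κ := κ) T (f := fun t => t.2.2) (g := fun t =>
    seqList (t.1.toList.map (cipher (inputVal n A I pk.N (c : pk.Cipher).val g))))
    (fun t => t.2.1) ?_
  · simpa [T, Function.comp_def, PublicKey.holeDist] using key
  · intro t ht
    simp only [T, List.mem_append, List.mem_cons, List.mem_map] at ht
    rcases ht with ⟨l, -, rfl⟩ | rfl | ⟨l, -, rfl⟩
    · exact dom_row hlt hg hnonce hunit l
    · rw [toList_list]
      let U : List (Val × PMF Val) := l₁.map (fun t => (flagTask t, pk.flagDist t)) ++
        (task 1 a, pk.maskDist (PMF.pure (c : pk.Cipher)) a) ::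
        l₂.map (fun t => (flagTask t, pk.flagDist t))
      have key := Dom.seqList_map_one (κ := κ) U (f := fun t => t.2) (g := fun t =>
        cipher (inputVal n A I pk.N (c : pk.Cipher).val g) t.1) ?_
      · simpa [U, Function.comp_def] using key
      · intro t ht
        simp only [U, List.mem_append, List.mem_cons, List.mem_map] at ht
        rcases ht with ⟨l, -, rfl⟩ | rfl | ⟨l, -, rfl⟩
        · exact dom_cipher_flag hlt hg hnonce hunit l
        -- The challenge itself is reproduced without loss; a factor `κ` is given away to keep the
        -- count uniform.
        · exact (dom_cipher_challenge hlt hg a).mono hκ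
        · exact dom_cipher_flag hlt hg hnonce hunit l
    · exact dom_row hlt hg hnonce hunit l

/-- One factor is spent on each component of the encrypted previous solution, each nonce and each
message. The flag `true` in `hT` serves only to count entries. -/
theorem dom_viewOfBase (hκ : κ ≤ 1)
    (hT : ((L₁ ++ (l₁ ++ (true, a) :: l₂) :: L₂).map List.length).sum = J.numMessages) :
    Dom (κ ^ (J.dim + J.numCoins + J.numMessages))
      ((seqList ((List.ofFn J.Uw).map pk.encDist)).bind fun U =>
        ((seqList (List.replicate J.numCoins pk.nonceDist)).bind fun ρ =>
          (pk.holeDist L₁ l₁ a l₂ L₂ (PMF.pure (c : pk.Cipher))).map fun m => pair ρ m).map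
            fun x => pair (J.serverVal pk U) x)
      (viewOfBase (inputVal n A (advice J L₁ l₁ a l₂ L₂) pk.N (c : pk.Cipher).val g)) := by
  set I := advice J L₁ l₁ a l₂ L₂ with hI
  set v := inputVal n A I pk.N (c : pk.Cipher).val g with hv
  have h4 : (info 4 v).toList = (List.ofFn J.Uw).map (task 2) := toList_list _
  have h5 : (info 5 v).toList = List.replicate J.numCoins (num 0) := toList_unary _
  have h6 : (info 6 v).toList = (L₁.map rowTask ++
        .list (l₁.map flagTask ++ task 1 a :: l₂.map flagTask) :: L₂.map rowTask) := toList_list _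
  have hs : ∀ U, serverInput v U = J.serverVal pk U := fun U => by
    rw [serverInput, hv, base_inputVal hg]; rfl
  rw [viewOfBase, h4, h5, h6, add_assoc, pow_add, List.map_map]
  refine Dom.bind ?_ fun U _ => ?_
  · have := Dom.seqList_map_one (κ := κ) (List.ofFn J.Uw) (f := pk.encDist)
      (g := cipher v ∘ task 2) fun b _ => by
        rw [PublicKey.encDist_eq]
        exact dom_cipher_flag hlt hg hnonce hunit (true, b)
    rwa [List.length_ofFn] at this
  · rw [hs U, pow_add]
    refine Dom.map (Dom.bind ?_ fun ρ _ => Dom.map ?_ _) _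
    · have := Dom.seqList_map_one (List.replicate J.numCoins ()) fun _ _ => hnonce
      simp only [List.length_replicate, List.map_replicate] at this
      rw [List.map_replicate]
      exact this
    · rw [← hT]
      exact dom_hole hlt hg hnonce hunit hκ

end

variable {G : KeyGen} {J : Instance} {L₁ L₂ : List (List (Bool × ℤ))} {l₁ l₂ : List (Bool × ℤ)}
  {a : ℤ}

theorem dom_view {M : Factors} (hp : M.p.size = n) (hq : M.q.size = n)
    (hT : ((L₁ ++ (l₁ ++ (true, a) :: l₂) :: L₂).map List.length).sum = J.numMessages)
    (hc : c < M.N ^ 2) :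
    Dom (ENNReal.ofReal (1 - 5 / 2 ^ n) ^ (J.dim + J.numCoins + J.numMessages))
      (G.game n J M fun pk => pk.holeDist L₁ l₁ a l₂ L₂ (PMF.pure (c : pk.Cipher)))
      (view G.base (pair (unary n) (pair (pair A (advice J L₁ l₁ a l₂ L₂))
        (pair (num M.N) (num c))))) := by
  refine Dom.bind_right _ fun g _ => ?_
  have hw := length_fiveTimes_unary n
  have hlt : M.N < 2 ^ (fiveTimes (unary n)).toList.length := by
    rw [hw]
    exact (Factors.N_lt hp hq).trans_le (Nat.pow_le_pow_right (by norm_num) (by omega))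
  have hκ : ENNReal.ofReal (1 - 5 / 2 ^ n) ≤ 1 := by
    rw [ENNReal.ofReal_le_one, sub_le_self_iff]; positivity
  have hunit : Dom (ENNReal.ofReal (1 - 5 / 2 ^ n))
      ((M.publicKey g.toNat).unitDist.map fun y => num y.val)
      (randMod (fiveTimes (unary n)) (num (M.N ^ 2))) := by
    rw [PublicKey.unitDist, PMF.map_comp]
    exact Factors.dom_randMod_unit hp hq hw
  have := dom_viewOfBase (A := A) (c := c) (pk := M.publicKey g.toNat) (J := J) hlt rfl
    (Factors.dom_randMod_nonce hp hq hw) hunit hκ hT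
  rw [ZMod.val_natCast_of_lt (show c < (M.publicKey g.toNat).N ^ 2 from hc)] at this
  exact this

end Reduction

/-! ### The hybrid argument. -/

theorem acceptProb_sub_le {κ : ℝ} {D : PPT} {n : ℕ} {a : Val} {X Y : PMF Val} {k : ℕ} (hκ : 0 ≤ κ)
    (h : Dom (ENNReal.ofReal κ ^ k) X Y) :
    |acceptProb D n a X - acceptProb D n a Y| ≤ 1 - κ ^ k := by
  rw [← ENNReal.ofReal_pow hκ] at h
  exact Dom.abs_sub_le (pow_nonneg hκ k) (h.bind_left _) _

/-- The distinguisher's own advice travels as the first half of the advice of the reduction. -/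
theorem acceptProb_run {A D D' : PPT} (hD' : ∀ v, D'.out v = Reduction.run A D v) (n : ℕ)
    (a I : Val) (X : PMF Val) : acceptProb D' n (.pair a I) X
      = acceptProb D n a (X.bind fun s =>
          Reduction.view A (.pair (.unary n) (.pair (.pair a I) s))) := by
  rw [acceptProb, acceptProb, PMF.bind_bind]
  simp only [hD', Reduction.run, Val.fst_pair, Val.snd_pair]

/-- A challenge of the residuosity problem: an `N`-th residue, or a unit, modulo `N ^ 2`. -/
noncomputable def challengeDist (N : ℕ) [NeZero (N ^ 2)] (b : Bool) : PMF ℕ :=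
  (uniformOfFintype (ZMod (N ^ 2))ˣ).map fun r : (ZMod (N ^ 2))ˣ =>
    (if b then (r : ZMod (N ^ 2)) ^ N else (r : ZMod (N ^ 2))).val

theorem PublicKey.hybridDist_eq_bind {pk : PublicKey} {L₁ L₂ : List (List (Bool × ℤ))}
    {l₁ l₂ : List (Bool × ℤ)} {a : ℤ} (b : Bool) :
    pk.hybridDist (L₁ ++ (l₁ ++ (b, a) :: l₂) :: L₂) = (challengeDist pk.N b).bind fun c =>
      pk.holeDist L₁ l₁ a l₂ L₂ (PMF.pure (c : pk.Cipher)) := by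
  rw [← holeDist_bind, ← holeDist_flag]
  congr 1
  rw [challengeDist, PMF.bind_map]
  simp only [Function.comp_def, ZMod.natCast_zmod_val]
  cases b <;> rfl

namespace KeyGen
variable {G : KeyGen} {n : ℕ} {J : Instance}

theorem game_congr {M : Factors} {msg msg' : PublicKey → PMF Val}
    (h : ∀ g : ℕ, msg (M.publicKey g) = msg' (M.publicKey g)) :
    G.game n J M msg = G.game n J M msg' := by
  simp only [game, h]

/-- The type of challenge becomes the flag at the hole: residues give the hybrid with a real
encryption there, units the one with a random message. -/
theorem dom_sample (hsize : ∀ M ∈ (G.factors n).support, M.p.size = n ∧ M.q.size = n)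
    {L₁ L₂ : List (List (Bool × ℤ))} {l₁ l₂ : List (Bool × ℤ)} {a : ℤ} {A : Val}
    (hT : ((L₁ ++ (l₁ ++ (true, a) :: l₂) :: L₂).map List.length).sum = J.numMessages) (b : Bool) :
    Dom (ENNReal.ofReal (1 - 5 / 2 ^ n) ^ (J.dim + J.numCoins + J.numMessages))
      ((G.factors n).bind fun M => G.game n J M fun pk =>
        pk.hybridDist (L₁ ++ (l₁ ++ (b, a) :: l₂) :: L₂))
      ((if b then residueSample G.factors n else unitSample G.factors n).bind fun s =>
        Reduction.view G.base (.pair (.unary n)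
          (.pair (.pair A (Reduction.advice J L₁ l₁ a l₂ L₂)) s))) := by
  have hC : (if b then residueSample G.factors n else unitSample G.factors n)
      = (G.factors n).bind fun M => (challengeDist M.N b).map fun c =>
        .pair (.num M.N) (.num c) := by
    cases b
    · have : unitSample G.factors n = (G.factors n).bind fun M =>
          ((uniformOfFintype (ZMod (M.N ^ 2))ˣ).map Units.val).map fun r =>
            .pair (.num M.N) (.num r.val) := rfl
      simp only [challengeDist, this, PMF.map_comp, Function.comp_def, Bool.false_eq_true, if_false]
    · simp only [challengeDist, residueSample, PMF.map_comp, Function.comp_def, if_true,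
        Units.val_pow_eq_pow_val]
  rw [hC, PMF.bind_bind]
  refine Dom.bind_right _ fun M hM => ?_
  obtain ⟨hp, hq⟩ := hsize M hM
  have hgame : (G.game n J M fun pk => pk.hybridDist (L₁ ++ (l₁ ++ (b, a) :: l₂) :: L₂))
      = (challengeDist M.N b).bind fun c => G.game n J M fun pk =>
        pk.holeDist L₁ l₁ a l₂ L₂ (PMF.pure (c : pk.Cipher)) := by
    rw [← game_bind]
    exact game_congr fun g => PublicKey.hybridDist_eq_bind b
  rw [hgame, PMF.bind_map]
  refine Dom.bind_right _ fun c hc => Reduction.dom_view hp hq hT ?_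
  rw [challengeDist, PMF.mem_support_map_iff] at hc
  obtain ⟨r, -, rfl⟩ := hc
  exact ZMod.val_lt _

end KeyGen

section Telescope
variable {α : Type} {f : List (List (Bool × α)) → ℝ} {ε : ℝ} {P : List (List α)}

/-- Replacing the entries of a list of lists one by one. -/
theorem abs_sub_le_of_steps
    (h : ∀ L₁ l₁ a l₂ L₂,
      (L₁ ++ (l₁ ++ (true, a) :: l₂) :: L₂).map (List.map Prod.snd) = P →
      |f (L₁ ++ (l₁ ++ (true, a) :: l₂) :: L₂) - f (L₁ ++ (l₁ ++ (false, a) :: l₂) :: L₂)| ≤ ε) :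
    |f (P.map fun l => l.map fun a => (true, a)) - f (P.map fun l => l.map fun a => (false, a))|
      ≤ (P.map List.length).sum * ε := by
  have row : ∀ (L₁ L₂ : List (List (Bool × α))) (l : List α) (l₁ : List (Bool × α)),
      L₁.map (List.map Prod.snd) ++ (l₁.map Prod.snd ++ l) :: L₂.map (List.map Prod.snd) = P →
      |f (L₁ ++ (l₁ ++ l.map fun a => (true, a)) :: L₂)
        - f (L₁ ++ (l₁ ++ l.map fun a => (false, a)) :: L₂)| ≤ l.length * ε := by
    intro L₁ L₂ l
    induction l with
    | nil => intro l₁ _; simp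
    | cons a l ih =>
      intro l₁ hP
      have h1 := h L₁ l₁ a (l.map fun a => (true, a)) L₂ (by simpa [Function.comp_def] using hP)
      -- The entry just replaced joins the prefix, while those further right are still marked
      -- `true`.
      have h2 := ih (l₁ ++ [(false, a)]) (by simpa using hP)
      simp only [List.append_assoc, List.singleton_append] at h2
      simp only [List.map_cons, List.length_cons]
      rw [Nat.cast_add, Nat.cast_one]
      have := abs_sub_le _ _ _ |>.trans (add_le_add h1 h2)
      linarith
  have rows : ∀ (L : List (List α)) (L₁ : List (List (Bool × α))),
      L₁.map (List.map Prod.snd) ++ L = P →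
      |f (L₁ ++ L.map fun l => l.map fun a => (true, a))
        - f (L₁ ++ L.map fun l => l.map fun a => (false, a))| ≤ (L.map List.length).sum * ε := by
    intro L
    induction L with
    | nil => intro L₁ _; simp
    | cons l L ih =>
      intro L₁ hP
      have h1 := row L₁ (L.map fun l => l.map fun a => (true, a)) l []
        (by simpa [Function.comp_def] using hP)
      have h2 := ih (L₁ ++ [l.map fun a => (false, a)])
        (by simpa [Function.comp_def] using hP)
      simp only [List.append_assoc, List.singleton_append, List.nil_append] at h1 h2
      simp only [List.map_cons, List.sum_cons]
      rw [Nat.cast_add]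
      have := abs_sub_le _ _ _ |>.trans (add_le_add h1 h2)
      linarith
  simpa using rows P [] (by simp)

end Telescope

namespace KeyGen
variable {G : KeyGen} {n : ℕ} {J : Instance}

/-- The distance of the real and the simulated view is bounded by the advantage of the reduction. -/
theorem abs_acceptProb_sub_le
    (hsize : ∀ M ∈ (G.factors n).support, M.p.size = n ∧ M.q.size = n) (hn : 5 ≤ 2 ^ n)
    (hJ : G.Admissible n J)
    {S D D' : PPT} (hS : ∀ v, S.out v = Simulator.sim v)
    (hD' : ∀ v, D'.out v = Reduction.run G.base D v) {A : Val} {ε : ℝ}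
    (h : ∀ L₁ l₁ a l₂ L₂,
      (L₁ ++ (l₁ ++ (true, a) :: l₂) :: L₂).map (List.map Prod.snd) = J.plaintexts →
      |acceptProb D' n (.pair A (Reduction.advice J L₁ l₁ a l₂ L₂)) (residueSample G.factors n)
        - acceptProb D' n (.pair A (Reduction.advice J L₁ l₁ a l₂ L₂)) (unitSample G.factors n)|
          ≤ ε) :
    |acceptProb D n A (G.simulated n J S) - acceptProb D n A (G.view n J)|
      ≤ (J.dim + J.numCoins + J.numMessages : ℕ) * (5 / 2 ^ n) + J.numMessages *
        (ε + 2 * ((J.dim + J.numCoins + J.numMessages : ℕ) * (5 / 2 ^ n))) := by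
  set B := J.dim + J.numCoins + J.numMessages with hB
  have hpos : (0 : ℝ) < 2 ^ n := by positivity
  have hx : (5 : ℝ) / 2 ^ n ≤ 1 := by rw [div_le_one hpos]; exact_mod_cast hn
  have hx0 : (0 : ℝ) ≤ 5 / 2 ^ n := by positivity
  have hκ : (0 : ℝ) ≤ 1 - 5 / 2 ^ n := by linarith
  -- Bernoulli's inequality turns the loss over `k` samples into a linear bound.
  have bern : ∀ k : ℕ, k ≤ B → 1 - (1 - 5 / 2 ^ n : ℝ) ^ k ≤ B * (5 / 2 ^ n) := fun k hk => by
    have h1 := one_add_mul_le_pow (show (-2 : ℝ) ≤ -(5 / 2 ^ n) by linarith) k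
    rw [← sub_eq_add_neg] at h1
    have h2 : (k : ℝ) * (5 / 2 ^ n) ≤ B * (5 / 2 ^ n) :=
      mul_le_mul_of_nonneg_right (by exact_mod_cast hk) hx0
    linarith
  let f : List (List (Bool × ℤ)) → ℝ := fun T =>
    acceptProb D n A ((G.factors n).bind fun M => G.game n J M fun pk => pk.hybridDist T)
  have h1 := (acceptProb_sub_le (D := D) (n := n) (a := A) hκ
    (dom_simulated G hS hsize (J := J))).trans
    (bern _ (by omega))
  have h2 := abs_sub_le_of_steps (f := f) (P := J.plaintexts)
    (ε := ε + 2 * (B * (5 / 2 ^ n))) fun L₁ l₁ a l₂ L₂ hP => by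
      have hT : ((L₁ ++ (l₁ ++ (true, a) :: l₂) :: L₂).map List.length).sum = J.numMessages := by
        rw [Instance.numMessages, ← hP, List.map_map]
        congr 2
        funext l
        simp
      -- Both hybrids are close to the reduction on the corresponding challenge, which costs the
      -- sampling error twice; between the two challenges the distance is at most `ε`.
      have e1 := (acceptProb_sub_le (D := D) (n := n) (a := A) hκ
        (dom_sample hsize (A := A) hT true)).trans (bern _ le_rfl)
      have e2 := (acceptProb_sub_le (D := D) (n := n) (a := A) hκ
        (dom_sample hsize (A := A) hT false)).trans (bern _ le_rfl)
      have e3 := h L₁ l₁ a l₂ L₂ hP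
      rw [acceptProb_run hD', acceptProb_run hD'] at e3
      simp only [if_true, Bool.false_eq_true, if_false] at e1 e2
      rw [abs_le] at e1 e2 e3 ⊢
      simp only [f]
      constructor <;> linarith [e1.1, e1.2, e2.1, e2.2, e3.1, e3.2]
  rw [view_eq G n J hJ]
  simp only [f] at h2
  rw [← Instance.numMessages] at h2
  rw [abs_le] at h1 h2 ⊢
  constructor <;> linarith [h1.1, h1.2, h2.1, h2.2]

end KeyGen

/-! ### Polynomial bounds for the number of messages and the length of the advice. -/

namespace Val

theorem size_list (l : List Val) : (list l).size = (l.map fun v => v.size + 1).sum + 1 := by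
  induction l with
  | nil => simp [list, size]
  | cons a l ih => simp only [list, size, ih, List.map_cons, List.sum_cons]; omega

theorem size_lt_size_list {v : Val} {l : List Val} (h : v ∈ l) : v.size < (list l).size := by
  have := List.single_le_sum (l := l.map fun v => v.size + 1) (by simp) (v.size + 1)
    (List.mem_map_of_mem h)
  rw [size_list]
  omega

theorem length_lt_size_list (l : List Val) : l.length < (list l).size := by
  have := length_toList_lt (list l)
  rwa [toList_list] at this

theorem size_list_le {l : List Val} {b : ℕ} (h : ∀ v ∈ l, v.size ≤ b) :
    (list l).size ≤ l.length * (b + 1) + 1 := by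
  have := List.sum_le_card_nsmul (l.map fun v => v.size + 1) (b + 1) (by simpa using h)
  rw [size_list]
  simpa using this

theorem size_unary (n : ℕ) : (unary n).size = 2 * n + 1 := by
  rw [unary, size_list]
  simp [size]; omega

theorem natAbs_size_lt_ofIntVec {k : ℕ} (f : Fin k → ℤ) (i : Fin k) :
    (f i).natAbs.size < (ofIntVec f).size := by
  have h : (ofInt (f i)).size < (ofIntVec f).size :=
    size_lt_size_list (List.mem_ofFn.2 ⟨i, rfl⟩)
  have : (f i).natAbs.size < (ofInt (f i)).size := by simp only [ofInt, size]; omega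
  omega

end Val

namespace Instance
variable (J : Instance)

theorem size_lt_encode {v : Val} (h : v ∈ [J.toParams.encode, .ofIntMatrix J.H, .ofIntMatrix J.F,
    .ofInt J.η, .ofIntVec J.x, .ofIntVec J.lu, .ofIntVec J.hu, .ofIntVec J.Uw]) :
    v.size < J.encode.size := Val.size_lt_size_list h

theorem n_lt_size : J.n < J.encode.size :=
  (((List.length_ofFn (f := fun i => Val.ofInt (J.x i))).symm.trans_lt
    (Val.length_lt_size_list _))).trans (J.size_lt_encode (v := .ofIntVec J.x) (by simp))

theorem dim_lt_size : J.dim < J.encode.size :=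
  (((List.length_ofFn (f := fun i => Val.ofInt (J.lu i))).symm.trans_lt
    (Val.length_lt_size_list _))).trans (J.size_lt_encode (v := .ofIntVec J.lu) (by simp))

/-- This is where the unary encoding of the iteration counts is needed. -/
theorem K_lt_size : J.K < J.encode.size := by
  have h := J.size_lt_encode (v := J.toParams.encode) (by simp)
  have hc : (Val.unary J.Kc).size < J.toParams.encode.size := Val.size_lt_size_list (by simp)
  have hw : (Val.unary J.Kw).size < J.toParams.encode.size := Val.size_lt_size_list (by simp)
  rw [Val.size_unary] at hc hw
  rw [Params.K]
  split_ifs <;> omega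

theorem numCoins_lt_size : J.numCoins < J.encode.size := by
  have := J.dim_lt_size
  have := J.m_le_dim
  rw [Params.numCoins]
  split_ifs <;> omega

/-- Projection keeps the iterates within the bounds of the box, so their lengths do not grow with
`k`. The unprojected `U_0` is excluded, and it is never sent. -/
theorem size_iterate_lt {k : ℕ} (hk : 1 ≤ k) (i : Fin J.dim) :
    ((J.iterate k).1 i).natAbs.size < J.encode.size := by
  obtain ⟨k, rfl⟩ : ∃ j, k = j + 1 := ⟨k - 1, by omega⟩
  have h1 := (Val.natAbs_size_lt_ofIntVec J.lu i).trans
    (J.size_lt_encode (v := .ofIntVec J.lu) (by simp))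
  have h2 := (Val.natAbs_size_lt_ofIntVec J.hu i).trans
    (J.size_lt_encode (v := .ofIntVec J.hu) (by simp))
  have h3 : ((J.iterate (k + 1)).1 i).natAbs ≤ max (J.lu i).natAbs (J.hu i).natAbs := by
    change (max (-J.lu i) (min (J.hu i) _)).natAbs ≤ _
    omega
  rcases le_max_iff.1 h3 with h | h
  · exact (Nat.size_le_size h).trans_lt h1
  · exact (Nat.size_le_size h).trans_lt h2

theorem plaintexts_bound : ∀ l ∈ J.plaintexts, l.length ≤ J.encode.size ∧
    ∀ a ∈ l, a.natAbs.size ≤ J.encode.size := by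
  intro l hl
  rw [plaintexts, List.mem_cons, List.mem_map] at hl
  rcases hl with rfl | ⟨k, hk, rfl⟩
  · refine ⟨by rw [List.length_ofFn]; exact J.n_lt_size.le, fun a ha => ?_⟩
    obtain ⟨i, rfl⟩ := List.mem_ofFn.1 ha
    exact ((Val.natAbs_size_lt_ofIntVec J.x i).trans
      (J.size_lt_encode (v := .ofIntVec J.x) (by simp))).le
  · refine ⟨by rw [List.length_ofFn]; exact J.dim_lt_size.le, fun a ha => ?_⟩
    obtain ⟨i, rfl⟩ := List.mem_ofFn.1 ha
    rw [List.mem_range'_1] at hk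
    exact (J.size_iterate_lt hk.1 i).le

theorem length_plaintexts : J.plaintexts.length ≤ J.encode.size := by
  have := J.K_lt_size
  simp only [plaintexts, List.length_cons, List.length_map, List.length_range']
  omega

theorem numMessages_le : J.numMessages ≤ J.encode.size * J.encode.size := by
  have := List.sum_le_card_nsmul (J.plaintexts.map List.length) J.encode.size (by
    intro x hx
    obtain ⟨l, hl, rfl⟩ := List.mem_map.1 hx
    exact (J.plaintexts_bound l hl).1)
  rw [List.length_map, smul_eq_mul] at this
  exact this.trans (Nat.mul_le_mul_right _ J.length_plaintexts)

end Instance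

namespace Reduction

theorem size_task_le {m s : ℕ} {a : ℤ} (hm : m ≤ 2) (ha : a.natAbs.size ≤ s) :
    (task m a).size ≤ 2 * s + 7 := by
  have h1 : m.size ≤ 2 := by interval_cases m <;> decide
  have h2 := Nat.size_le_size (show a.toNat ≤ a.natAbs by omega)
  have h3 := Nat.size_le_size (show (-a).toNat ≤ a.natAbs by omega)
  simp only [task, Val.size]
  omega

/-- Bounds the length of the advice in terms of the length of the data. -/
noncomputable def adviceBound : Polynomial ℕ :=
  4 * .X + (.X * (2 * .X + 8) + 1) + (2 * .X + 1) + (.X * (.X * (2 * .X + 8) + 2) + 1) + 8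

theorem size_advice_le {J : Instance} {L₁ L₂ : List (List (Bool × ℤ))} {l₁ l₂ : List (Bool × ℤ)}
    {a : ℤ} (h : (L₁ ++ (l₁ ++ (true, a) :: l₂) :: L₂).map (List.map Prod.snd) = J.plaintexts) :
    (advice J L₁ l₁ a l₂ L₂).size ≤ adviceBound.eval J.encode.size := by
  set s := J.encode.size with hs
  have hflag : ∀ t : Bool × ℤ, t.2.natAbs.size ≤ s → (flagTask t).size ≤ 2 * s + 7 := fun t ht =>
    size_task_le (by split_ifs <;> omega) ht
  have hlist : ∀ U : List Val, U.length ≤ s → (∀ u ∈ U, u.size ≤ 2 * s + 7) →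
      (Val.list U).size ≤ s * (2 * s + 8) + 1 := fun U h1 h2 =>
    (Val.size_list_le h2).trans (Nat.add_le_add_right (Nat.mul_le_mul_right _ h1) 1)
  have hmem : ∀ l ∈ L₁ ++ (l₁ ++ (true, a) :: l₂) :: L₂,
      l.length ≤ s ∧ ∀ t ∈ l, t.2.natAbs.size ≤ s := fun l hl => by
    have := J.plaintexts_bound (l.map Prod.snd) (h ▸ List.mem_map_of_mem hl)
    rw [List.length_map] at this
    exact ⟨this.1, fun t ht => this.2 _ (List.mem_map_of_mem ht)⟩
  have hrow : ∀ l ∈ L₁ ++ (l₁ ++ (true, a) :: l₂) :: L₂, (rowTask l).size ≤ s * (2 * s + 8) + 1 :=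
    fun l hl => by
    refine hlist _ (by rw [List.length_map]; exact (hmem l hl).1) fun u hu => ?_
    obtain ⟨t, ht, rfl⟩ := List.mem_map.1 hu
    exact hflag t ((hmem l hl).2 t ht)
  have hhole : (Val.list (l₁.map flagTask ++ task 1 a :: l₂.map flagTask)).size
      ≤ s * (2 * s + 8) + 1 := by
    obtain ⟨h1, h2⟩ := hmem (l₁ ++ (true, a) :: l₂) (by simp)
    refine hlist _ (by simpa using h1) fun u hu => ?_
    simp only [List.mem_append, List.mem_cons, List.mem_map] at hu
    rcases hu with ⟨t, ht, rfl⟩ | rfl | ⟨t, ht, rfl⟩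
    · exact hflag t (h2 t (by simp [ht]))
    · exact size_task_le (by omega) (h2 (true, a) (by simp))
    · exact hflag t (h2 t (by simp [ht]))
  have htasks : (Val.list (L₁.map rowTask ++
      .list (l₁.map flagTask ++ task 1 a :: l₂.map flagTask) :: L₂.map rowTask)).size
      ≤ s * (s * (2 * s + 8) + 2) + 1 := by
    refine (Val.size_list_le (b := s * (2 * s + 8) + 1) fun u hu => ?_).trans
      (Nat.add_le_add_right (Nat.mul_le_mul_right _ ?_) 1)
    · simp only [List.mem_append, List.mem_cons, List.mem_map] at hu
      rcases hu with ⟨l, hl, rfl⟩ | rfl | ⟨l, hl, rfl⟩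
      · exact hrow l (by simp [hl])
      · exact hhole
      · exact hrow l (by simp [hl])
    · have := J.length_plaintexts
      rw [← h] at this
      simpa using this
  have hUw : (Val.list ((List.ofFn J.Uw).map (task 2))).size ≤ s * (2 * s + 8) + 1 := by
    refine hlist _ (by rw [List.length_map, List.length_ofFn]; exact J.dim_lt_size.le)
      fun u hu => ?_
    obtain ⟨b, hb, rfl⟩ := List.mem_map.1 hu
    obtain ⟨i, rfl⟩ := List.mem_ofFn.1 hb
    exact size_task_le le_rfl ((Val.natAbs_size_lt_ofIntVec J.Uw i).trans
      (J.size_lt_encode (v := .ofIntVec J.Uw) (by simp))).le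
  have h1 := J.size_lt_encode (v := J.toParams.encode) (by simp)
  have h2 := J.size_lt_encode (v := .ofIntMatrix J.H) (by simp)
  have h3 := J.size_lt_encode (v := .ofIntMatrix J.F) (by simp)
  have h4 := J.size_lt_encode (v := .ofInt J.η) (by simp)
  have h5 := J.numCoins_lt_size
  simp only [advice, Val.size_list (_ :: _), List.map_cons, List.map_nil, List.sum_cons,
    List.sum_nil, Val.size_unary]
  simp only [adviceBound, Polynomial.eval_add, Polynomial.eval_mul, Polynomial.eval_X,
    Polynomial.eval_one, Polynomial.eval_ofNat]
  omega

end Reduction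

/-! ### Choice of the advice, and the final estimate. -/

theorem Polynomial.eventually_eval_le_two_pow (P : Polynomial ℝ) :
    ∀ᶠ n : ℕ in atTop, P.eval (n : ℝ) ≤ 2 ^ n := by
  have h : Tendsto (fun n : ℕ => P.eval (n : ℝ) / 2 ^ n) atTop (nhds 0) := by
    induction P using Polynomial.induction_on' with
    | add p q hp hq => simpa [add_div] using hp.add hq
    | monomial k a =>
      simpa [mul_div_assoc] using
        (tendsto_pow_const_div_const_pow_of_one_lt k (one_lt_two (α := ℝ))).const_mul a
  filter_upwards [h.eventually_lt_const one_pos] with n hn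
  rw [div_lt_one (by positivity)] at hn
  exact hn.le

theorem KeyGen.privateAgainstServer (G : KeyGen) (hDCR : DCR G.factors) :
    G.PrivateAgainstServer := by
  obtain ⟨S, hS⟩ := Simulator.pt_sim.exists_ppt
  refine ⟨S, fun l D adv ⟨la, hla⟩ p hp => ?_⟩
  obtain ⟨D', hD'⟩ := (Reduction.pt_run G.base D).exists_ppt
  let lr : Polynomial ℝ := l.map (Nat.castRingHom ℝ)
  -- Exceeds the number of all samples: at most `l` previous components, `l` coins and `l * l`
  -- messages, with one to spare for strictness.
  let q : Polynomial ℝ := 2 * lr + lr * lr + 1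
  have hq : ∀ n : ℕ, q.eval (n : ℝ) = 2 * (l.eval n : ℕ) + (l.eval n : ℕ) * (l.eval n : ℕ) + 1 :=
    fun n => by simp [q, lr]
  have hq1 : ∀ n : ℕ, 1 ≤ q.eval (n : ℝ) := fun n => by
    rw [hq, le_add_iff_nonneg_left]; positivity
  have hp' : ∀ n : ℕ, 0 < (2 * p * q).eval (n : ℝ) := fun n => by
    have := hp n
    have := hq1 n
    simp only [Polynomial.eval_mul, Polynomial.eval_ofNat]
    positivity
  let R : Polynomial ℕ := la + Reduction.adviceBound.comp l + 1
  -- Advice of admissible length with which the reduction violates the required DCR bound.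
  let E : ℕ → Val → Prop := fun n A => A.size ≤ R.eval n ∧ 1 / (2 * p * q).eval (n : ℝ) ≤
    |acceptProb D' n A (residueSample G.factors n) - acceptProb D' n A (unitSample G.factors n)|
  classical
  -- One violating advice for each `n` if there is any. Since DCR defeats this single sequence, for
  -- large `n` no violating advice exists, so all instances and all hybrids are covered at once. The
  -- default `0` only has to be short.
  let adv' : ℕ → Val := fun n => if h : ∃ A, E n A then h.choose else .num 0
  have hadv' : ∀ n, (adv' n).size ≤ R.eval n := fun n => by
    by_cases h : ∃ A, E n A
    · simp only [adv', dif_pos h]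
      exact h.choose_spec.1
    · simp only [adv', dif_neg h]
      simp [Val.size, R]
  filter_upwards [hDCR D' adv' ⟨R, hadv'⟩ _ hp', G.factors_size, eventually_ge_atTop 3,
    Polynomial.eventually_eval_le_two_pow (20 * q * q * p)] with n h1 hsize hn3 hexp
  rintro ⟨J, hJ, hJs⟩
  have hno : ∀ A, ¬ E n A := fun A hA => by
    have hex : ∃ A, E n A := ⟨A, hA⟩
    have h2 := h1 ()
    simp only [adv', dif_pos hex] at h2
    exact absurd hex.choose_spec.2 (not_le.2 h2)
  have hn : 5 ≤ 2 ^ n := by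
    calc 5 ≤ 2 ^ 3 := by norm_num
      _ ≤ 2 ^ n := Nat.pow_le_pow_right (by norm_num) hn3
  have key := KeyGen.abs_acceptProb_sub_le hsize hn hJ hS hD' (D := D) (A := adv n)
    (ε := 1 / (2 * p * q).eval (n : ℝ)) fun L₁ l₁ a l₂ L₂ hP => by
      by_contra hlt
      refine hno (.pair (adv n) (Reduction.advice J L₁ l₁ a l₂ L₂)) ⟨?_, (not_le.1 hlt).le⟩
      have h2 := Reduction.size_advice_le hP
      have h3 := Reduction.adviceBound.eval_mono_nat hJs
      have h4 := hla n
      simp only [Val.size, R, Polynomial.eval_add, Polynomial.eval_comp,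
        Polynomial.eval_one] at h3 ⊢
      omega
  refine key.trans_lt ?_
  set s := l.eval n with hs
  have hB : ((J.dim + J.numCoins + J.numMessages : ℕ) : ℝ) ≤ q.eval (n : ℝ) - 1 := by
    have h2 : J.dim + J.numCoins + J.numMessages ≤ 2 * s + s * s := by
      have := J.dim_lt_size
      have := J.numCoins_lt_size
      have := J.numMessages_le.trans (Nat.mul_le_mul hJs hJs)
      omega
    rw [hq]
    have h3 : ((J.dim + J.numCoins + J.numMessages : ℕ) : ℝ) ≤ (2 * s + s * s : ℕ) :=
      Nat.cast_le.2 h2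
    push_cast at h3 ⊢
    linarith
  have hmB : (J.numMessages : ℝ) ≤ ((J.dim + J.numCoins + J.numMessages : ℕ) : ℝ) :=
    Nat.cast_le.2 (by omega)
  have hP := hp n
  have hQ := hq1 n
  simp only [Polynomial.eval_mul, Polynomial.eval_ofNat] at hexp ⊢
  have hpow : (0 : ℝ) < 2 ^ n := by positivity
  have hm0 : (0 : ℝ) ≤ J.numMessages := Nat.cast_nonneg _
  have hB0 : (0 : ℝ) ≤ ((J.dim + J.numCoins + J.numMessages : ℕ) : ℝ) := Nat.cast_nonneg _
  generalize ((J.dim + J.numCoins + J.numMessages : ℕ) : ℝ) = B at *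
  generalize (J.numMessages : ℝ) = m at *
  generalize p.eval (n : ℝ) = P at *
  generalize q.eval (n : ℝ) = Q at *
  generalize (2 : ℝ) ^ n = X at *
  -- Half of the allowed advantage goes to the sampling error and the other half, in `e2`, to the
  -- DCR advantage summed over the messages.
  have hδ : 10 * Q * Q / X ≤ 1 / (2 * P) := by
    rw [div_le_div_iff₀ hpow (by positivity)]
    linarith
  have e1 : B * (5 / X) * (1 + 2 * m) ≤ 10 * Q * Q / X := by
    rw [← mul_div_assoc, div_mul_eq_mul_div, div_le_div_iff_of_pos_right hpow]
    nlinarith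
  have e2 : m * (1 / (2 * P * Q)) < 1 / (2 * P) := by
    rw [mul_one_div, div_lt_div_iff₀ (by positivity) (by positivity)]
    have : m < Q := by linarith
    nlinarith
  have e3 : 1 / (2 * P) + 1 / (2 * P) = 1 / P := by field_simp; norm_num
  calc B * (5 / X) + m * (1 / (2 * P * Q) + 2 * (B * (5 / X)))
      = B * (5 / X) * (1 + 2 * m) + m * (1 / (2 * P * Q)) := by ring
    _ < 1 / P := by linarith

theorem theorem1 (G : KeyGen) (hDCR : DCR G.factors) :
    G.Computes ∧ G.PrivateAgainstServer :=
  ⟨G.computes, G.privateAgainstServer hDCR⟩
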